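/- Let $G$ be a triangulated graph, i.e. a finite simple graph embedded in the plane such that every face, including the unbounded one, is bounded by a cycle of length $3$. Then $$\mathrm{Hh}(G)\le \mathrm{GMh}(G),$$ where the two parameters are defined as follows. \emph{Grid-major height.} $\mathrm{GMh}(G)$ is the least $H$ such that, for some $W$, the points of the $W\times H$ grid can be labelled by vertices of $G$ so that every vertex occurs as a label, the points with label $v$ induce a connected subgraph of the grid for every vertex $v$, and for every edge $vw$ of $G$ some grid edge has ends labelled $v$ and $w$. \emph{Homotopy height.} Choose as outer face either a face of $G$, or the new face of degree $2$ obtained by doubling an edge of $G$; all other faces are inner. Choose vertices $u,v$ on the outer face ($u=v$ allowed). They split its boundary into two paths $s$ and $t$ (if $u=v$, one is trivial and the other is the whole boundary), named such that $u,t,v,s$ is the clockwise order. A homotopy is a sequence $h_0,\dots,h_W$ of walks, each starting at a vertex of $s$ and ending at a vertex of $t$, where $h_0$ is the trivial walk at $u$, $h_W$ is the trivial walk at $v$, and each $h_{i+1}$ arises from $h_i$ by one of the following moves or its reverse: a face-flip, replacing a subwalk $x\,y$ by $x\,z\,y$ for an inner face $xyz$; an edge-slide, replacing $z\,x\,w$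 by $z\,y\,w$ for inner faces $xyz$ and $xyw$ on the two sides of the edge $xy$; a spike, replacing $x$ by $x\,y\,x$, traversing an edge $xy$ back and forth; a boundary-move, adding an edge of $s$ at the start or an edge of $t$ at the end of the walk; a boundary-edge-slide, replacing the initial $x\,z$ of the walk by $y\,z$ for an edge $xy$ of $s$ with incident inner face $xyz$, or the final $z\,x$ by $z\,y$ for an edge $xy$ of $t$ with incident inner face $xyz$. Whenever a face-flip, edge-slide or boundary-edge-slide flips a face, the flip counts $+1$ if the face lies to the right of $h_i$ and $-1$ if it lies to the left; it is required that these signs add up to $1$ for every inner face. The height of a homotopy is the largest number of vertices (with multiplicity) of a walk $h_i$, and $\mathrm{Hh}(G)$ is the least height of a homotopy over all choices of outer face and of $u,v$. -/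

import Mathlib

namespace GridHomotopy

/-! ### Combinatorial maps and triangulated planar graphs -/

/-- A combinatorial map: every edge is split into two opposite darts `d`, `rev d`; the dart `d`
leaves the vertex `tail d`; and `face d` is the dart that follows `d` on the boundary of the face
lying to the left of `d`. Parallel edges are possible. The faces are the cycles of `face`. -/
structure CombMap (V D : Type*) where
  tail : D → V
  rev : D → D
  face : Equiv.Perm D
  rev_rev : ∀ d, rev (rev d) = d
  rev_ne : ∀ d, rev d ≠ d
  tail_face : ∀ d, tail (face d) = tail (rev d)

/-- The vertex at which a dart arrives. -/
def CombMap.head {V D : Type*} (M : CombMap V D) (d : D) : V := M.tail (M.rev d)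

/-- Reversal of the darts of a simple graph, as a permutation. -/
def dartRev {V : Type*} (G : SimpleGraph V) : Equiv.Perm G.Dart where
  toFun := SimpleGraph.Dart.symm
  invFun := SimpleGraph.Dart.symm
  left_inv d := d.symm_symm
  right_inv d := d.symm_symm

/-- A planar embedding (as a rotation system) of a finite connected simple graph with at least
one edge. The permutation `d ↦ face (d.symm)` is the rotation of the darts around their common
initial vertex, and genus zero is expressed by Euler's formula `|V| - |E| + |F| = 2`. -/
structure PlanarEmbedding {V : Type*} (G : SimpleGraph V) where
  face : Equiv.Perm G.Dart
  face_fst : ∀ d, (face d).fst = d.snd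
  rotation : ∀ d d' : G.Dart, d.fst = d'.fst → (face * dartRev G).SameCycle d d'
  connected : G.Connected
  euler : Nat.card V + Nat.card (Quotient (Equiv.Perm.SameCycle.setoid face)) =
    Nat.card G.edgeSet + 2

/-- A triangulated planar graph: a simple graph with a planar embedding all of whose faces are
bounded by a cycle of length 3. (As `G` is simple, the cycle is a simple one.) -/
structure Triangulation {V : Type*} (G : SimpleGraph V) extends PlanarEmbedding G where
  face_three : ∀ d, face (face (face d)) = d

/-- The combinatorial map of an embedded simple graph. -/
def Triangulation.toMap {V : Type*} {G : SimpleGraph V} (T : Triangulation G) :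
    CombMap V G.Dart where
  tail d := d.fst
  rev d := d.symm
  face := T.face
  rev_rev d := d.symm_symm
  rev_ne d := d.symm_ne
  tail_face := T.face_fst

/-- Reversal of darts after doubling an edge. -/
def doubleRev {V : Type*} {G : SimpleGraph V} : G.Dart ⊕ Bool → G.Dart ⊕ Bool
  | .inl d => .inl d.symm
  | .inr b => .inr (!b)

/-- Initial vertices of darts after doubling the edge of `e`; the new darts are `inr false`,
parallel to `e`, and its reversal `inr true`. -/
def doubleTail {V : Type*} {G : SimpleGraph V} (e : G.Dart) : G.Dart ⊕ Bool → V
  | .inl d => d.fst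
  | .inr false => e.fst
  | .inr true => e.snd

open Classical in
/-- The face permutation after doubling the edge of `e`: the dart `inr true` takes the place of
`e.symm` on the face to the left of `e.symm`, and `inr false`, `e.symm` bound the new face of
degree 2. -/
noncomputable def doubleFace {V : Type*} {G : SimpleGraph V} (T : Triangulation G) (e : G.Dart) :
    Equiv.Perm (G.Dart ⊕ Bool) :=
  Equiv.swap (.inl e.symm) (.inr true) * Equiv.sumCongr T.face (Equiv.refl Bool) *
    Equiv.swap (.inl e.symm) (.inr true) * Equiv.swap (.inl e.symm) (.inr false)

theorem Triangulation.face_ne {V : Type*} {G : SimpleGraph V} (T : Triangulation G)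
    (d : G.Dart) : T.face d ≠ d := by
  intro h
  have h1 := T.face_fst d
  rw [h] at h1
  exact d.fst_ne_snd h1

theorem doubleFace_new {V : Type*} {G : SimpleGraph V} (T : Triangulation G) (e : G.Dart) :
    doubleFace T e (.inr false) = .inl e.symm := by
  simp [doubleFace]

theorem doubleFace_symm {V : Type*} {G : SimpleGraph V} (T : Triangulation G) (e : G.Dart) :
    doubleFace T e (.inl e.symm) = .inr false := by
  simp [doubleFace, Equiv.swap_apply_of_ne_of_ne]

open Classical in
theorem doubleFace_newRev {V : Type*} {G : SimpleGraph V} (T : Triangulation G) (e : G.Dart) :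
    doubleFace T e (.inr true) = .inl (T.face e.symm) := by
  have h : doubleFace T e (.inr true) =
      Equiv.swap (.inl e.symm) (.inr true) (.inl (T.face e.symm)) := by
    simp [doubleFace, Equiv.swap_apply_of_ne_of_ne]
  rw [h]
  exact Equiv.swap_apply_of_ne_of_ne (by simpa using T.face_ne _) (by simp)

open Classical in
theorem doubleFace_old {V : Type*} {G : SimpleGraph V} (T : Triangulation G) (e d : G.Dart)
    (hd : d ≠ e.symm) :
    (T.face d = e.symm → doubleFace T e (.inl d) = .inr true) ∧
    (T.face d ≠ e.symm → doubleFace T e (.inl d) = .inl (T.face d)) := by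
  have h1 : (Sum.inl d : G.Dart ⊕ Bool) ≠ .inl e.symm := by simpa using hd
  have h : doubleFace T e (.inl d) =
      Equiv.swap (.inl e.symm) (.inr true) (.inl (T.face d)) := by
    simp [doubleFace, Equiv.swap_apply_of_ne_of_ne h1]
  rw [h]
  refine ⟨fun h2 => by rw [h2]; simp, fun h2 => ?_⟩
  exact Equiv.swap_apply_of_ne_of_ne (by simpa using h2) (by simp)

/-- The map obtained by doubling the edge of `e`. -/
noncomputable def Triangulation.double {V : Type*} {G : SimpleGraph V} (T : Triangulation G)
    (e : G.Dart) : CombMap V (G.Dart ⊕ Bool) where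
  tail := doubleTail e
  rev := doubleRev
  face := doubleFace T e
  rev_rev d := by rcases d with d | b <;> simp [doubleRev]
  rev_ne d := by
    rcases d with d | b
    · simpa [doubleRev] using d.symm_ne
    · cases b <;> simp [doubleRev]
  tail_face d := by
    rcases d with d | b
    · by_cases hd : d = e.symm
      · subst hd
        rw [doubleFace_symm]
        simp [doubleTail, doubleRev]
      · by_cases h : T.face d = e.symm
        · rw [(doubleFace_old T e d hd).1 h]
          have h1 := T.face_fst d
          rw [h] at h1
          simpa [doubleTail, doubleRev] using h1
        · rw [(doubleFace_old T e d hd).2 h]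
          simpa [doubleTail, doubleRev] using T.face_fst d
    · cases b
      · rw [doubleFace_new]
        simp [doubleTail, doubleRev]
      · rw [doubleFace_newRev]
        simpa [doubleTail, doubleRev] using T.face_fst e.symm

/-! ### Homotopies -/

/-- A curve: its first vertex, the darts it traverses, its last vertex. -/
structure Curve (V D : Type*) where
  src : V
  darts : List D
  tgt : V

/-- The number of vertices of a curve, counted with multiplicity. -/
def Curve.length {V D : Type*} (c : Curve V D) : ℕ := c.darts.length + 1

/-- `M.IsWalk x l y`: the darts of `l` form a walk from `x` to `y`. -/
def CombMap.IsWalk {V D : Type*} (M : CombMap V D) : V → List D → V → Prop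
  | x, [], y => x = y
  | x, d :: l, y => M.tail d = x ∧ M.IsWalk (M.head d) l y

open Classical in
/-- The contribution of one positive flip of the face to the left of `a`, as a function on darts
which is constant on faces. -/
noncomputable def CombMap.flip {V D : Type*} (M : CombMap V D) (a : D) : D → ℤ :=
  fun d => if M.face.SameCycle a d then 1 else 0

/-- The moves (up to reversal) of a homotopy in a map with outer face the one to the left of `o`,
all other faces being triangles, where `s` and `t` are the sets of outer darts on which the curves
start and end. An inner face is traversed as `a, face a, face (face a)`, with the face to the
left, so that it lies to the right of a curve that uses the reversals of these darts.
In every constructor the flipped faces lie to the right of the first curve;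
the last argument records the signed flips. -/
inductive CombMap.PosMove {V D : Type*} (M : CombMap V D) (o : D) (s t : Set D) :
    Curve V D → Curve V D → (D → ℤ) → Prop
  /-- face-flip, from one edge of the face to the other two -/
  | flipUp (x y : V) (pre post : List D) (a : D) (ha : ¬ M.face.SameCycle o a) :
      PosMove M o s t
        ⟨x, pre ++ [M.rev a] ++ post, y⟩
        ⟨x, pre ++ [M.face a, M.face (M.face a)] ++ post, y⟩
        (M.flip a)
  /-- face-flip, from two edges of the face to the third -/
  | flipDown (x y : V) (pre post : List D) (a : D) (ha : ¬ M.face.SameCycle o a) :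
      PosMove M o s t
        ⟨x, pre ++ [M.rev (M.face (M.face a)), M.rev (M.face a)] ++ post, y⟩
        ⟨x, pre ++ [a] ++ post, y⟩
        (M.flip a)
  /-- edge-slide along the edge of `a`, flipping both incident faces -/
  | edgeSlide (x y : V) (pre post : List D) (a : D) (ha : ¬ M.face.SameCycle o a)
      (ha' : ¬ M.face.SameCycle o (M.rev a)) :
      PosMove M o s t
        ⟨x, pre ++ [M.rev (M.face (M.rev a)), M.rev (M.face (M.face a))] ++ post, y⟩
        ⟨x, pre ++ [M.face (M.face (M.rev a)), M.face a] ++ post, y⟩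
        (M.flip a + M.flip (M.rev a))
  /-- spike along the edge of `d` (the reversal is an unspike) -/
  | spike (x y : V) (pre post : List D) (d : D) :
      PosMove M o s t
        ⟨x, pre ++ post, y⟩
        ⟨x, pre ++ [d, M.rev d] ++ post, y⟩
        0
  /-- boundary-move at the start of the curve -/
  | boundaryStart (x y : V) (l : List D) (d : D) (hd : d ∈ s ∨ M.rev d ∈ s) :
      PosMove M o s t
        ⟨x, l, y⟩
        ⟨M.tail d, d :: l, y⟩
        0
  /-- boundary-move at the end of the curve -/
  | boundaryEnd (x y : V) (l : List D) (d : D) (hd : d ∈ t ∨ M.rev d ∈ t) :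
      PosMove M o s t
        ⟨x, l, y⟩
        ⟨x, l ++ [d], M.head d⟩
        0
  /-- boundary-edge-slide at the start of the curve -/
  | slideStart (y : V) (l : List D) (a : D) (ha : ¬ M.face.SameCycle o a) (has : M.rev a ∈ s) :
      PosMove M o s t
        ⟨M.tail a, M.rev (M.face (M.face a)) :: l, y⟩
        ⟨M.head a, M.face a :: l, y⟩
        (M.flip a)
  /-- boundary-edge-slide at the end of the curve -/
  | slideEnd (x : V) (l : List D) (a : D) (ha : ¬ M.face.SameCycle o a) (hat : M.rev a ∈ t) :
      PosMove M o s t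
        ⟨x, l ++ [M.rev (M.face a)], M.head a⟩
        ⟨x, l ++ [M.face (M.face a)], M.tail a⟩
        (M.flip a)

/-- A move of a homotopy with its signed flips: one of the moves above, or the reversal of one,
whose flips are then negative. -/
def CombMap.Move {V D : Type*} (M : CombMap V D) (o : D) (s t : Set D)
    (c c' : Curve V D) (φ : D → ℤ) : Prop :=
  M.PosMove o s t c c' φ ∨ M.PosMove o s t c' c (-φ)

/-- The set of outer darts `face^i r`, `i ∈ [j, k)`. -/
def CombMap.arc {V D : Type*} (M : CombMap V D) (r : D) (j k : ℕ) : Set D :=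
  {d | ∃ i, j ≤ i ∧ i < k ∧ d = (M.face ^ i) r}

/-- The vertices of the path formed by the darts `face^i r`, `i ∈ [j, k)`. -/
def CombMap.arcVerts {V D : Type*} (M : CombMap V D) (r : D) (j k : ℕ) : Set V :=
  {x | ∃ i, j ≤ i ∧ i ≤ k ∧ x = M.tail ((M.face ^ i) r)}

/-- A homotopy in the map `M` whose outer face is the one to the left of `o`, the other faces
being triangles. The darts `root, face root, face² root, …` run clockwise around the outer face
(the inner faces are on their right). The initial vertex `u` is the tail of `root`, the final
vertex `v` is reached after `cut` steps; the steps before form the path `t(uv)` and the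
remaining ones, back to `u`, the path `s(vu)`. If `u = v`, one of the two paths is trivial and
the other one is the whole boundary. -/
structure Homotopy {V D : Type*} (M : CombMap V D) (o : D) where
  root : D
  root_outer : M.face.SameCycle o root
  cut : ℕ
  cut_le : cut ≤ Function.minimalPeriod M.face root
  /-- the index of the last curve -/
  last : ℕ
  curve : ℕ → Curve V D
  /-- the signed face-flips of the `i`-th move -/
  flips : ℕ → D → ℤ
  isWalk : ∀ i ≤ last, M.IsWalk (curve i).src (curve i).darts (curve i).tgt
  curve_zero : curve 0 = ⟨M.tail root, [], M.tail root⟩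
  curve_last : curve last =
    ⟨M.tail ((M.face ^ cut) root), [], M.tail ((M.face ^ cut) root)⟩
  src_mem : ∀ i ≤ last,
    (curve i).src ∈ M.arcVerts root cut (Function.minimalPeriod M.face root)
  tgt_mem : ∀ i ≤ last, (curve i).tgt ∈ M.arcVerts root 0 cut
  move : ∀ i < last, M.Move o
    (M.arc root cut (Function.minimalPeriod M.face root)) (M.arc root 0 cut)
    (curve i) (curve (i + 1)) (flips i)
  /-- topological non-triviality: each inner face has algebraic flipping number one -/
  nontrivial : ∀ d, ¬ M.face.SameCycle o d → ∑ i ∈ Finset.range last, flips i d = 1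

/-- The height of a homotopy: the maximal number of vertices of its curves. -/
def Homotopy.height {V D : Type*} {M : CombMap V D} {o : D} (h : Homotopy M o) : ℕ :=
  (Finset.range (h.last + 1)).sup fun i => (h.curve i).length

/-- The homotopy height: the minimal height of a homotopy over all choices of an outer-face
(the face to the left of a dart `o`) and all choices of an outer-edge (the edge of a dart `e`,
which is doubled, with the new face of degree 2 as outer face). It is `⊤` if there is none. -/
noncomputable def homotopyHeight {V : Type*} {G : SimpleGraph V} (T : Triangulation G) : ℕ∞ :=
  (⨅ (o : G.Dart) (h : Homotopy T.toMap o), (h.height : ℕ∞)) ⊓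
    (⨅ (e : G.Dart) (h : Homotopy (T.double e) (Sum.inr false)), (h.height : ℕ∞))

/-! ### Grid-major height -/

/-- The `W × H` grid. -/
def gridGraph (W H : ℕ) : SimpleGraph (Fin W × Fin H) :=
  SimpleGraph.boxProd (SimpleGraph.pathGraph W) (SimpleGraph.pathGraph H)

/-- A grid-representation of `G` in the `W × H` grid. -/
structure GridRepresentation {V : Type*} (G : SimpleGraph V) (W H : ℕ) where
  label : Fin W × Fin H → V
  surjective : Function.Surjective label
  connected : ∀ v, ((gridGraph W H).induce {p | label p = v}).Connected
  edge : ∀ v w, G.Adj v w → ∃ p q, (gridGraph W H).Adj p q ∧ label p = v ∧ label q = w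

/-- The grid-major height: the least `H` such that `G` has a grid-representation in a grid of
height `H` (and `⊤` if there is none). -/
noncomputable def gridMajorHeight {V : Type*} (G : SimpleGraph V) : ℕ∞ :=
  ⨅ (W : ℕ) (H : ℕ) (_ : GridRepresentation G W H), (H : ℕ∞)

end GridHomotopy

/-! Read the columns of a grid representation of height H as walks in G, skipping repeated labels.
Each has at most H vertices. The task is to show that passing from one column to the next decomposes
into legal moves and that every inner face is swept exactly once.

Preparation. Constant columns at both ends make the first and last walk trivial. If the whole grid
boundary carries one label, a narrow channel brings another label to it
(`GridLabelling.exists_boundary`). A staircase refinement lets consecutive columns differ in at most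
one point. The result is a `Sweep`.

Rigidity. Contract the monochromatic grid edges. The bichromatic ones form a plane multigraph on the
vertices of G, whose faces are the unit squares and the outside. Planarity is used only in mod-2
cohomological form: a function on edges that sums to zero around every face is a coboundary
(`GridLabelling.isPlanar`). This holds because the grid is simply connected and the label classes
are connected. The multigraph realizes every edge of G, and G has the extremal number 3|V| - 6 of
edges. A dimension count therefore forces every face to have degree 0, 2 or 3, and every dart of G
to lie on exactly one triangular face (`FaceSystem.IsPlanar.count`, `FaceSystem.IsPlanar.rigid`).

Uniqueness. The triangular faces form a `TriangleSystem` on G. A mod-2 Jordan curve argument in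
place of Whitney's theorem shows that such a system is the set of faces of the given embedding, or
its mirror image (`TriangleSystem.consecutive`, `TriangleSystem.eq_or_eq_reverse`). In the mirror
case the order of the columns is reversed.

Homotopy. The outside has degree 3 or 2. In the first case it is a face of G. In the second it
becomes the new digon after doubling an edge, and the parallel copies of that edge in the grid have
to be distributed over the two edges of the doubled pair. When one point of a column changes its
label, the two squares next to the horizontal edge of that change are each degenerate or a triangle,
and the combinations are exactly the moves of a homotopy or no change at all
(`CombMap.Move.of_up_low`). Each inner face is one triangular square, so its flips sum to 1. -/

namespace GridHomotopy

/-! ### Uniqueness of the embedding of a triangulation -/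

/-- A system of oriented triangles on the darts of `G`, `f d` being the dart following `d`, such
that every symmetric mod-2 function on darts that vanishes on all triangles is a coboundary. -/
structure TriangleSystem {V : Type*} (G : SimpleGraph V) (f : G.Dart → G.Dart) : Prop where
  fst : ∀ d, (f d).fst = d.snd
  three : ∀ d, f (f (f d)) = d
  potential : ∀ ω : G.Dart → ZMod 2, (∀ d, ω d.symm = ω d) →
    (∀ d, ω d + ω (f d) + ω (f (f d)) = 0) →
    ∃ φ : V → ZMod 2, ∀ d, ω d = φ d.fst + φ d.snd

section Uniqueness

variable {V : Type*} {G : SimpleGraph V}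

theorem dart_ext {d d' : G.Dart} (h₁ : d.fst = d'.fst) (h₂ : d.snd = d'.snd) : d = d' :=
  SimpleGraph.Dart.ext _ _ (Prod.ext h₁ h₂)

theorem dart_symm_eq_iff {d d' : G.Dart} : d.symm = d' ↔ d = d'.symm :=
  ⟨fun h => by rw [← h, d.symm_symm], fun h => by rw [h, d'.symm_symm]⟩

theorem TriangleSystem.snd_snd {f : G.Dart → G.Dart} (hf : TriangleSystem G f) (d : G.Dart) :
    (f (f d)).snd = d.fst := by
  rw [← hf.fst, hf.three]

theorem TriangleSystem.snd_ne {f : G.Dart → G.Dart} (hf : TriangleSystem G f) (d : G.Dart) :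
    (f d).snd ≠ d.fst := by
  rw [← hf.snd_snd d, ← hf.fst]
  exact (f (f d)).fst_ne_snd

theorem TriangleSystem.rot_ne {f : G.Dart → G.Dart} (hf : TriangleSystem G f) (d : G.Dart) :
    f d.symm ≠ d := by
  intro h
  have := hf.snd_ne d.symm
  rw [h] at this
  exact this rfl

theorem TriangleSystem.injective {f : G.Dart → G.Dart} (hf : TriangleSystem G f) :
    Function.Injective f := fun a b h => by
  rw [← hf.three a, h, hf.three]

theorem zmod_two_add_eq_zero {a b : ZMod 2} : a + b = 0 ↔ a = b := by
  rw [CharTwo.add_eq_zero]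

/-- A mod-2 Jordan curve theorem for a closed walk of length three: `w` colours the triangles of the
system by the two sides of the curve, so the colour changes across edges of the curve only. It is
the dual form of `potential`: if first cohomology vanishes, then cycles bound. -/
theorem TriangleSystem.exists_coloring [Finite V] {f : G.Dart → G.Dart}
    (hf : TriangleSystem G f) {a b c : G.Dart} (hab : a.snd = b.fst) (hbc : b.snd = c.fst)
    (hca : c.snd = a.fst) :
    ∃ w : G.Dart → ZMod 2, (∀ d, w (f d) = w d) ∧
      ((∀ d, d ≠ a → d ≠ b → d ≠ c → d.symm ≠ a → d.symm ≠ b → d.symm ≠ c → w d.symm = w d) ∧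
      (a.symm ≠ b → a.symm ≠ c → a ≠ b → a ≠ c → w a.symm = w a + 1)) := by
  classical
  have : Finite G.Dart := Finite.of_injective _ SimpleGraph.Dart.toProd_injective
  let A : (G.Dart → ZMod 2) →ₗ[ZMod 2] (G.Dart → ZMod 2) :=
    LinearMap.id + LinearMap.funLeft (ZMod 2) (ZMod 2) SimpleGraph.Dart.symm
  let I : Submodule (ZMod 2) (G.Dart → ZMod 2) :=
    LinearMap.ker (LinearMap.funLeft (ZMod 2) (ZMod 2) f - LinearMap.id)
  have hA : ∀ w d, A w d = w d + w d.symm := fun w d => rfl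
  have hI : ∀ w, w ∈ I ↔ ∀ d, w (f d) = w d := fun w => by
    simp only [I, LinearMap.mem_ker, funext_iff, LinearMap.sub_apply,
      LinearMap.funLeft_apply, LinearMap.id_apply, sub_eq_zero]
  let e : G.Dart → (G.Dart → ZMod 2) := fun d => Pi.single d 1
  have he : ∀ d d', e d d' = if d' = d then 1 else 0 := fun d d' => by
    simp [e, Pi.single_apply]
  -- Otherwise a linear functional kills the boundaries of all triangle colourings but not the
  -- curve. Read as a function on edges it vanishes on triangles, hence is a coboundary, and a
  -- coboundary sums to zero around the curve.
  have key : A (e a + e b + e c) ∈ I.map A := by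
    by_contra hn
    obtain ⟨ψ, hψ, hle⟩ := Submodule.exists_le_ker_of_notMem hn
    apply hψ
    obtain ⟨φ, hφ⟩ := hf.potential (fun d => ψ (A (e d))) (fun d => by
      congr 1
      ext d'
      simp only [hA, he]
      rw [add_comm]
      simp only [dart_symm_eq_iff, SimpleGraph.Dart.symm_symm]) (fun d => by
      rw [← map_add, ← map_add, ← map_add, ← map_add]
      have h1 : e d + e (f d) + e (f (f d)) ∈ I := by
        rw [hI]
        intro d'
        have h1 : (f d' = d) = (d' = f (f d)) := by
          apply propext
          constructor
          · rintro rfl; rw [hf.three]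
          · rintro rfl; rw [hf.three]
        have h2 : (f d' = f d) = (d' = d) := propext hf.injective.eq_iff
        have h3 : (f d' = f (f d)) = (d' = f d) := propext hf.injective.eq_iff
        simp only [Pi.add_apply, he, h1, h2, h3]
        ring
      exact hle (Submodule.mem_map_of_mem h1))
    rw [map_add, map_add, map_add, map_add, hφ a, hφ b, hφ c, hab, hbc, hca]
    linear_combination (CharTwo.add_self_eq_zero (φ a.fst)) +
      (CharTwo.add_self_eq_zero (φ b.fst)) + (CharTwo.add_self_eq_zero (φ c.fst))
  obtain ⟨w, hw, hwA⟩ := key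
  refine ⟨w, (hI w).1 hw, fun d h1 h2 h3 h4 h5 h6 => ?_, fun h1 h2 h3 h4 => ?_⟩
  · have := congrFun hwA d
    simp only [hA, Pi.add_apply, he, h1, h2, h3, h4, h5, h6, if_false, add_zero] at this
    exact (zmod_two_add_eq_zero.1 this).symm
  · have := congrFun hwA a
    simp only [hA, Pi.add_apply, he, h1, h2, h3, h4, a.symm_ne, if_false, if_true,
      add_zero] at this
    linear_combination this - CharTwo.add_self_eq_zero (w a)

theorem Triangulation.triangleSystem_three (T : Triangulation G) (d : G.Dart) :
    (T.face (T.face d)).snd = d.fst := by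
  rw [← T.face_fst, T.face_three]

/-- A function on the darts leaving a vertex which is invariant under the rotation of a
triangulation is constant. -/
theorem Triangulation.rot_induction (T : Triangulation G) {p : G.Dart → Prop} {d : G.Dart}
    (hd : p d) (h : ∀ a, a.fst = d.fst → p a → p (T.face a.symm)) (hfin : Finite V)
    {d' : G.Dart} (h' : d'.fst = d.fst) : p d' := by
  have : Finite G.Dart := Finite.of_injective _ SimpleGraph.Dart.toProd_injective
  obtain ⟨n, hn⟩ := (T.rotation d d' h'.symm).exists_nat_pow_eq
  have key : ∀ n : ℕ, (((T.face * dartRev G) ^ n) d).fst = d.fst ∧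
      p (((T.face * dartRev G) ^ n) d) := by
    intro n
    induction n with
    | zero => exact ⟨rfl, hd⟩
    | succ n ih =>
      rw [pow_succ', Equiv.Perm.mul_apply]
      refine ⟨?_, h _ ih.1 ih.2⟩
      rw [← ih.1]
      exact T.face_fst _
  rw [← hn]
  exact (key n).2

/-- A triangle system is not assumed to have a transitive rotation at each vertex; this is the
substitute. It combines the vanishing cohomology of the system with the connected link of the vertex
in `T`. -/
theorem TriangleSystem.rot_const [hfin : Finite V] (T : Triangulation G) {f : G.Dart → G.Dart}
    (hf : TriangleSystem G f) {g : G.Dart → ZMod 2} {d d' : G.Dart} (h : d.fst = d'.fst)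
    (hg : ∀ a, a.fst = d.fst → g (f a.symm) = g a) : g d = g d' := by
  classical
  let p := d.fst
  -- `g` is spread over the edges at `p` and extended by zero. A triangle through `p` meets these
  -- edges in two rotation-consecutive darts, so rotation invariance makes `ω` closed.
  let ω : G.Dart → ZMod 2 := fun a =>
    if a.fst = p then g a else if a.snd = p then g a.symm else 0
  have h0 : ∀ a : G.Dart, a.fst = p → ω a + ω (f a) + ω (f (f a)) = 0 := by
    intro a ha
    have h1 : (f a).fst ≠ p := by rw [hf.fst, ← ha]; exact a.snd_ne_fst
    have h2 : (f a).snd ≠ p := by rw [← ha]; exact hf.snd_ne a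
    have h3 : (f (f a)).fst ≠ p := by rw [hf.fst]; exact h2
    have h4 : (f (f a)).snd = p := by rw [hf.snd_snd, ha]
    have h5 := hg (f (f a)).symm h4
    rw [SimpleGraph.Dart.symm_symm, hf.three] at h5
    simp only [ω, ha, h1, h2, h3, h4, if_true, if_false, add_zero]
    rw [h5]
    exact CharTwo.add_self_eq_zero _
  obtain ⟨φ, hφ⟩ := hf.potential ω
    (fun a => by
      simp only [ω]
      by_cases h1 : a.fst = p
      · have h2 : a.snd ≠ p := by rw [← h1]; exact a.snd_ne_fst
        simp [h1, h2, SimpleGraph.Dart.symm]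
      · by_cases h2 : a.snd = p <;> simp [h1, h2])
    (fun a => by
      by_cases h1 : a.fst = p
      · exact h0 a h1
      by_cases h2 : (f a).fst = p
      · have := h0 _ h2
        rw [hf.three] at this
        rw [← this]; ring
      by_cases h3 : (f (f a)).fst = p
      · have := h0 _ h3
        rw [hf.three] at this
        rw [← this]; ring
      have h4 : a.snd ≠ p := by rwa [← hf.fst]
      have h5 : (f a).snd ≠ p := by rwa [← hf.fst]
      have h6 : (f (f a)).snd ≠ p := by rwa [← hf.fst, hf.three]
      simp [ω, h1, h2, h3, h4, h5, h6])
  have hd' : ∀ a : G.Dart, a.fst = p → g a = φ p + φ a.snd := fun a ha => by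
    rw [← ha, ← hφ a]; simp [ω, ha]
  -- Consecutive neighbours of `p` in `T` are joined by an edge avoiding `p`, on which `ω` is zero,
  -- so the potential is constant along the link.
  have : φ d.snd = φ d'.snd := by
    refine T.rot_induction (p := fun a => φ d.snd = φ a.snd) rfl (fun a ha hh => ?_) hfin h.symm
    have h1 := hφ (T.face (T.face a.symm))
    have h2 : (T.face (T.face a.symm)).snd = a.snd := T.triangleSystem_three _
    have h3 : (T.face (T.face a.symm)).fst = (T.face a.symm).snd := T.face_fst _
    have h4 : (T.face a.symm).fst = p := by rw [T.face_fst]; exact ha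
    have h5 : ω (T.face (T.face a.symm)) = 0 := by
      have e1 : (T.face (T.face a.symm)).fst ≠ p := by
        rw [h3, ← h4]; exact SimpleGraph.Dart.snd_ne_fst _
      have e2 : (T.face (T.face a.symm)).snd ≠ p := by
        rw [h2]; intro hh; exact a.snd_ne_fst (hh.trans ha.symm)
      simp [ω, e1, e2]
    rw [h5, h2, h3] at h1
    rw [hh]
    exact (zmod_two_add_eq_zero.1 h1.symm).symm
  rw [hd' d rfl, hd' d' h.symm, this]

/-- Darts that are consecutive around a vertex in a triangulation are consecutive in every
triangle system. -/
theorem TriangleSystem.consecutive [hfin : Finite V] (T : Triangulation G) {f : G.Dart → G.Dart}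
    (hf : TriangleSystem G f) (d : G.Dart) :
    f d.symm = T.face d.symm ∨ f (T.face d.symm).symm = d := by
  by_contra! hcon
  obtain ⟨hc1, hc2⟩ := hcon
  set d' := T.face d.symm with hd'
  have hfst' : d'.fst = d.fst := T.face_fst _
  have hne : d'.snd ≠ d.snd := by
    have h1 : (T.face d').snd = d.snd := T.triangleSystem_three _
    rw [← h1, ← T.face_fst]
    exact SimpleGraph.Dart.fst_ne_snd _
  have h3fst : (T.face d').fst = d'.snd := T.face_fst _
  have h3snd : (T.face d').snd = d.snd := T.triangleSystem_three _
  -- The curve is the face of `T` spanned by `d` and `d'`. If these are not adjacent in the rotation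
  -- of `f`, other edges leave the vertex on both sides of the curve. But the remaining neighbours
  -- are linked in `T` off the curve, so all these edges lie on one side.
  obtain ⟨w, hw, hw1, hw2⟩ := hf.exists_coloring (a := d.symm) (b := d') (c := T.face d')
    hfst'.symm (T.face_fst _).symm h3snd
  have hxy : d.fst ≠ d.snd := d.fst_ne_snd
  have hxz : d.fst ≠ d'.snd := by rw [← hfst']; exact d'.fst_ne_snd
  -- no jump away from the triangle
  have hout : ∀ a : G.Dart, a.fst ≠ d.fst → a.fst ≠ d.snd → a.fst ≠ d'.snd →
      w a.symm = w a := by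
    intro a h1 h2 h3
    apply hw1
    · rintro rfl; exact h2 rfl
    · rintro rfl; exact h1 hfst'
    · rintro rfl; exact h3 h3fst
    · intro h; apply h1; exact congrArg (fun e : G.Dart => e.snd) h
    · intro h; apply h3; exact congrArg (fun e : G.Dart => e.snd) h
    · intro h; apply h2; rw [← h3snd]; exact congrArg (fun e : G.Dart => e.snd) h
  have hatx : ∀ a : G.Dart, a.fst = d.fst → a ≠ d → a ≠ d' → w a.symm = w a := by
    intro a h0 h1 h2
    apply hw1
    · rintro rfl; exact hxy h0.symm
    · exact h2
    · rintro rfl; exact hxz (h0.symm.trans h3fst)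
    · intro h; apply h1; rw [← d.symm_symm, ← h, a.symm_symm]
    · intro h; apply a.fst_ne_snd; rw [h0, ← hfst', ← h]; rfl
    · intro h; apply hxy; rw [← h0, ← h3snd, ← h]; rfl
  have hjump : w d = w d.symm + 1 := by
    have := hw2 (by rw [d.symm_symm]; intro h; exact hne (by rw [← h]))
      (by rw [d.symm_symm]; intro h; exact hxz (by rw [← h3fst, ← h]))
      (by intro h; exact hxy (by rw [← hfst', ← h]; rfl))
      (by intro h; exact hxy (by rw [← h3snd, ← h]; rfl))
    rwa [d.symm_symm] at this
  have hlink : ∀ a b : G.Dart, a.fst = b.fst → a.fst ≠ d.fst → a.fst ≠ d.snd →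
      a.fst ≠ d'.snd → w a = w b := by
    intro a b hab h1 h2 h3
    refine hf.rot_const T hab (fun c hc => ?_)
    rw [hw]
    exact hout c (hc ▸ h1) (hc ▸ h2) (hc ▸ h3)
  have hsnd : ∀ a : G.Dart, a.fst = d.fst → a ≠ d → a ≠ d' →
      a.snd ≠ d.fst ∧ a.snd ≠ d.snd ∧ a.snd ≠ d'.snd := by
    intro a h0 h1 h2
    refine ⟨?_, fun h => h1 (dart_ext h0 h), fun h => h2 (dart_ext (h0.trans hfst'.symm) h)⟩
    rw [← h0]; exact a.snd_ne_fst
  -- The colour is carried from `a` to the next dart in `T` along the third edge of their common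
  -- face. The ends of that edge are off the curve, and `hlink` makes the colour constant there.
  have hstep : ∀ a : G.Dart, a.fst = d.fst → a ≠ d → a ≠ d' → T.face a.symm ≠ d →
      T.face a.symm ≠ d' → w (T.face a.symm) = w a := by
    intro a h0 h1 h2 h3 h4
    have h0' : (T.face a.symm).fst = d.fst := by rw [T.face_fst]; exact h0
    obtain ⟨p1, p2, p3⟩ := hsnd a h0 h1 h2
    obtain ⟨q1, q2, q3⟩ := hsnd _ h0' h3 h4
    set a' := T.face a.symm
    have hb2 : (T.face a').snd = a.snd := T.triangleSystem_three _
    have hb1 : (T.face a').fst = a'.snd := T.face_fst _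
    rw [← hatx a h0 h1 h2, ← hatx a' h0' h3 h4]
    rw [hlink a'.symm (T.face a') hb1.symm q1 q2 q3,
      ← hout (T.face a') (by rw [hb1]; exact q1) (by rw [hb1]; exact q2)
        (by rw [hb1]; exact q3)]
    exact hlink (T.face a').symm a.symm hb2 (by rw [← hb2] at p1; exact p1)
      (by rw [← hb2] at p2; exact p2) (by rw [← hb2] at p3; exact p3)
  have hconst : ∀ a : G.Dart, a.fst = d.fst → a ≠ d → a ≠ d' →
      w a = w (T.face d'.symm) := by
    intro a h0 h1 h2
    have := T.rot_induction (d := d') (p := fun a => a = d ∨ a = d' ∨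
      w a = w (T.face d'.symm)) (Or.inr (Or.inl rfl)) (fun b hb hh => ?_) hfin
      (h0.trans hfst'.symm)
    · rcases this with h | h | h
      · exact absurd h h1
      · exact absurd h h2
      · exact h
    · by_cases e1 : b = d
      · right; left; rw [e1]
      by_cases e2 : b = d'
      · right; right; rw [e2]
      by_cases e3 : T.face b.symm = d
      · left; exact e3
      by_cases e4 : T.face b.symm = d'
      · right; left; exact e4
      right; right
      rw [hstep b (hb.trans hfst') e1 e2 e3 e4]
      rcases hh with h | h | h
      · exact absurd h e1
      · exact absurd h e2
      · exact h
  -- the two neighbours of `d` in the other system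
  have hd1 : w (f d.symm) = w d.symm := hw _
  have e1 : (f d.symm).fst = d.fst := hf.fst _
  have h1 := hconst _ e1 (hf.rot_ne d) hc1
  let d0 := (f (f d)).symm
  have e0 : d0.fst = d.fst := hf.snd_snd d
  have hd0 : f d0.symm = d := by simp only [d0, SimpleGraph.Dart.symm_symm]; exact hf.three d
  have n1 : d0 ≠ d := fun h => hf.rot_ne d (by rw [h] at hd0; exact hd0)
  have n2 : d0 ≠ d' := fun h => hc2 (by rw [h] at hd0; exact hd0)
  have h2 := hconst d0 e0 n1 n2
  have h3 : w d = w d0 := by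
    have := hw d0.symm
    rw [hd0] at this
    exact this.trans (hatx d0 e0 n1 n2)
  rw [h3, h2, ← hd1, h1] at hjump
  simp at hjump

/-- Face steps and reversals generate the rotation at each vertex, and connectivity carries the
property from vertex to vertex. -/
theorem dart_induction (hG : G.Connected) (T : Triangulation G) [hfin : Finite V]
    {p : G.Dart → Prop}
    (hface : ∀ d, p d → p (T.face d)) (hsymm : ∀ d, p d → p d.symm) {d : G.Dart} (hd : p d)
    (d' : G.Dart) : p d' := by
  have h : ∀ (x y : V), G.Walk x y → (∃ a, a.fst = x ∧ p a) → ∀ b : G.Dart, b.fst = y → p b := by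
    intro x y W
    induction W with
    | nil =>
      rintro ⟨a, ha, hp⟩ b hb
      exact T.rot_induction (p := p) hp (fun c _ hc => hface _ (hsymm _ hc)) hfin
        (hb.trans ha.symm)
    | @cons x z y hadj W ih =>
      rintro ⟨a, ha, hp⟩ b hb
      refine ih ⟨⟨(z, x), hadj.symm⟩, rfl, ?_⟩ b hb
      have : p ⟨(x, z), hadj⟩ :=
        T.rot_induction (p := p) hp (fun c _ hc => hface _ (hsymm _ hc)) hfin
          (by exact ha.symm)
      exact hsymm _ this
  obtain ⟨W⟩ := hG.preconnected d.fst d'.fst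
  exact h _ _ W ⟨d, rfl, hd⟩ d' rfl

/-- A triangle system on a triangulated planar graph consists of the faces of the embedding, up
to reflection. -/
theorem TriangleSystem.eq_or_eq_reverse [hfin : Finite V] (T : Triangulation G)
    {f : G.Dart → G.Dart} (hf : TriangleSystem G f) :
    (∀ d, f d = T.face d) ∨ ∀ d, f d ≠ T.face d ∧ f d = (T.face (T.face d.symm)).symm := by
  have hcons := hf.consecutive T
  by_cases hex : ∃ d, f d = T.face d
  · left
    obtain ⟨d, hd⟩ := hex
    have hface : ∀ d, f d = T.face d → f (T.face d) = T.face (T.face d) := by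
      intro d hd
      apply dart_ext
      · rw [hf.fst, T.face_fst]
      · rw [← hd, hf.snd_snd, hd, T.triangleSystem_three]
    have hrot : ∀ d, f d = T.face d → f (T.face d).symm = T.face (T.face d).symm := by
      intro a ha
      have hd : f a.symm.symm = T.face a.symm.symm := by simpa using ha
      set d := a.symm with hda
      have ha' : a = d.symm := by rw [hda, a.symm_symm]
      rw [ha']
      rcases hcons (T.face d.symm) with h | h
      · exact h
      -- The other alternative of `consecutive` forces a vertex with only the darts `d` and `d'`,
      -- where the two rotations agree anyway.
      · set d' := T.face d.symm
        have hd2 : T.face d'.symm = d := by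
          have h4 : f (T.face d'.symm).symm = f d.symm := h.trans (by rw [← ha', ha, ha'])
          exact (dart_symm_eq_iff.1 (hf.injective h4)).trans d.symm_symm
        have hfst' : d'.fst = d.fst := T.face_fst _
        have := T.rot_induction (d := d) (p := fun a => a = d ∨ a = d') (Or.inl rfl)
          (fun b _ hb => by
            rcases hb with rfl | rfl
            · right; rfl
            · left; exact hd2) hfin (d' := f d'.symm) (by rw [hf.fst]; exact hfst')
        rcases this with h5 | h5
        · rw [h5, hd2]
        · exact absurd h5 (hf.rot_ne d')
    have hsymm : ∀ d, f d = T.face d → f d.symm = T.face d.symm := by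
      intro d hd
      have := hrot _ (hface _ (hface _ hd))
      rwa [T.face_three] at this
    exact dart_induction T.connected T hface hsymm hd
  · right
    push Not at hex
    intro d
    refine ⟨hex d, ?_⟩
    -- Since agreement is excluded everywhere, consecutive darts of `T` are consecutive in `f` in
    -- the opposite sense.
    rcases hcons (T.face (T.face d.symm)).symm with h | h
    · exact absurd h (hex _)
    · rw [SimpleGraph.Dart.symm_symm, T.face_three, SimpleGraph.Dart.symm_symm] at h
      exact h

end Uniqueness

/-! ### Multigraphs with face boundaries -/

/-- A labelled multigraph: every edge `b` has the two orientations `(b, true)` and `(b, false)`,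
and every oriented edge has an initial vertex and a face to its left. -/
structure FaceSystem (V B Q : Type*) where
  src : B × Bool → V
  face : B × Bool → Q
  src_ne : ∀ b, src (b, true) ≠ src (b, false)

theorem sum_eq_add_of_forall {A M : Type*} [AddCommMonoid M] {s : Finset A} {a a' : A}
    (hne : a ≠ a') (ha : a ∈ s) (ha' : a' ∈ s) (h : ∀ x ∈ s, x = a ∨ x = a') (g : A → M) :
    ∑ x ∈ s, g x = g a + g a' := by
  classical
  rw [← Finset.sum_pair hne]
  congr 1
  ext x
  rw [Finset.mem_insert, Finset.mem_singleton]
  constructor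
  · exact h x
  · rintro (rfl | rfl) <;> assumption

namespace FaceSystem

variable {V B Q : Type*}

/-- The terminal vertex of an oriented edge. -/
def tgt (S : FaceSystem V B Q) (a : B × Bool) : V := S.src (a.1, !a.2)

/-- The unordered pair of end-vertices of an edge. -/
def ends (S : FaceSystem V B Q) (b : B) : Sym2 V := s(S.src (b, true), S.src (b, false))

theorem src_ne_tgt (S : FaceSystem V B Q) (a : B × Bool) : S.src a ≠ S.tgt a := by
  obtain ⟨b, s⟩ := a
  cases s
  · exact (S.src_ne b).symm
  · exact S.src_ne b

theorem ends_eq (S : FaceSystem V B Q) (a : B × Bool) : S.ends a.1 = s(S.src a, S.tgt a) := by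
  obtain ⟨b, s⟩ := a
  cases s
  · exact Sym2.eq_swap
  · rfl

section

variable {S : FaceSystem V B Q}

/-- The coboundary of a function on vertices. -/
def coboundary (S : FaceSystem V B Q) : (V → ZMod 2) →ₗ[ZMod 2] (B → ZMod 2) where
  toFun φ b := φ (S.src (b, true)) + φ (S.src (b, false))
  map_add' φ φ' := by ext b; simp only [Pi.add_apply]; ring
  map_smul' c φ := by ext b; simp only [Pi.smul_apply, smul_eq_mul, RingHom.id_apply]; ring

/-- The constants lie in the kernel, which costs one dimension. -/
theorem finrank_coboundary [Fintype V] [Nonempty V] [Finite B] :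
    Module.finrank (ZMod 2) (LinearMap.range S.coboundary) + 1 ≤ Fintype.card V := by
  have h := LinearMap.finrank_range_add_finrank_ker S.coboundary
  rw [Module.finrank_fintype_fun_eq_card] at h
  have : 0 < Module.finrank (ZMod 2) (LinearMap.ker S.coboundary) := by
    rw [Module.finrank_pos_iff_exists_ne_zero]
    refine ⟨⟨fun _ => 1, ?_⟩, ?_⟩
    · rw [LinearMap.mem_ker]
      ext b
      exact CharTwo.add_self_eq_zero _
    · intro h
      have := congrFun (congrArg Subtype.val h) (Classical.arbitrary V)
      exact one_ne_zero this
  omega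

/-- The functions on edges induced by functions on the edges of a simple graph. -/
noncomputable def pullback (S : FaceSystem V B Q) (G : SimpleGraph V) :
    (G.edgeSet → ZMod 2) →ₗ[ZMod 2] (B → ZMod 2) where
  toFun g b := by
    classical
    exact if h : S.ends b ∈ G.edgeSet then g ⟨_, h⟩ else 0
  map_add' g g' := by ext b; by_cases h : S.ends b ∈ G.edgeSet <;> simp [h]
  map_smul' c g := by ext b; by_cases h : S.ends b ∈ G.edgeSet <;> simp [h]

theorem pullback_apply {G : SimpleGraph V} {g : G.edgeSet → ZMod 2} {b : B}
    (h : S.ends b ∈ G.edgeSet) : S.pullback G g b = g ⟨_, h⟩ := by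
  simp [pullback, h]

theorem pullback_apply_of_notMem {G : SimpleGraph V} {g : G.edgeSet → ZMod 2} {b : B}
    (h : S.ends b ∉ G.edgeSet) : S.pullback G g b = 0 := by
  simp [pullback, h]

theorem pullback_congr {G : SimpleGraph V} {g : G.edgeSet → ZMod 2} {b b' : B}
    (h : S.ends b = S.ends b') : S.pullback G g b = S.pullback G g b' := by
  by_cases h' : S.ends b' ∈ G.edgeSet
  · rw [pullback_apply h', pullback_apply (h ▸ h')]
    simp [h]
  · rw [pullback_apply_of_notMem h', pullback_apply_of_notMem (h ▸ h')]

theorem pullback_injective {G : SimpleGraph V} (hG : ∀ e ∈ G.edgeSet, ∃ b, S.ends b = e) :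
    Function.Injective (S.pullback G) := by
  intro g g' h
  ext ⟨e, he⟩
  obtain ⟨b, rfl⟩ := hG e he
  have := congrFun h b
  rwa [pullback_apply he, pullback_apply he] at this

end

open Classical in
/-- The oriented edges on the boundary of a face. -/
noncomputable def fiber [Fintype B] (S : FaceSystem V B Q) (q : Q) : Finset (B × Bool) :=
  Finset.univ.filter fun a => S.face a = q

/-- Face boundaries are closed, and every mod-2 function on edges vanishing on all face boundaries
is a coboundary. -/
structure IsPlanar [Fintype B] (S : FaceSystem V B Q) : Prop where
  conserve : ∀ q (f : V → ℤ), ∑ a ∈ S.fiber q, (f (S.tgt a) - f (S.src a)) = 0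
  potential : ∀ ω : B → ZMod 2, (∀ q, ∑ a ∈ S.fiber q, ω a.1 = 0) →
    ∃ φ : V → ZMod 2, ∀ b, ω b = φ (S.src (b, true)) + φ (S.src (b, false))

/-! ### Faces of small degree and the mod-2 dimension count -/

section

variable [Fintype B] {S : FaceSystem V B Q}

theorem mem_fiber {q : Q} {a : B × Bool} : a ∈ S.fiber q ↔ S.face a = q := by
  simp [fiber]

theorem IsPlanar.exists_next (hS : S.IsPlanar) {q : Q} {a : B × Bool} (ha : a ∈ S.fiber q) :
    ∃ a' ∈ S.fiber q, S.src a' = S.tgt a := by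
  classical
  by_contra! hcon
  have h := hS.conserve q (fun v => if v = S.tgt a then 1 else 0)
  rw [Finset.sum_congr rfl (g := fun a' => if S.tgt a' = S.tgt a then (1 : ℤ) else 0)
    (fun a' ha' => by simp [hcon a' ha'])] at h
  have h2 := Finset.single_le_sum (f := fun a' => if S.tgt a' = S.tgt a then (1 : ℤ) else 0)
    (fun a' _ => by positivity) ha
  rw [h] at h2
  simp at h2

theorem IsPlanar.card_ne_one (hS : S.IsPlanar) (q : Q) : (S.fiber q).card ≠ 1 := by
  intro h
  obtain ⟨a, ha⟩ := Finset.card_eq_one.1 h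
  obtain ⟨a', ha', h'⟩ := hS.exists_next (q := q) (a := a) (by rw [ha]; simp)
  rw [ha, Finset.mem_singleton] at ha'
  rw [ha'] at h'
  exact S.src_ne_tgt a h'

theorem IsPlanar.of_card_two (hS : S.IsPlanar) {q : Q} (hq : (S.fiber q).card = 2)
    {a : B × Bool} (ha : a ∈ S.fiber q) :
    ∃ a' ∈ S.fiber q, a ≠ a' ∧ (∀ x ∈ S.fiber q, x = a ∨ x = a') ∧ S.src a' = S.tgt a ∧
      S.tgt a' = S.src a := by
  classical
  obtain ⟨a', ha', h'⟩ := hS.exists_next ha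
  have hne : a ≠ a' := by rintro rfl; exact S.src_ne_tgt a h'
  have hf : S.fiber q = {a, a'} := by
    symm
    apply Finset.eq_of_subset_of_card_le
    · intro x hx
      rcases Finset.mem_insert.1 hx with rfl | hx
      · exact ha
      · rw [Finset.mem_singleton.1 hx]; exact ha'
    · rw [hq, Finset.card_pair hne]
  refine ⟨a', ha', hne, fun x hx => by simpa [hf] using hx, h', ?_⟩
  have h := hS.conserve q (fun v => if v = S.tgt a' then 1 else 0)
  rw [hf, Finset.sum_pair hne] at h
  by_contra hne'
  have h1 : S.src a ≠ S.tgt a' := fun h => hne' h.symm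
  have h2 := S.src_ne_tgt a'
  simp [h1, h'] at h

/-- Only balance at each vertex is known about a face boundary. Testing it on the indicators of the
ends of the third edge shows that three edges can balance only as a closed triangle. -/
theorem IsPlanar.of_card_three (hS : S.IsPlanar) {q : Q} (hq : (S.fiber q).card = 3)
    {a a' : B × Bool} (ha : a ∈ S.fiber q) (ha' : a' ∈ S.fiber q) (h' : S.src a' = S.tgt a) :
    ∃ a'' ∈ S.fiber q, (∀ x ∈ S.fiber q, x = a ∨ x = a' ∨ x = a'') ∧ S.src a'' = S.tgt a' ∧
      S.tgt a'' = S.src a := by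
  classical
  have hne : a ≠ a' := by rintro rfl; exact S.src_ne_tgt a h'
  have hc : ((S.fiber q).erase a).card = 2 := by rw [Finset.card_erase_of_mem ha, hq]
  have hm' : a' ∈ (S.fiber q).erase a := Finset.mem_erase.2 ⟨hne.symm, ha'⟩
  have hc' : (((S.fiber q).erase a).erase a').card = 1 := by rw [Finset.card_erase_of_mem hm', hc]
  obtain ⟨a'', h''⟩ := Finset.card_eq_one.1 hc'
  have hm'' : a'' ∈ ((S.fiber q).erase a).erase a' := by rw [h'']; simp
  have hmem := Finset.mem_of_mem_erase (Finset.mem_of_mem_erase hm'')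
  refine ⟨a'', hmem, ?_, ?_⟩
  · intro x hx
    by_cases h1 : x = a
    · exact Or.inl h1
    by_cases h2 : x = a'
    · exact Or.inr (Or.inl h2)
    have : x ∈ ((S.fiber q).erase a).erase a' :=
      Finset.mem_erase.2 ⟨h2, Finset.mem_erase.2 ⟨h1, hx⟩⟩
    rw [h''] at this
    exact Or.inr (Or.inr (Finset.mem_singleton.1 this))
  · have hsum : ∀ f : V → ℤ, f (S.tgt a) - f (S.src a) + (f (S.tgt a') - f (S.src a') +
        (f (S.tgt a'') - f (S.src a''))) = 0 := by
      intro f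
      have := hS.conserve q f
      rwa [← Finset.add_sum_erase _ _ ha, ← Finset.add_sum_erase _ _ hm', h'',
        Finset.sum_singleton] at this
    have e1 := hsum (fun v => if v = S.src a'' then 1 else 0)
    have e2 := hsum (fun v => if v = S.tgt a'' then 1 else 0)
    have hn := (S.src_ne_tgt a'')
    simp only [h', hn, hn.symm, if_true, if_false] at e1 e2
    constructor
    · by_contra h
      have h1 : ¬ S.tgt a' = S.src a'' := fun hh => h hh.symm
      simp only [h1, if_false] at e1
      split_ifs at e1 <;> omega
    · by_contra h
      have h1 : ¬ S.src a = S.tgt a'' := fun hh => h hh.symm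
      simp only [h1, if_false] at e2
      split_ifs at e2 <;> omega

/-- The two edges on the boundary of a face of degree two have the same ends. -/
theorem IsPlanar.ends_eq_of_card_two (hS : S.IsPlanar) {q : Q} (hq : (S.fiber q).card = 2)
    {a a' : B × Bool} (ha : a ∈ S.fiber q) (ha' : a' ∈ S.fiber q) :
    S.ends a.1 = S.ends a'.1 := by
  obtain ⟨c, -, -, hf, h1, h2⟩ := hS.of_card_two hq ha
  rcases hf a' ha' with rfl | rfl
  · rfl
  · rw [S.ends_eq, S.ends_eq, h1, h2]
    exact Sym2.eq_swap

theorem sum_fiber_total [Fintype Q] {M : Type*} [AddCommMonoid M] (g : B × Bool → M) :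
    ∑ q, ∑ a ∈ S.fiber q, g a = ∑ b, (g (b, true) + g (b, false)) := by
  classical
  have : ∑ q, ∑ a ∈ S.fiber q, g a = ∑ a, g a := by
    simp only [fiber]
    convert Finset.sum_fiberwise Finset.univ S.face g
  rw [this, Fintype.sum_prod_type]
  simp

/-- Every edge is counted once from each side. Hence closedness on all faces but one implies it on
the last. -/
theorem sum_fiber_total_zmod [Fintype Q] (ω : B → ZMod 2) :
    ∑ q, ∑ a ∈ S.fiber q, ω a.1 = 0 := by
  rw [sum_fiber_total (fun a => ω a.1)]
  exact Finset.sum_eq_zero fun b _ => CharTwo.add_self_eq_zero _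

/-- The sums of a function on edges along the boundaries of a set of faces. -/
noncomputable def boundarySum (S : FaceSystem V B Q) (Z : Set Q) :
    (B → ZMod 2) →ₗ[ZMod 2] (Z → ZMod 2) where
  toFun ω q := ∑ a ∈ S.fiber q, ω a.1
  map_add' ω ω' := by ext q; simp [Finset.sum_add_distrib]
  map_smul' c ω := by ext q; simp [Finset.mul_sum]

/-- The functions on edges that agree on the two edges of every face of degree two. -/
noncomputable def digonal (S : FaceSystem V B Q) : Submodule (ZMod 2) (B → ZMod 2) :=
  LinearMap.ker (S.boundarySum {q | (S.fiber q).card = 2})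

theorem mem_digonal {ω : B → ZMod 2} :
    ω ∈ S.digonal ↔ ∀ q, (S.fiber q).card = 2 → ∑ a ∈ S.fiber q, ω a.1 = 0 := by
  simp [digonal, LinearMap.mem_ker, funext_iff, boundarySum]

theorem IsPlanar.sum_eq_zero_iff_of_card_two (hS : S.IsPlanar) {q : Q}
    (hq : (S.fiber q).card = 2) (ω : B → ZMod 2) :
    ∑ a ∈ S.fiber q, ω a.1 = 0 ↔ ∀ a ∈ S.fiber q, ∀ a' ∈ S.fiber q, ω a.1 = ω a'.1 := by
  classical
  obtain ⟨a, ha⟩ : (S.fiber q).Nonempty := Finset.card_pos.1 (by omega)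
  obtain ⟨a', ha', hne, hf, -, -⟩ := hS.of_card_two hq ha
  rw [sum_eq_add_of_forall hne ha ha' hf, zmod_two_add_eq_zero]
  constructor
  · intro h x hx x' hx'
    rcases hf x hx with rfl | rfl <;> rcases hf x' hx' with rfl | rfl <;> simp [h]
  · exact fun h => h a ha a' ha'

theorem sum_card_fiber [Fintype Q] : ∑ q, (S.fiber q).card = 2 * Fintype.card B := by
  have := S.sum_fiber_total (Q := Q) (M := ℕ) (fun _ => 1)
  simp only [Finset.sum_const, smul_eq_mul, mul_one, Finset.card_univ] at this
  rw [this]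
  simp [mul_comm]

/-- Each digon imposes one linear condition. -/
theorem card_le_finrank_digonal [Fintype Q] :
    Fintype.card B ≤ Module.finrank (ZMod 2) S.digonal +
      (Finset.univ.filter fun q => (S.fiber q).card = 2).card := by
  classical
  have h := LinearMap.finrank_range_add_finrank_ker (S.boundarySum {q | (S.fiber q).card = 2})
  rw [Module.finrank_fintype_fun_eq_card] at h
  have h2 := Submodule.finrank_le
    (LinearMap.range (S.boundarySum {q | (S.fiber q).card = 2}))
  rw [Module.finrank_fintype_fun_eq_card] at h2
  have h3 : Fintype.card {q | (S.fiber q).card = 2} =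
      (Finset.univ.filter fun q => (S.fiber q).card = 2).card := by
    rw [← Set.toFinset_card]
    congr 1
    ext; simp
  rw [h3] at h2
  unfold digonal
  omega

/-- The Euler inequality in linear form. A digonal function that also sums to zero on `Z` is closed
on all faces: at most one face of degree at least three is left, and its condition follows from the
others. So it is a coboundary, and these have dimension at most |V| - 1. -/
theorem IsPlanar.finrank_digonal_le [Fintype V] [Nonempty V] [Fintype Q] (hS : S.IsPlanar)
    (Z : Finset Q) (hZ : ∀ q, q ∉ Z → 3 ≤ (S.fiber q).card →
      ∀ q', q' ∉ Z → 3 ≤ (S.fiber q').card → q = q') :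
    Module.finrank (ZMod 2) S.digonal + 1 ≤ Fintype.card V + Z.card := by
  classical
  let C := (S.boundarySum (Z : Set Q)).comp S.digonal.subtype
  have h := LinearMap.finrank_range_add_finrank_ker C
  have h2 := Submodule.finrank_le (LinearMap.range C)
  rw [Module.finrank_fintype_fun_eq_card] at h2
  have hZc : Fintype.card (Z : Set Q) = Z.card := by simp
  rw [hZc] at h2
  have h3 : (LinearMap.ker C).map S.digonal.subtype ≤ LinearMap.range S.coboundary := by
    rintro _ ⟨⟨ω, hω⟩, hk, rfl⟩
    have hk' : ∀ q ∈ Z, ∑ a ∈ S.fiber q, ω a.1 = 0 := fun q hq =>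
      congrFun (LinearMap.mem_ker.1 hk) ⟨q, hq⟩
    have hsmall : ∀ q, ¬ (q ∉ Z ∧ 3 ≤ (S.fiber q).card) → ∑ a ∈ S.fiber q, ω a.1 = 0 := by
      intro q hq
      by_cases hqZ : q ∈ Z
      · exact hk' q hqZ
      have hlt : (S.fiber q).card < 3 := by
        by_contra hc
        exact hq ⟨hqZ, by omega⟩
      have := hS.card_ne_one q
      by_cases h0 : (S.fiber q).card = 0
      · rw [Finset.card_eq_zero.1 h0]; simp
      · exact mem_digonal.1 hω q (by omega)
    obtain ⟨φ, hφ⟩ := hS.potential ω (fun q => by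
      by_cases hq : q ∉ Z ∧ 3 ≤ (S.fiber q).card
      · have := S.sum_fiber_total_zmod ω
        rwa [Finset.sum_eq_single q (fun q' _ hne => hsmall q' (fun h' =>
          hne (hZ q' h'.1 h'.2 q hq.1 hq.2))) (by simp)] at this
      · exact hsmall q hq)
    exact ⟨φ, by ext b; exact (hφ b).symm⟩
  have h4 := Submodule.finrank_mono h3
  have h5 : Module.finrank (ZMod 2) ((LinearMap.ker C).map S.digonal.subtype) =
      Module.finrank (ZMod 2) (LinearMap.ker C) :=
    Submodule.finrank_map_subtype_eq _ _
  have h6 := S.finrank_coboundary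
  omega

theorem IsPlanar.range_pullback_le (hS : S.IsPlanar) (G : SimpleGraph V) :
    LinearMap.range (S.pullback G) ≤ S.digonal := by
  rintro _ ⟨g, rfl⟩
  rw [mem_digonal]
  intro q hq
  rw [hS.sum_eq_zero_iff_of_card_two hq]
  exact fun a ha a' ha' => pullback_congr (hS.ends_eq_of_card_two hq ha ha')

end

end FaceSystem

/-! ### Rigidity from the extremal number of edges -/

namespace FaceSystem

variable {V B Q : Type*}

variable [Fintype B] [Fintype Q] {S : FaceSystem V B Q}
  {G : SimpleGraph V}

theorem IsPlanar.sum_card_big (hS : S.IsPlanar) :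
    2 * (Finset.univ.filter fun q => (S.fiber q).card = 2).card +
      ∑ q ∈ Finset.univ.filter (fun q => 3 ≤ (S.fiber q).card), (S.fiber q).card =
      2 * Fintype.card B := by
  rw [← S.sum_card_fiber, Finset.sum_filter, Finset.card_filter, Finset.mul_sum,
    ← Finset.sum_add_distrib]
  refine Finset.sum_congr rfl fun q _ => ?_
  have := hS.card_ne_one q
  split_ifs <;> omega

/-- If `G` has the maximal number of edges of a planar graph, then all faces of degree greater
than two are triangles, and the counts are as in a triangulation. -/
theorem IsPlanar.count [Finite V] (hS : S.IsPlanar) (hG : ∀ e ∈ G.edgeSet, ∃ b, S.ends b = e)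
    (hE : Nat.card G.edgeSet + 6 = 3 * Nat.card V) (hV : 3 ≤ Nat.card V) :
    (∀ q, 3 ≤ (S.fiber q).card → (S.fiber q).card = 3) ∧
    S.digonal ≤ LinearMap.range (S.pullback G) ∧
    ∑ q ∈ Finset.univ.filter (fun q => 3 ≤ (S.fiber q).card), (S.fiber q).card =
      2 * Nat.card G.edgeSet := by
  classical
  have : Fintype V := Fintype.ofFinite V
  have : Fintype G.edgeSet := Fintype.ofFinite _
  have : Nonempty V := (Nat.card_pos_iff.1 (by omega)).1
  simp only [Nat.card_eq_fintype_card] at hE hV ⊢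
  set y := Module.finrank (ZMod 2) S.digonal with hy
  have h1 := hS.sum_card_big
  set big := Finset.univ.filter (fun q => 3 ≤ (S.fiber q).card)
  have h2 := S.card_le_finrank_digonal
  have hPr : Module.finrank (ZMod 2) (LinearMap.range (S.pullback G)) =
      Fintype.card G.edgeSet := by
    rw [LinearMap.finrank_range_of_inj (pullback_injective hG),
      Module.finrank_fintype_fun_eq_card]
  have h3 : Fintype.card G.edgeSet ≤ y := by
    rw [← hPr]
    exact Submodule.finrank_mono (hS.range_pullback_le G)
  have h4 : 3 * big.card ≤ ∑ q ∈ big, (S.fiber q).card := by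
    rw [mul_comm, ← smul_eq_mul]
    exact Finset.card_nsmul_le_sum _ _ _ fun q hq => (Finset.mem_filter.1 hq).2
  -- One face of `big` is left out of `Z` as redundant. If there is none, the weaker bound y + 1 ≤
  -- |V| already contradicts |E| = 3|V| - 6 ≤ y with |V| ≥ 3.
  have h5 : y + 2 ≤ Fintype.card V + big.card := by
    rcases big.eq_empty_or_nonempty with hb | ⟨q₀, hq₀⟩
    · have := hS.finrank_digonal_le ∅ (fun q _ hq => by
        have : q ∈ big := Finset.mem_filter.2 ⟨Finset.mem_univ _, hq⟩
        rw [hb] at this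
        simp at this)
      rw [Finset.card_empty] at this
      omega
    · have := hS.finrank_digonal_le (big.erase q₀) (fun q hq hq3 q' hq' hq'3 => by
        have m : q ∈ big := Finset.mem_filter.2 ⟨Finset.mem_univ _, hq3⟩
        have m' : q' ∈ big := Finset.mem_filter.2 ⟨Finset.mem_univ _, hq'3⟩
        have e : q = q₀ := by
          by_contra hne
          exact hq (Finset.mem_erase.2 ⟨hne, m⟩)
        have e' : q' = q₀ := by
          by_contra hne
          exact hq' (Finset.mem_erase.2 ⟨hne, m'⟩)
        rw [e, e'])
      rw [Finset.card_erase_of_mem hq₀] at this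
      have := Finset.card_pos.2 ⟨q₀, hq₀⟩
      omega
  -- The bounds combine to 3·|big| ≤ ∑ deg ≤ 2y and 3y ≤ 3|V| - 6 + 3·|big|, whence y ≤ 3|V| - 6 =
  -- |E| ≤ y. All inequalities are thus equalities.
  have h6 : ∑ q ∈ big, (S.fiber q).card = 3 * big.card := by omega
  refine ⟨fun q hq => ?_, ?_, by omega⟩
  · have h7 : ∑ q ∈ big, 3 = ∑ q ∈ big, (S.fiber q).card := by
      rw [h6, Finset.sum_const, smul_eq_mul, mul_comm]
    exact ((Finset.sum_eq_sum_iff_of_le fun q hq => (Finset.mem_filter.1 hq).2).1 h7 q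
      (Finset.mem_filter.2 ⟨Finset.mem_univ _, hq⟩)).symm
  · refine (Submodule.eq_of_le_of_finrank_le (hS.range_pullback_le G) ?_).ge
    rw [hPr]
    omega

/-- A nonconstant function on the edges with given ends, subject to few linear conditions. -/
theorem exists_nonconstant (e : Sym2 V) (Z : Finset Q)
    (hZ : Z.card + 2 ≤ Nat.card {b // S.ends b = e}) :
    ∃ κ : B → ZMod 2, (∀ b, S.ends b ≠ e → κ b = 0) ∧ (∀ q ∈ Z, ∑ a ∈ S.fiber q, κ a.1 = 0) ∧
      ∃ b b', S.ends b = e ∧ S.ends b' = e ∧ κ b ≠ κ b' := by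
  classical
  by_contra! hcon
  let X : Type _ := {b // S.ends b = e}
  let ext : (X → ZMod 2) →ₗ[ZMod 2] (B → ZMod 2) :=
    { toFun := fun g b => if h : S.ends b = e then g ⟨b, h⟩ else 0
      map_add' := fun g g' => by ext b; by_cases h : S.ends b = e <;> simp [h]
      map_smul' := fun c g => by ext b; by_cases h : S.ends b = e <;> simp [h] }
  let C := (S.boundarySum (Z : Set Q)).comp ext
  have h := LinearMap.finrank_range_add_finrank_ker C
  rw [Module.finrank_fintype_fun_eq_card] at h
  have h2 := Submodule.finrank_le (LinearMap.range C)
  rw [Module.finrank_fintype_fun_eq_card] at h2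
  have hZc : Fintype.card (Z : Set Q) = Z.card := by simp
  have hX : Nat.card {b // S.ends b = e} = Fintype.card X := Nat.card_eq_fintype_card
  -- If all solutions were constant, the solution space would have dimension at most one, whereas
  -- the count of conditions leaves at least two.
  have h3 : LinearMap.ker C ≤ Submodule.span (ZMod 2) {fun _ => 1} := by
    intro g hg
    obtain ⟨x₀⟩ : Nonempty X := by
      rw [← Fintype.card_pos_iff]
      omega
    rw [Submodule.mem_span_singleton]
    refine ⟨g x₀, ?_⟩
    ext x
    have := hcon (ext g) (fun b hb => by simp [ext, hb])
      (fun q hq => congrFun (LinearMap.mem_ker.1 hg) ⟨q, hq⟩) x₀.1 x.1 x₀.2 x.2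
    simpa [ext, x₀.2, x.2] using this
  have h4 := Submodule.finrank_mono h3
  have h5 := finrank_span_le_card (R := ZMod 2) ({fun _ => 1} : Set (X → ZMod 2))
  simp only [Set.toFinset_singleton, Finset.card_singleton] at h5
  omega

/-- The consequences of the count for the boundaries of the faces. -/
structure Rigid (S : FaceSystem V B Q) (G : SimpleGraph V) : Prop where
  adj : ∀ a, G.Adj (S.src a) (S.tgt a)
  card_fiber : ∀ q, (S.fiber q).card = 0 ∨ (S.fiber q).card = 2 ∨ (S.fiber q).card = 3
  existsUnique : ∀ d : G.Dart, ∃! a, S.src a = d.fst ∧ S.tgt a = d.snd ∧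
    (S.fiber (S.face a)).card = 3
  copies : ∀ a₀, (S.fiber (S.face a₀)).card = 2 → ∃ κ : B → ZMod 2,
    (∀ q, q ≠ S.face a₀ → (S.fiber q).card = 2 →
      ∀ a ∈ S.fiber q, ∀ a' ∈ S.fiber q, κ a.1 = κ a'.1) ∧
    (∀ a, S.src a = S.tgt a₀ → S.tgt a = S.src a₀ → S.face a = S.face a₀ → κ a.1 ≠ κ a₀.1) ∧
    ∀ a, (S.fiber (S.face a)).card = 3 →
      (S.src a = S.src a₀ → S.tgt a = S.tgt a₀ → κ a.1 ≠ κ a₀.1) ∧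
      (S.src a = S.tgt a₀ → S.tgt a = S.src a₀ → κ a.1 = κ a₀.1)

open Classical in
/-- The net number of traversals from `x` to `y` by the oriented edge `a`. -/
noncomputable def crossing (S : FaceSystem V B Q) (x y : V) (a : B × Bool) : ℤ :=
  (if S.src a = x ∧ S.tgt a = y then 1 else 0) - (if S.src a = y ∧ S.tgt a = x then 1 else 0)

/-- Over all faces the two orientations of each edge cancel. A digon with constant weight cancels by
itself, so the faces of `Z` must balance too. -/
theorem IsPlanar.balance (hS : S.IsPlanar) (x y : V) (k : B → ℤ) (Z : Finset Q)
    (hZ : ∀ q ∉ Z, (S.fiber q).card ≠ 0 → (S.fiber q).card = 2 ∧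
      ∀ a ∈ S.fiber q, ∀ a' ∈ S.fiber q, k a.1 = k a'.1) :
    ∑ q ∈ Z, ∑ a ∈ S.fiber q, k a.1 * S.crossing x y a = 0 := by
  classical
  have h1 := S.sum_fiber_total (Q := Q) (fun a => k a.1 * S.crossing x y a)
  have h2 : ∑ b, (k b * S.crossing x y (b, true) + k b * S.crossing x y (b, false)) = 0 := by
    refine Finset.sum_eq_zero fun b _ => ?_
    have e1 : S.tgt (b, true) = S.src (b, false) := rfl
    have e2 : S.tgt (b, false) = S.src (b, true) := rfl
    simp only [crossing, e1, e2, and_comm]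
    ring
  rw [h2] at h1
  rw [← h1]
  refine Finset.sum_subset (Finset.subset_univ _) fun q _ hq => ?_
  by_cases h0 : (S.fiber q).card = 0
  · rw [Finset.card_eq_zero.1 h0]; simp
  obtain ⟨h2, hk⟩ := hZ q hq h0
  obtain ⟨a, ha⟩ : (S.fiber q).Nonempty := Finset.card_pos.1 (by omega)
  obtain ⟨a', ha', hne, hf, e1, e2⟩ := hS.of_card_two h2 ha
  rw [sum_eq_add_of_forall hne ha ha' hf, hk a ha a' ha']
  simp only [crossing, e1, e2, and_comm]
  ring

theorem sum_fiber_filter {M : Type*} [AddCommMonoid M] (p : Q → Prop) [DecidablePred p]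
    (g : B × Bool → M) :
    ∑ q ∈ Finset.univ.filter p, ∑ a ∈ S.fiber q, g a =
      ∑ a ∈ Finset.univ.filter (fun a => p (S.face a)), g a := by
  classical
  rw [Finset.sum_filter, Finset.sum_filter]
  have : ∀ q, (if p q then ∑ a ∈ S.fiber q, g a else 0) =
      ∑ a ∈ S.fiber q, if p (S.face a) then g a else 0 := by
    intro q
    have h : ∑ a ∈ S.fiber q, (if p (S.face a) then g a else 0) =
        ∑ a ∈ S.fiber q, if p q then g a else 0 :=
      Finset.sum_congr rfl fun a ha => by rw [mem_fiber.1 ha]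
    rw [h]
    split_ifs <;> simp
  rw [Finset.sum_congr rfl fun q _ => this q]
  simp only [fiber]
  convert Finset.sum_fiberwise Finset.univ S.face fun a => if p (S.face a) then g a else 0

/-- Double counting of the sides of the copies of `e`: a digon contains two such sides or none. -/
theorem IsPlanar.count_ends (hS : S.IsPlanar) (e : Sym2 V) :
    ∃ Z : Finset Q, (∀ q, q ∈ Z ↔ (S.fiber q).card = 2 ∧ ∃ a ∈ S.fiber q, S.ends a.1 = e) ∧
      2 * Nat.card {b // S.ends b = e} = 2 * Z.card +
        Nat.card {a // 3 ≤ (S.fiber (S.face a)).card ∧ S.ends a.1 = e} := by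
  classical
  refine ⟨Finset.univ.filter fun q => (S.fiber q).card = 2 ∧ ∃ a ∈ S.fiber q, S.ends a.1 = e,
    by simp, ?_⟩
  have h1 := S.sum_fiber_total (Q := Q) (fun a => if S.ends a.1 = e then 1 else 0)
  have h2 : Nat.card {b // S.ends b = e} = ∑ b, if S.ends b = e then 1 else 0 := by
    rw [Nat.card_eq_fintype_card, Fintype.card_subtype, Finset.card_filter]
  have h3 : Nat.card {a // 3 ≤ (S.fiber (S.face a)).card ∧ S.ends a.1 = e} =
      ∑ q ∈ Finset.univ.filter (fun q => 3 ≤ (S.fiber q).card), ∑ a ∈ S.fiber q,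
        if S.ends a.1 = e then 1 else 0 := by
    rw [sum_fiber_filter, Nat.card_eq_fintype_card, Fintype.card_subtype, ← Finset.sum_filter,
      Finset.filter_filter, Finset.card_eq_sum_ones]
  rw [h2, h3, Finset.card_filter, Finset.mul_sum, Finset.mul_sum, Finset.sum_filter,
    ← Finset.sum_add_distrib]
  simp only [← two_mul] at h1
  rw [← h1]
  refine Finset.sum_congr rfl fun q _ => ?_
  have h4 := hS.card_ne_one q
  by_cases h0 : (S.fiber q).card = 0
  · rw [Finset.card_eq_zero.1 h0]; simp
  by_cases h5 : (S.fiber q).card = 2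
  · by_cases h6 : ∃ a ∈ S.fiber q, S.ends a.1 = e
    · have : ∀ a ∈ S.fiber q, (if S.ends a.1 = e then 1 else 0) = 1 := by
        obtain ⟨a, ha, hae⟩ := h6
        intro a' ha'
        rw [← hS.ends_eq_of_card_two h5 ha ha', if_pos hae]
      rw [Finset.sum_congr rfl this]
      simp [h5, h6]
    · have : ∀ a ∈ S.fiber q, (if S.ends a.1 = e then 1 else 0) = 0 := by
        intro a' ha'
        exact if_neg fun h => h6 ⟨a', ha', h⟩
      rw [Finset.sum_congr rfl this]
      simp [h5, h6]
  · have h7 : 3 ≤ (S.fiber q).card := by omega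
    simp [h5, h7]

/-- By the count, a function that agrees across every digon depends only on the ends of an edge;
equivalently, the parallel copies of an edge of `G` are linked by digons. They form a chain with one
triangle at each end. The field `copies` says that removing one digon cuts this chain in two, and on
which side each triangle remains; it is needed when that digon is the outer face. -/
theorem IsPlanar.rigid [Finite V] (hS : S.IsPlanar)
    (hG : ∀ e ∈ G.edgeSet, ∃ b, S.ends b = e)
    (hE : Nat.card G.edgeSet + 6 = 3 * Nat.card V) (hV : 3 ≤ Nat.card V) : S.Rigid G := by
  classical
  obtain ⟨h3, hdig, hsum⟩ := hS.count hG hE hV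
  have : Fintype G.edgeSet := Fintype.ofFinite _
  -- functions constant on digons are functions of the ends
  have hκ : ∀ κ : B → ZMod 2, (∀ q, (S.fiber q).card = 2 → ∑ a ∈ S.fiber q, κ a.1 = 0) →
      ∀ b b', S.ends b = S.ends b' → κ b = κ b' := by
    intro κ hκ b b' h
    obtain ⟨g, rfl⟩ := hdig (mem_digonal.2 hκ)
    exact pullback_congr h
  have hadj : ∀ b, S.ends b ∈ G.edgeSet := by
    intro b
    obtain ⟨g, hg⟩ := hdig (mem_digonal (S := S) (ω := fun _ => 1) |>.2
      (fun q hq => by rw [Finset.sum_const, hq]; rfl))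
    by_contra hb
    have := congrFun hg b
    rw [pullback_apply_of_notMem hb] at this
    exact zero_ne_one this
  -- Three or more such sides would mean at least |Z| + 2 copies of `e` for |Z| digons, hence a
  -- function that agrees across digons but separates two copies.
  have hle : ∀ e : Sym2 V, Nat.card {a // 3 ≤ (S.fiber (S.face a)).card ∧ S.ends a.1 = e} ≤ 2 := by
    intro e
    obtain ⟨Z, hZ, hc⟩ := hS.count_ends e
    by_contra hgt
    obtain ⟨κ, hk0, hkZ, b, b', hb, hb', hne⟩ := S.exists_nonconstant e Z (by omega)
    apply hne
    refine hκ κ (fun q hq => ?_) b b' (hb.trans hb'.symm)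
    by_cases hq' : q ∈ Z
    · exact hkZ q hq'
    · refine Finset.sum_eq_zero fun a ha => hk0 _ fun h => hq' ((hZ q).2 ⟨hq, a, ha, h⟩)
  -- The sides on large faces number 2|E| in total, so the bound 2 is attained at every edge.
  have heq : ∀ e ∈ G.edgeSet,
      Nat.card {a // 3 ≤ (S.fiber (S.face a)).card ∧ S.ends a.1 = e} = 2 := by
    have hN : ∀ e : Sym2 V, Nat.card {a // 3 ≤ (S.fiber (S.face a)).card ∧ S.ends a.1 = e} =
        ∑ a ∈ Finset.univ.filter (fun a => 3 ≤ (S.fiber (S.face a)).card),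
          if S.ends a.1 = e then 1 else 0 := by
      intro e
      rw [Nat.card_eq_fintype_card, Fintype.card_subtype, ← Finset.sum_filter,
        Finset.filter_filter, Finset.card_eq_sum_ones]
    have h1 : ∑ e : G.edgeSet,
        Nat.card {a // 3 ≤ (S.fiber (S.face a)).card ∧ S.ends a.1 = e} =
        ∑ e : G.edgeSet, 2 := by
      simp only [hN]
      rw [Finset.sum_comm, Finset.sum_const, smul_eq_mul, mul_comm, Finset.card_univ,
        ← Nat.card_eq_fintype_card, ← hsum]
      rw [Finset.sum_congr rfl (fun q _ => Finset.card_eq_sum_ones (S.fiber q)),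
        sum_fiber_filter]
      refine Finset.sum_congr rfl fun a _ => ?_
      rw [Finset.sum_eq_single ⟨S.ends a.1, hadj a.1⟩]
      · simp
      · intro e _ hne
        exact if_neg fun h => hne (Subtype.ext h.symm)
      · simp
    intro e he
    exact (Finset.sum_eq_sum_iff_of_le fun (e : G.edgeSet) _ => hle e).1 h1 ⟨e, he⟩
      (Finset.mem_univ _)
  have hadj' : ∀ a, G.Adj (S.src a) (S.tgt a) := fun a => by
    have := hadj a.1
    rwa [S.ends_eq] at this
  have hcard : ∀ q, (S.fiber q).card = 0 ∨ (S.fiber q).card = 2 ∨ (S.fiber q).card = 3 := by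
    intro q
    have := hS.card_ne_one q
    have := h3 q
    omega
  have hex : ∀ d : G.Dart, ∃! a, S.src a = d.fst ∧ S.tgt a = d.snd ∧
      (S.fiber (S.face a)).card = 3 := by
    intro d
    set x := d.fst
    set y := d.snd
    have hxy : x ≠ y := d.fst_ne_snd
    have h1 := heq s(x, y) d.edge_mem
    have h2 := hS.balance x y (fun _ => 1) (Finset.univ.filter fun q => 3 ≤ (S.fiber q).card)
      (fun q hq h0 => by
        have hq' : ¬ 3 ≤ (S.fiber q).card := by simpa using hq
        exact ⟨by have := hcard q; omega, fun _ _ _ _ => rfl⟩)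
    rw [sum_fiber_filter] at h2
    rw [Nat.card_eq_fintype_card, Fintype.card_subtype, ← Finset.filter_filter,
      Finset.card_filter] at h1
    have h4 : ∑ a ∈ Finset.univ.filter (fun a => 3 ≤ (S.fiber (S.face a)).card),
        (if S.ends a.1 = s(x, y) then (1 : ℤ) else 0) = 2 := by exact_mod_cast h1
    -- Of the two sides over an edge, one runs in each direction, by `balance` with weight 1.
    have h5 : 2 * ∑ a ∈ Finset.univ.filter (fun a => 3 ≤ (S.fiber (S.face a)).card),
        (if S.src a = x ∧ S.tgt a = y then (1 : ℤ) else 0) = 2 := by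
      have hp : ∀ a, 2 * (if S.src a = x ∧ S.tgt a = y then (1 : ℤ) else 0) =
          (if S.ends a.1 = s(x, y) then (1 : ℤ) else 0) + 1 * S.crossing x y a := ?_
      · rw [Finset.mul_sum, Finset.sum_congr rfl fun a _ => hp a, Finset.sum_add_distrib, h4, h2,
          add_zero]
      intro a
      rw [S.ends_eq]
      simp only [crossing, Sym2.eq_iff]
      by_cases p : S.src a = x ∧ S.tgt a = y
      · simp [p, hxy]
      · by_cases p' : S.src a = y ∧ S.tgt a = x
        · simp [p', hxy.symm]
        · simp [p, p']
    have h6 : (Finset.univ.filter fun a => 3 ≤ (S.fiber (S.face a)).card ∧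
        (S.src a = x ∧ S.tgt a = y)).card = 1 := by
      rw [← Finset.filter_filter, Finset.card_filter]
      have : ∑ a ∈ Finset.univ.filter (fun a => 3 ≤ (S.fiber (S.face a)).card),
        (if S.src a = x ∧ S.tgt a = y then (1 : ℤ) else 0) = 1 := by omega
      exact_mod_cast this
    obtain ⟨a, ha⟩ := Finset.card_eq_one.1 h6
    have hm : ∀ a', a' = a ↔ 3 ≤ (S.fiber (S.face a')).card ∧ (S.src a' = x ∧ S.tgt a' = y) := by
      intro a'
      rw [← Finset.mem_singleton, ← ha]
      simp
    have ha' := (hm a).1 rfl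
    refine ⟨a, ⟨ha'.2.1, ha'.2.2, h3 _ ha'.1⟩, fun a' h' => ?_⟩
    exact (hm a').2 ⟨h'.2.2.ge, h'.1, h'.2.1⟩
  refine ⟨hadj', hcard, hex, ?_⟩
  intro a₀ h2
  obtain ⟨Z, hZ, hc⟩ := hS.count_ends (S.ends a₀.1)
  rw [heq _ (hadj _)] at hc
  have hmem : S.face a₀ ∈ Z := (hZ _).2 ⟨h2, a₀, mem_fiber.2 rfl, rfl⟩
  have hpos := Finset.card_pos.2 ⟨_, hmem⟩
  -- The number of copies is |Z| + 1. Dropping the condition at the face of `a₀` leaves room for a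
  -- nonconstant `κ`, which must then jump exactly across that digon.
  obtain ⟨κ, hk0, hkZ, b, b', hb, hb', hne⟩ := S.exists_nonconstant (S.ends a₀.1)
    (Z.erase (S.face a₀)) (by rw [Finset.card_erase_of_mem hmem]; omega)
  have hk2 : ∀ q, q ≠ S.face a₀ → (S.fiber q).card = 2 → ∑ a ∈ S.fiber q, κ a.1 = 0 := by
    intro q hq hq2
    by_cases hq' : q ∈ Z
    · exact hkZ q (Finset.mem_erase.2 ⟨hq, hq'⟩)
    · exact Finset.sum_eq_zero fun a ha => hk0 _ fun h => hq' ((hZ q).2 ⟨hq2, a, ha, h⟩)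
  have hconst : ∀ q, q ≠ S.face a₀ → (S.fiber q).card = 2 →
      ∀ a ∈ S.fiber q, ∀ a' ∈ S.fiber q, κ a.1 = κ a'.1 := fun q hq hq2 =>
    (hS.sum_eq_zero_iff_of_card_two hq2 κ).1 (hk2 q hq hq2)
  obtain ⟨a₁, ha₁, hne₁, hf, e1, e2⟩ := hS.of_card_two h2 (mem_fiber.2 (rfl : S.face a₀ = _))
  have hdiff : κ a₁.1 ≠ κ a₀.1 := by
    intro h
    apply hne
    refine hκ κ (fun q hq => ?_) b b' (hb.trans hb'.symm)
    by_cases hq' : q = S.face a₀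
    · subst hq'
      rw [sum_eq_add_of_forall hne₁ (mem_fiber.2 rfl) ha₁ hf, h]
      exact CharTwo.add_self_eq_zero _
    · exact hk2 q hq' hq
  refine ⟨κ, hconst, ?_, ?_⟩
  · intro a h1 _ h3
    rcases hf a (mem_fiber.2 h3) with rfl | rfl
    · exact absurd h1 (S.src_ne_tgt _)
    · exact hdiff
  · obtain ⟨p, hp, hpu⟩ := hex ⟨(S.src a₀, S.tgt a₀), hadj' a₀⟩
    obtain ⟨m, hm, hmu⟩ := hex ⟨(S.tgt a₀, S.src a₀), (hadj' a₀).symm⟩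
    have hne₀ := S.src_ne_tgt a₀
    -- With this weight the cut digon contributes 1 through `a₀` alone, so `balance` reads 1 + k p -
    -- k m = 0 for the two triangle sides `p` and `m`. Hence k p = 0 and k m = 1.
    let k : B → ℤ := fun b => if κ b = κ a₀.1 then 1 else 0
    have hnb : S.face a₀ ∉ Finset.univ.filter fun q => (S.fiber q).card = 3 := by
      simp [h2]
    have h1 := hS.balance (S.src a₀) (S.tgt a₀) k
      (insert (S.face a₀) (Finset.univ.filter fun q => (S.fiber q).card = 3))
      (fun q hq h0 => by
        have hq' : q ≠ S.face a₀ ∧ (S.fiber q).card ≠ 3 := by simpa using hq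
        have h2 : (S.fiber q).card = 2 := by have := hcard q; omega
        refine ⟨h2, fun a ha a' ha' => ?_⟩
        simp only [k, hconst q hq'.1 h2 a ha a' ha'])
    rw [Finset.sum_insert hnb, sum_eq_add_of_forall hne₁ (mem_fiber.2 rfl) ha₁ hf,
      sum_fiber_filter] at h1
    have h4 : ∀ a ∈ Finset.univ.filter (fun a => (S.fiber (S.face a)).card = 3),
        k a.1 * S.crossing (S.src a₀) (S.tgt a₀) a =
          (if p = a then k a.1 else 0) - (if m = a then k a.1 else 0) := by
      intro a ha
      have ha3 := (Finset.mem_filter.1 ha).2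
      have i1 : (S.src a = S.src a₀ ∧ S.tgt a = S.tgt a₀) ↔ p = a := by
        constructor
        · exact fun h => (hpu a ⟨h.1, h.2, ha3⟩).symm
        · rintro rfl; exact ⟨hp.1, hp.2.1⟩
      have i2 : (S.src a = S.tgt a₀ ∧ S.tgt a = S.src a₀) ↔ m = a := by
        constructor
        · exact fun h => (hmu a ⟨h.1, h.2, ha3⟩).symm
        · rintro rfl; exact ⟨hm.1, hm.2.1⟩
      simp only [crossing, i1, i2, mul_sub, mul_ite, mul_one, mul_zero]
    rw [Finset.sum_congr rfl h4, Finset.sum_sub_distrib, Finset.sum_ite_eq, Finset.sum_ite_eq,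
      if_pos (by simpa using hp.2.2), if_pos (by simpa using hm.2.2)] at h1
    simp only [crossing, e1, e2, hne₀, hne₀.symm, k, hdiff, if_true, if_false, and_true,
      and_false, sub_zero, mul_one, zero_mul, add_zero] at h1
    intro a ha3
    constructor
    · intro s1 s2 hh
      rw [hpu a ⟨s1, s2, ha3⟩] at hh
      rw [if_pos hh] at h1
      split_ifs at h1 <;> omega
    · intro s1 s2
      rw [hmu a ⟨s1, s2, ha3⟩]
      by_contra hh
      rw [if_neg hh] at h1
      split_ifs at h1 <;> omega

end FaceSystem

/-! ### Labelled grids -/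

/-- A labelling of the points `(k, r)`, `k ≤ N`, `r ≤ h`, of a grid such that label classes are
connected (expressed by the constancy of locally constant functions) and all edges of `G` are
realized. -/
structure GridLabelling {V : Type*} (G : SimpleGraph V) (N h : ℕ) (ℓ : ℕ → ℕ → V) : Prop where
  conn : ∀ φ : ℕ → ℕ → ZMod 2,
    (∀ k r, k < N → r ≤ h → ℓ k r = ℓ (k + 1) r → φ k r = φ (k + 1) r) →
    (∀ k r, k ≤ N → r < h → ℓ k r = ℓ k (r + 1) → φ k r = φ k (r + 1)) →
    ∀ k r k' r', k ≤ N → r ≤ h → k' ≤ N → r' ≤ h → ℓ k r = ℓ k' r' → φ k r = φ k' r'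
  edge : ∀ e ∈ G.edgeSet, (∃ k r, k < N ∧ r ≤ h ∧ s(ℓ k r, ℓ (k + 1) r) = e) ∨
    ∃ k r, k ≤ N ∧ r < h ∧ s(ℓ k r, ℓ k (r + 1)) = e

section

variable {V : Type*} {G : SimpleGraph V} {N h : ℕ} {ℓ : ℕ → ℕ → V}

theorem GridRepresentation.exists_gridLabelling
    (R : GridRepresentation G (N + 1) (h + 1)) : ∃ ℓ, GridLabelling G N h ℓ := by
  let pt : ℕ → ℕ → Fin (N + 1) × Fin (h + 1) := fun k r =>
    (⟨min k N, by omega⟩, ⟨min r h, by omega⟩)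
  have hpt : ∀ p : Fin (N + 1) × Fin (h + 1), pt p.1 p.2 = p := by
    rintro ⟨⟨k, hk⟩, ⟨r, hr⟩⟩
    simp only [pt, Prod.mk.injEq, Fin.mk.injEq]
    omega
  have hadj : ∀ p q, (gridGraph (N + 1) (h + 1)).Adj p q →
      ((p.1 : ℕ) + 1 = q.1 ∧ (p.2 : ℕ) = q.2) ∨ ((q.1 : ℕ) + 1 = p.1 ∧ (p.2 : ℕ) = q.2) ∨
      ((p.2 : ℕ) + 1 = q.2 ∧ (p.1 : ℕ) = q.1) ∨ ((q.2 : ℕ) + 1 = p.2 ∧ (p.1 : ℕ) = q.1) := by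
    intro p q hpq
    rw [gridGraph, SimpleGraph.boxProd_adj, SimpleGraph.pathGraph_adj,
      SimpleGraph.pathGraph_adj] at hpq
    rcases hpq with ⟨h1 | h1, h2⟩ | ⟨h1 | h1, h2⟩ <;> simp [h1, h2]
  refine ⟨fun k r => R.label (pt k r), ?_, ?_⟩
  · intro φ h1 h2 k r k' r' hk hr hk' hr' heq
    have hstep : ∀ p q : Fin (N + 1) × Fin (h + 1), (gridGraph (N + 1) (h + 1)).Adj p q →
        R.label p = R.label q → φ p.1 p.2 = φ q.1 q.2 := by
      intro p q hpq hl
      rw [← hpt p, ← hpt q] at hl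
      have b1 := p.1.2
      have b2 := p.2.2
      have b3 := q.1.2
      have b4 := q.2.2
      rcases hadj p q hpq with ⟨e1, e2⟩ | ⟨e1, e2⟩ | ⟨e1, e2⟩ | ⟨e1, e2⟩
      · rw [← e1, ← e2] at hl ⊢
        exact h1 _ _ (by omega) (by omega) hl
      · rw [← e1, e2] at hl ⊢
        exact (h1 _ _ (by omega) (by omega) hl.symm).symm
      · rw [← e1, ← e2] at hl ⊢
        exact h2 _ _ (by omega) (by omega) hl
      · rw [← e1, e2] at hl ⊢
        exact (h2 _ _ (by omega) (by omega) hl.symm).symm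
    have hreach := (R.connected (R.label (pt k r))).preconnected ⟨pt k r, rfl⟩
      ⟨pt k' r', heq.symm⟩
    obtain ⟨w⟩ := hreach
    have hw : ∀ (a b : {p | R.label p = R.label (pt k r)}),
        ((gridGraph (N + 1) (h + 1)).induce _).Walk a b →
        φ a.1.1 a.1.2 = φ b.1.1 b.1.2 := by
      intro a b w
      induction w with
      | nil => rfl
      | @cons a c b hac w ih =>
        rw [← ih]
        exact hstep a.1 c.1 hac (a.2.trans c.2.symm)
    have := hw _ _ w
    simp only [pt] at this
    rwa [min_eq_left hk, min_eq_left hr, min_eq_left hk', min_eq_left hr'] at this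
  · intro e
    induction e with
    | _ x y =>
    intro hxy
    obtain ⟨p, q, hpq, rfl, rfl⟩ := R.edge x y hxy
    have b1 := p.1.2
    have b2 := p.2.2
    have b3 := q.1.2
    have b4 := q.2.2
    rw [← hpt p, ← hpt q]
    rcases hadj p q hpq with ⟨e1, e2⟩ | ⟨e1, e2⟩ | ⟨e1, e2⟩ | ⟨e1, e2⟩
    · rw [← e1, ← e2]
      exact Or.inl ⟨p.1, p.2, by omega, by omega, rfl⟩
    · rw [← e1, e2]
      exact Or.inl ⟨q.1, q.2, by omega, by omega, Sym2.eq_swap⟩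
    · rw [← e1, ← e2]
      exact Or.inr ⟨p.1, p.2, by omega, by omega, rfl⟩
    · rw [← e1, e2]
      exact Or.inr ⟨q.1, q.2, by omega, by omega, Sym2.eq_swap⟩

/-- Reversal of the order of columns. -/
theorem GridLabelling.reverse (hl : GridLabelling G N h ℓ) :
    GridLabelling G N h fun k r => ℓ (N - k) r := by
  refine ⟨?_, ?_⟩
  · intro φ h1 h2 k r k' r' hk hr hk' hr' heq
    have := hl.conn (fun k r => φ (N - k) r)
      (fun k r hk hr he => by
        have := h1 (N - (k + 1)) r (by omega) hr (by
          rw [show N - (N - (k + 1)) = k + 1 by omega,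
            show N - (N - (k + 1) + 1) = k by omega, he])
        rw [show N - (k + 1) + 1 = N - k by omega] at this
        exact this.symm)
      (fun k r hk hr he => h2 (N - k) r (by omega) hr (by
        rw [show N - (N - k) = k by omega, he]))
      (N - k) r (N - k') r' (by omega) hr (by omega) hr' heq
    simpa [Nat.sub_sub_self hk, Nat.sub_sub_self hk'] using this
  · intro e he
    rcases hl.edge e he with ⟨k, r, hk, hr, rfl⟩ | ⟨k, r, hk, hr, rfl⟩
    · refine Or.inl ⟨N - (k + 1), r, by omega, hr, ?_⟩
      rw [show N - (N - (k + 1)) = k + 1 by omega, show N - (N - (k + 1) + 1) = k by omega]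
      exact Sym2.eq_swap
    · refine Or.inr ⟨N - k, r, by omega, hr, ?_⟩
      rw [show N - (N - k) = k by omega]

/-- A constant column may be added in front. -/
theorem GridLabelling.cons (hl : GridLabelling G N h ℓ) :
    GridLabelling G (N + 1) h fun k r => if k = 0 then ℓ 0 0 else ℓ (k - 1) r := by
  refine ⟨?_, ?_⟩
  · intro φ h1 h2
    have hc := hl.conn (fun k r => φ (k + 1) r)
      (fun k r hk hr he => h1 (k + 1) r (by omega) hr (by simpa using he))
      (fun k r hk hr he => h2 (k + 1) r (by omega) hr (by simpa using he))
    have h0 : ∀ r ≤ h, φ 0 r = φ 1 0 := by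
      intro r
      induction r with
      | zero => exact fun _ => h1 0 0 (by omega) (by omega) (by simp)
      | succ r ih =>
        intro hr
        rw [← ih (by omega)]
        exact (h2 0 r (by omega) (by omega) (by simp)).symm
    intro k r k' r' hk hr hk' hr' heq
    rcases k with _ | k <;> rcases k' with _ | k'
    · rw [h0 r hr, h0 r' hr']
    · rw [h0 r hr]
      exact hc 0 0 k' r' (by omega) (by omega) (by omega) hr' (by simpa using heq)
    · rw [h0 r' hr']
      exact hc k r 0 0 (by omega) hr (by omega) (by omega) (by simpa using heq)
    · exact hc k r k' r' (by omega) hr (by omega) hr' (by simpa using heq)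
  · intro e he
    rcases hl.edge e he with ⟨k, r, hk, hr, rfl⟩ | ⟨k, r, hk, hr, rfl⟩
    · exact Or.inl ⟨k + 1, r, by omega, hr, by simp⟩
    · exact Or.inr ⟨k + 1, r, by omega, hr, by simp⟩

/-- Constant columns at both ends. -/
theorem GridLabelling.exists_pad (hl : GridLabelling G N h ℓ) :
    ∃ N' ℓ', GridLabelling G N' h ℓ' ∧ (∀ r, ℓ' 0 r = ℓ' 0 0) ∧ ∀ r, ℓ' N' r = ℓ' N' 0 := by
  refine ⟨N + 1 + 1, _, hl.cons.reverse.cons.reverse, ?_, ?_⟩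
  · intro r
    simp
  · intro r
    simp

/-- If the boundary of the grid is monochromatic, then a further label can be brought to the
boundary. -/
theorem GridLabelling.exists_boundary (hl : GridLabelling G N h ℓ)
    (h0 : ∀ r, ℓ 0 r = ℓ 0 0) (hN : ∀ r, ℓ N r = ℓ N 0) (hne : ∃ e, e ∈ G.edgeSet)
    (hb : ∀ k ≤ N, ℓ k 0 = ℓ 0 0 ∧ ℓ k h = ℓ 0 0) :
    ∃ N' ℓ', GridLabelling G N' h ℓ' ∧ (∀ r, ℓ' 0 r = ℓ' 0 0) ∧ (∀ r, ℓ' N' r = ℓ' N' 0) ∧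
      ∃ k ≤ N', ℓ' k 0 ≠ ℓ' 0 0 := by
  classical
  -- a point with another label
  obtain ⟨c, j₀, hc, hj₀, hw⟩ : ∃ k r, k ≤ N ∧ r ≤ h ∧ ℓ k r ≠ ℓ 0 0 := by
    obtain ⟨e, he⟩ := hne
    by_contra! hcon
    rcases hl.edge e he with ⟨k, r, hk, hr, rfl⟩ | ⟨k, r, hk, hr, rfl⟩
    · rw [hcon k r (by omega) hr, hcon (k + 1) r hk hr] at he
      exact G.loopless.irrefl _ he
    · rw [hcon k r hk (by omega), hcon k (r + 1) hk hr] at he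
      exact G.loopless.irrefl _ he
  obtain ⟨j, hjw, hjmin⟩ : ∃ j, ℓ c j ≠ ℓ 0 0 ∧ ∀ r < j, ℓ c r = ℓ 0 0 := by
    have hex : ∃ j, ℓ c j ≠ ℓ 0 0 := ⟨j₀, hw⟩
    exact ⟨Nat.find hex, Nat.find_spec hex, fun r hr => not_not.1 (Nat.find_min hex hr)⟩
  have hjh : j < h := by
    by_contra hjh
    rcases lt_or_eq_of_le (not_lt.1 hjh) with hlt | rfl
    · exact hw (hjmin _ (by omega))
    · exact hjw (hb c hc).2
  have hj0 : 0 < j := by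
    by_contra hj
    rw [show j = 0 by omega] at hjw
    exact hjw (hb c hc).1
  have hc0 : 0 < c := by
    by_contra hc'
    rw [show c = 0 by omega, h0] at hjw
    exact hjw rfl
  have hcN : c < N := by
    by_contra hc'
    rw [show c = N by omega, hN] at hjw
    exact hjw (hb N le_rfl).1
  -- Column `c` is tripled. In the middle copy the label at height `j` is extended down to the
  -- bottom row, which is the channel.
  let ℓ' : ℕ → ℕ → V := fun k r =>
    if k ≤ c then ℓ k r else if k = c + 1 then (if r < j then ℓ c j else ℓ c r) else ℓ (k - 2) r
  have l1 : ∀ k r, k ≤ c → ℓ' k r = ℓ k r := fun k r hk => by simp [ℓ', hk]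
  have l2 : ∀ r, r < j → ℓ' (c + 1) r = ℓ c j := fun r hr => by simp [ℓ', hr]
  have l3 : ∀ r, ¬ r < j → ℓ' (c + 1) r = ℓ c r := fun r hr => by simp [ℓ', hr]
  have l4 : ∀ k r, c ≤ k → ℓ' (k + 2) r = ℓ k r := fun k r hk => by
    simp [ℓ', show ¬ k + 2 ≤ c by omega, show k + 1 ≠ c by omega]
  refine ⟨N + 2, ℓ', ⟨?_, ?_⟩, ?_, ?_, c + 1, by omega, ?_⟩
  · intro φ h1 h2
    -- the ring along the boundary
    have col : ∀ (k : ℕ) (x : V) (m : ℕ), k ≤ N + 2 → m ≤ h → (∀ r ≤ m, ℓ' k r = x) →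
        ∀ r ≤ m, φ k r = φ k 0 := by
      intro k x m hk hm hx r
      induction r with
      | zero => exact fun _ => rfl
      | succ r ih =>
        intro hr
        rw [← ih (by omega)]
        exact (h2 k r hk (by omega) (by rw [hx r (by omega), hx (r + 1) hr])).symm
    have row : ∀ (r : ℕ) (x : V) (m n : ℕ), m ≤ n → n ≤ N + 2 → r ≤ h →
        (∀ k, m ≤ k → k ≤ n → ℓ' k r = x) → φ n r = φ m r := by
      intro r x m n hmn
      induction n, hmn using Nat.le_induction with
      | base => exact fun _ _ _ => rfl
      | succ n hmn ih =>
        intro hn hr hx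
        rw [← ih (by omega) hr (fun k hk hk' => hx k hk (by omega))]
        exact (h1 n r (by omega) hr (by
          rw [hx n hmn (by omega), hx (n + 1) (by omega) le_rfl])).symm
    have top : ∀ k ≤ N + 2, ℓ' k h = ℓ 0 0 := by
      intro k hk
      by_cases hk1 : k ≤ c
      · rw [l1 k h hk1]; exact (hb k (by omega)).2
      by_cases hk2 : k = c + 1
      · rw [hk2, l3 h (by omega)]; exact (hb c hc).2
      · obtain ⟨k, rfl⟩ : ∃ k', k = k' + 2 := ⟨k - 2, by omega⟩
        rw [l4 k h (by omega)]; exact (hb k (by omega)).2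
    -- The channel separates the two outer copies of column `c` below height `j`, but the boundary
    -- label still connects them around the left end, the top row and the right end.
    have ring0 : φ (c + 2) 0 = φ c 0 := by
      have e1 := row 0 (ℓ 0 0) 0 c (by omega) (by omega) (by omega)
        (fun k _ hk => by rw [l1 k 0 hk]; exact (hb k (by omega)).1)
      have e2 := row 0 (ℓ 0 0) (c + 2) (N + 2) (by omega) (by omega) (by omega)
        (fun k hk hk' => by
          obtain ⟨k, rfl⟩ : ∃ k', k = k' + 2 := ⟨k - 2, by omega⟩
          rw [l4 k 0 (by omega)]; exact (hb k (by omega)).1)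
      have e3 := row h (ℓ 0 0) 0 (N + 2) (by omega) (by omega) (by omega)
        (fun k _ hk => top k hk)
      have e4 := col 0 (ℓ 0 0) h (by omega) le_rfl
        (fun r _ => by rw [l1 0 r (by omega)]; exact h0 r) h le_rfl
      have e5 := col (N + 2) (ℓ 0 0) h (by omega) le_rfl
        (fun r _ => by rw [l4 N r (by omega), hN]; exact (hb N le_rfl).1) h le_rfl
      rw [e1, ← e2, ← e5, e3, e4]
    have ring : ∀ r ≤ h, φ (c + 2) r = φ c r := by
      intro r hr
      by_cases hrj : r < j
      · rw [col c (ℓ 0 0) r (by omega) hr (fun r' hr' => by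
            rw [l1 c r' le_rfl]; exact hjmin r' (by omega)) r le_rfl,
          col (c + 2) (ℓ 0 0) r (by omega) hr (fun r' hr' => by
            rw [l4 c r' le_rfl]; exact hjmin r' (by omega)) r le_rfl, ring0]
      · rw [h1 c r (by omega) hr (by rw [l1 c r le_rfl, l3 r hrj]),
          h1 (c + 1) r (by omega) hr (by rw [l4 c r le_rfl, l3 r hrj])]
    -- Forgetting the two inserted columns gives a locally constant function on the original grid.
    have hcn := hl.conn (fun k r => if k ≤ c then φ k r else φ (k + 2) r)
      (fun k r hk hr he => by
        rcases lt_trichotomy k c with hkc | rfl | hkc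
        · simp only [show k ≤ c by omega, show k + 1 ≤ c by omega, if_true]
          exact h1 k r (by omega) hr (by rw [l1 k r (by omega), l1 (k + 1) r (by omega), he])
        · simp only [le_refl, if_true, show ¬ k + 1 ≤ k by omega, if_false]
          rw [← ring r hr]
          exact h1 (k + 2) r (by omega) hr (by
            rw [l4 k r le_rfl, show k + 2 + 1 = k + 1 + 2 by omega, l4 (k + 1) r (by omega), he])
        · simp only [show ¬ k ≤ c by omega, show ¬ k + 1 ≤ c by omega, if_false]
          exact h1 (k + 2) r (by omega) hr (by
            rw [l4 k r hkc.le, show k + 2 + 1 = k + 1 + 2 by omega, l4 (k + 1) r (by omega), he]))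
      (fun k r hk hr he => by
        by_cases hkc : k ≤ c
        · simp only [hkc, if_true]
          exact h2 k r (by omega) hr (by rw [l1 k r hkc, l1 k (r + 1) hkc, he])
        · simp only [hkc, if_false]
          exact h2 (k + 2) r (by omega) hr (by
            rw [l4 k r (by omega), l4 k (r + 1) (by omega), he]))
    -- every point is joined to a copy of an original one
    have hred : ∀ k r, k ≤ N + 2 → r ≤ h → ∃ k' r', k' ≤ N ∧ r' ≤ h ∧ ℓ' k r = ℓ k' r' ∧
        φ k r = if k' ≤ c then φ k' r' else φ (k' + 2) r' := by
      intro k r hk hr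
      by_cases hk1 : k ≤ c
      · exact ⟨k, r, by omega, hr, l1 k r hk1, by simp [hk1]⟩
      by_cases hk2 : k = c + 1
      · subst hk2
        have hmid : ∀ r ≤ h, ¬ r < j → φ (c + 1) r = φ c r := fun r hr hrj =>
          (h1 c r (by omega) hr (by rw [l1 c r le_rfl, l3 r hrj])).symm
        by_cases hrj : r < j
        · refine ⟨c, j, hc, hjh.le, l2 r hrj, ?_⟩
          have hx : ∀ r' ≤ j, ℓ' (c + 1) r' = ℓ c j := by
            intro r' hr'
            rcases lt_or_eq_of_le hr' with hlt | rfl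
            · exact l2 r' hlt
            · exact l3 _ (by omega)
          rw [col (c + 1) (ℓ c j) j (by omega) hjh.le hx r hrj.le,
            ← col (c + 1) (ℓ c j) j (by omega) hjh.le hx j le_rfl,
            hmid j hjh.le (by omega)]
          simp
        · exact ⟨c, r, hc, hr, l3 r hrj, by rw [hmid r hr hrj]; simp⟩
      · obtain ⟨k, rfl⟩ : ∃ k', k = k' + 2 := ⟨k - 2, by omega⟩
        refine ⟨k, r, by omega, hr, l4 k r (by omega), ?_⟩
        by_cases hkc : k ≤ c
        · rw [if_pos hkc, show k = c by omega, ring r hr]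
        · rw [if_neg hkc]
    intro k r k' r' hk hr hk' hr' heq
    obtain ⟨a, b, ha, hb', e1, e2⟩ := hred k r hk hr
    obtain ⟨a', b', ha', hb'', e1', e2'⟩ := hred k' r' hk' hr'
    rw [e2, e2']
    exact hcn a b a' b' ha hb' ha' hb'' (by rw [← e1, ← e1', heq])
  · intro e he
    rcases hl.edge e he with ⟨k, r, hk, hr, rfl⟩ | ⟨k, r, hk, hr, rfl⟩
    · by_cases hkc : k < c
      · exact Or.inl ⟨k, r, by omega, hr, by rw [l1 k r hkc.le, l1 (k + 1) r hkc]⟩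
      · refine Or.inl ⟨k + 2, r, by omega, hr, ?_⟩
        rw [l4 k r (by omega), show k + 2 + 1 = k + 1 + 2 by omega, l4 (k + 1) r (by omega)]
    · by_cases hkc : k ≤ c
      · exact Or.inr ⟨k, r, by omega, hr, by rw [l1 k r hkc, l1 k (r + 1) hkc]⟩
      · refine Or.inr ⟨k + 2, r, by omega, hr, ?_⟩
        rw [l4 k r (by omega), l4 k (r + 1) (by omega)]
  · intro r
    rw [l1 0 r (by omega), l1 0 0 (by omega), h0]
  · intro r
    rw [l4 N r hcN.le, l4 N 0 hcN.le, hN]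
  · rw [l2 0 hj0, l1 0 0 (by omega)]
    exact hjw

/-- A labelled grid in which consecutive columns differ in at most one point, and whose first and
last column are constant, while its boundary is not. -/
structure Sweep (G : SimpleGraph V) (N h : ℕ) (ℓ : ℕ → ℕ → V) : Prop
    extends GridLabelling G N h ℓ where
  first : ∀ r ≤ h, ℓ 0 r = ℓ 0 0
  last : ∀ r ≤ h, ℓ N r = ℓ N 0
  boundary : ∃ k ≤ N, ℓ k 0 ≠ ℓ 0 0 ∨ ℓ k h ≠ ℓ 0 0
  step : ∀ k < N, ∃ r ≤ h, ∀ r' ≤ h, r' ≠ r → ℓ (k + 1) r' = ℓ k r'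

theorem Sweep.reverse (hl : Sweep G N h ℓ) : Sweep G N h fun k r => ℓ (N - k) r := by
  refine ⟨hl.toGridLabelling.reverse, ?_, ?_, ?_, ?_⟩
  · simpa using hl.last
  · simpa using hl.first
  · by_contra! hcon
    obtain ⟨k, hk, hne⟩ := hl.boundary
    have h1 := hcon (N - k) (by omega)
    have h2 := hcon N le_rfl
    simp only [Nat.sub_sub_self hk, Nat.sub_self, Nat.sub_zero] at h1 h2
    rw [h1.1, h1.2, h2.1] at hne
    exact hne.elim (fun h => h rfl) fun h => h rfl
  · intro k hk
    obtain ⟨r, hrh, hr⟩ := hl.step (N - (k + 1)) (by omega)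
    refine ⟨r, hrh, fun r' hr' hne => ?_⟩
    rw [← hr r' hr' hne]
    congr 1
    omega

/-- A staircase replacement of each column change by h + 1 changes of single points. Row `r` passes
from column `i` to `i + 1` between the new columns i(h+1) + r and i(h+1) + r + 1, and the new column
i(h+1) is the old column `i`. -/
theorem GridLabelling.refine (hl : GridLabelling G N h ℓ) :
    GridLabelling G (N * (h + 1)) h fun k r => ℓ ((k + h - r) / (h + 1)) r := by
  have hcol : ∀ i r, r ≤ h → (i * (h + 1) + h - r) / (h + 1) = i := by
    intro i r hr
    rw [show i * (h + 1) + h - r = (h - r) + (h + 1) * i by rw [mul_comm]; omega,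
      Nat.add_mul_div_left _ _ (by omega), Nat.div_eq_of_lt (by omega), zero_add]
  have hmono : ∀ k k' r, k ≤ k' → (k + h - r) / (h + 1) ≤ (k' + h - r) / (h + 1) :=
    fun k k' r hk => Nat.div_le_div_right (by omega)
  have hle : ∀ k r, k ≤ N * (h + 1) → r ≤ h → (k + h - r) / (h + 1) ≤ N := fun k r hk hr => by
    rw [← hcol N r hr]
    exact hmono _ _ r hk
  refine ⟨?_, ?_⟩
  · intro φ h1 h2
    have hrun : ∀ r k k', r ≤ h → k ≤ k' → k' ≤ N * (h + 1) →
        (∀ m, k ≤ m → m < k' → ℓ ((m + h - r) / (h + 1)) r =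
          ℓ ((m + 1 + h - r) / (h + 1)) r) → φ k r = φ k' r := by
      intro r k k' hr hk
      induction k', hk using Nat.le_induction with
      | base => exact fun _ _ => rfl
      | succ k' hk ih =>
        intro hk' hm
        rw [ih (by omega) fun m h1 h2 => hm m h1 (by omega)]
        exact h1 k' r (by omega) hr (hm k' hk (by omega))
    have hrun' : ∀ r k k', r ≤ h → k ≤ N * (h + 1) → k' ≤ N * (h + 1) →
        (k + h - r) / (h + 1) = (k' + h - r) / (h + 1) → φ k r = φ k' r := by
      have : ∀ r k k', r ≤ h → k ≤ k' → k' ≤ N * (h + 1) →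
          (k + h - r) / (h + 1) = (k' + h - r) / (h + 1) → φ k r = φ k' r := by
        intro r k k' hr hk hk' he
        refine hrun r k k' hr hk hk' fun m hm hm' => ?_
        have a1 := hmono k m r hm
        have a2 := hmono m (m + 1) r (by omega)
        have a3 := hmono (m + 1) k' r (by omega)
        rw [show (m + h - r) / (h + 1) = (m + 1 + h - r) / (h + 1) by omega]
      intro r k k' hr hk hk' he
      rcases le_total k k' with hkk | hkk
      · exact this r k k' hr hkk hk' he
      · exact (this r k' k hr hkk hk he.symm).symm
    have hc := hl.conn (fun k r => φ (k * (h + 1)) r)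
      (fun k r hk hr he => by
        have hN : (k + 1) * (h + 1) ≤ N * (h + 1) := Nat.mul_le_mul_right _ hk
        refine hrun r _ _ hr (Nat.mul_le_mul_right _ (by omega)) hN fun m hm hm' => ?_
        have a1 := hmono _ m r hm
        have a2 := hmono m (m + 1) r (by omega)
        have a3 := hmono (m + 1) _ r hm'
        rw [hcol k r hr] at a1
        rw [hcol (k + 1) r hr] at a3
        have : ∀ c, k ≤ c → c ≤ k + 1 → ℓ c r = ℓ k r := by
          intro c hc hc'
          rcases Nat.lt_or_ge k c with hkc | hkc
          · rw [show c = k + 1 by omega, he]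
          · rw [show c = k by omega]
        rw [this _ a1 (by omega), this _ (by omega) a3])
      (fun k r hk hr he => h2 _ r (Nat.mul_le_mul_right _ hk) hr (by
        rw [hcol k r (by omega), hcol k (r + 1) (by omega), he]))
    have hnode : ∀ k r, k ≤ N * (h + 1) → r ≤ h →
        φ k r = φ ((k + h - r) / (h + 1) * (h + 1)) r := by
      intro k r hk hr
      refine hrun' r _ _ hr hk (Nat.mul_le_mul_right _ (hle k r hk hr)) ?_
      rw [hcol _ r hr]
    intro k r k' r' hk hr hk' hr' he
    rw [hnode k r hk hr, hnode k' r' hk' hr']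
    exact hc _ _ _ _ (hle k r hk hr) hr (hle k' r' hk' hr') hr' he
  · intro e he
    rcases hl.edge e he with ⟨k, r, hk, hr, rfl⟩ | ⟨k, r, hk, hr, rfl⟩
    · have hk' : (k + 1) * (h + 1) ≤ N * (h + 1) := Nat.mul_le_mul_right _ hk
      rw [add_mul, one_mul] at hk'
      refine Or.inl ⟨k * (h + 1) + r, r, by omega, hr, ?_⟩
      rw [show k * (h + 1) + r + h - r = k * (h + 1) + h - 0 by omega, hcol k 0 (by omega),
        show k * (h + 1) + r + 1 + h - r = (k + 1) * (h + 1) + h - h by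
          rw [add_mul, one_mul]; omega, hcol (k + 1) h le_rfl]
    · refine Or.inr ⟨k * (h + 1), r, Nat.mul_le_mul_right _ hk, hr, ?_⟩
      rw [hcol k r (by omega), hcol k (r + 1) (by omega)]

/-- A grid representation yields a sweep of the same height. -/
theorem GridRepresentation.exists_sweep (R : GridRepresentation G (N + 1) (h + 1))
    (hne : ∃ e, e ∈ G.edgeSet) : ∃ N ℓ, Sweep G N h ℓ := by
  obtain ⟨ℓ₀, h₀⟩ := R.exists_gridLabelling
  obtain ⟨N₁, ℓ₁, h₁, hf₁, hl₁⟩ := h₀.exists_pad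
  obtain ⟨N, ℓ, hl, hf, hla, hb⟩ : ∃ N ℓ, GridLabelling G N h ℓ ∧ (∀ r, ℓ 0 r = ℓ 0 0) ∧
      (∀ r, ℓ N r = ℓ N 0) ∧ ∃ k ≤ N, ℓ k 0 ≠ ℓ 0 0 ∨ ℓ k h ≠ ℓ 0 0 := by
    by_cases hb : ∃ k ≤ N₁, ℓ₁ k 0 ≠ ℓ₁ 0 0 ∨ ℓ₁ k h ≠ ℓ₁ 0 0
    · exact ⟨N₁, ℓ₁, h₁, hf₁, hl₁, hb⟩
    · push Not at hb
      obtain ⟨N', ℓ', a1, a2, a3, k, hk, hk'⟩ := h₁.exists_boundary hf₁ hl₁ hne hb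
      exact ⟨N', ℓ', a1, a2, a3, k, hk, Or.inl hk'⟩
  have hcol : ∀ i r, r ≤ h → (i * (h + 1) + h - r) / (h + 1) = i := by
    intro i r hr
    rw [show i * (h + 1) + h - r = (h - r) + (h + 1) * i by rw [mul_comm]; omega,
      Nat.add_mul_div_left _ _ (by omega), Nat.div_eq_of_lt (by omega), zero_add]
  refine ⟨N * (h + 1), _, hl.refine, ?_, ?_, ?_, ?_⟩
  · intro r hr
    have h1 := hcol 0 r hr
    have h2 := hcol 0 0 (by omega)
    rw [zero_mul] at h1 h2
    simp only [h1, h2]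
    exact hf r
  · intro r hr
    simp only [hcol N r hr, hcol N 0 (by omega)]
    exact hla r
  · obtain ⟨k, hk, hne⟩ := hb
    refine ⟨k * (h + 1), Nat.mul_le_mul_right _ hk, ?_⟩
    have h1 := hcol 0 0 (by omega)
    rw [zero_mul] at h1
    simp only [hcol k 0 (by omega), hcol k h le_rfl, h1]
    exact hne
  · intro k hk
    -- The row that passes to the next old column at time `k`. For every other row both quotients
    -- are the same.
    refine ⟨k % (h + 1), Nat.lt_succ_iff.1 (Nat.mod_lt _ (by omega)), fun r hr hne => ?_⟩
    congr 1
    have h1 := Nat.div_add_mod k (h + 1)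
    set q := k / (h + 1)
    set m := k % (h + 1)
    have hm : m < h + 1 := Nat.mod_lt _ (by omega)
    have key : ∀ t c, (c + h - r) = (h + 1) * q + t → t < 2 * (h + 1) →
        (c + h - r) / (h + 1) = q + t / (h + 1) := by
      intro t c hc _
      rw [hc, Nat.mul_add_div (by omega)]
    rw [key (m + h - r) k (by omega) (by omega), key (m + 1 + h - r) (k + 1) (by omega) (by omega)]
    congr 1
    rcases Nat.lt_or_ge m r with hlt | hge
    · rw [Nat.div_eq_of_lt (by omega), Nat.div_eq_of_lt (by omega)]
    · have : ∀ t, h + 1 ≤ t → t < 2 * (h + 1) → t / (h + 1) = 1 := by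
        intro t h1 h2
        exact Nat.div_eq_of_lt_le (by omega) (by omega)
      rw [this _ (by omega) (by omega), this _ (by omega) (by omega)]

end

/-! ### From realized sweeps to homotopies -/

section

variable {V D : Type*} (M : CombMap V D)

theorem CombMap.isWalk_append {x y z : V} {l l' : List D} (h : M.IsWalk x l y)
    (h' : M.IsWalk y l' z) : M.IsWalk x (l ++ l') z := by
  induction l generalizing x with
  | nil =>
    have : x = y := h
    rw [this]
    exact h'
  | cons d l ih => exact ⟨h.1, ih h.2⟩

theorem CombMap.tail_rev (d : D) : M.tail (M.rev d) = M.head d := rfl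

theorem CombMap.head_rev (d : D) : M.head (M.rev d) = M.tail d := by
  rw [CombMap.head, M.rev_rev]

theorem CombMap.flip_face (d : D) : M.flip (M.face d) = M.flip d := by
  classical
  ext a
  simp [CombMap.flip, Equiv.Perm.sameCycle_apply_left]

/-- A sequence of moves through curves with the property `p`, with the sum of its flips. -/
inductive CombMap.Chain (o : D) (s t : Set D) (p : Curve V D → Prop) :
    Curve V D → Curve V D → (D → ℤ) → Prop
  | refl (c : Curve V D) (hc : p c) : CombMap.Chain o s t p c c 0
  | tail {c c' c'' : Curve V D} {Φ φ : D → ℤ} (h : CombMap.Chain o s t p c c' Φ)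
      (hm : M.Move o s t c' c'' φ) (hc : p c'') : CombMap.Chain o s t p c c'' (Φ + φ)

theorem CombMap.Chain.exists_seq {M : CombMap V D} {o : D} {s t : Set D} {p : Curve V D → Prop}
    {c c' : Curve V D} {Φ : D → ℤ} (h : M.Chain o s t p c c' Φ) :
    ∃ (n : ℕ) (curve : ℕ → Curve V D) (flips : ℕ → D → ℤ), curve 0 = c ∧ curve n = c' ∧
      (∀ i ≤ n, p (curve i)) ∧ (∀ i < n, M.Move o s t (curve i) (curve (i + 1)) (flips i)) ∧
      ∀ d, ∑ i ∈ Finset.range n, flips i d = Φ d := by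
  induction h with
  | refl hc =>
    exact ⟨0, fun _ => c, fun _ => 0, rfl, rfl, fun _ _ => hc, fun i hi => absurd hi (by omega),
      fun d => by simp⟩
  | @tail c' c'' Φ φ h hm hc ih =>
    obtain ⟨n, curve, flips, h0, hn, hp, hmv, hs⟩ := ih
    refine ⟨n + 1, fun i => if i ≤ n then curve i else c'', fun i => if i < n then flips i else φ,
      by simp [h0], by simp, ?_, ?_, ?_⟩
    · intro i hi
      by_cases hin : i ≤ n
      · simp only [hin, if_true]; exact hp i hin
      · simp only [hin, if_false]; exact hc
    · intro i hi
      by_cases hin : i < n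
      · simp only [hin, hin.le, show i + 1 ≤ n from hin, if_true]
        exact hmv i hin
      · obtain rfl : i = n := by omega
        simp only [le_refl, lt_irrefl, show ¬ i + 1 ≤ i by omega, if_true, if_false, hn]
        exact hm
    · intro d
      rw [Finset.sum_range_succ, Pi.add_apply, ← hs d]
      congr 1
      · refine Finset.sum_congr rfl fun i hi => ?_
        simp only [Finset.mem_range.1 hi, if_true]
      · simp

/-- The part below the dart `α` of a step of a sweep in which a vertex moves along `α`. -/
def CombMap.UpStep (o α : D) (L L' : List D) (φ : D → ℤ) : Prop :=
  (L = [] ∧ L' = [α] ∧ φ = 0) ∨ (L = [M.rev α] ∧ L' = [] ∧ φ = 0) ∨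
  (L = [M.rev (M.face (M.rev α))] ∧ L' = [M.face (M.face (M.rev α))] ∧ φ = M.flip (M.rev α) ∧
    ¬ M.face.SameCycle o (M.rev α) ∧ M.face (M.face (M.face (M.rev α))) = M.rev α)

/-- The part above the dart `α` of a step of a sweep in which a vertex moves along `α`. -/
def CombMap.LowStep (o α : D) (L L' : List D) (φ : D → ℤ) : Prop :=
  (L = [] ∧ L' = [M.rev α] ∧ φ = 0) ∨ (L = [α] ∧ L' = [] ∧ φ = 0) ∨
  (L = [M.rev (M.face (M.face α))] ∧ L' = [M.face α] ∧ φ = M.flip α ∧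
    ¬ M.face.SameCycle o α ∧ M.face (M.face (M.face α)) = α)

variable {M} {o α : D} {s t : Set D} {L₁ L₁' L₂ L₂' : List D} {φ₁ φ₂ : D → ℤ}

/-- On each side of `α` an edge appears, an edge disappears, or a triangle is flipped. The nine
combinations are a spike, an unspike, two kinds of face-flip in two versions each, the edge-slide,
and two cases in which `α` or its reversal only shifts along the column and the walk stays the same.
-/
theorem CombMap.Move.of_up_low (h₁ : M.UpStep o α L₁ L₁' φ₁) (h₂ : M.LowStep o α L₂ L₂' φ₂)
    (x y : V) (pre post : List D) :
    M.Move o s t ⟨x, pre ++ (L₁ ++ L₂) ++ post, y⟩ ⟨x, pre ++ (L₁' ++ L₂') ++ post, y⟩ (φ₁ + φ₂) ∨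
      (L₁ ++ L₂ = L₁' ++ L₂' ∧ φ₁ + φ₂ = 0) := by
  rcases h₁ with ⟨rfl, rfl, rfl⟩ | ⟨rfl, rfl, rfl⟩ | ⟨rfl, rfl, rfl, ho₁, h3₁⟩ <;>
  rcases h₂ with ⟨rfl, rfl, rfl⟩ | ⟨rfl, rfl, rfl⟩ | ⟨rfl, rfl, rfl, ho₂, h3₂⟩
  · left; left
    have := PosMove.spike (M := M) (o := o) (s := s) (t := t) x y pre post α
    simpa using this
  · right; simp
  · left; left
    have ho : ¬ M.face.SameCycle o (M.face (M.face α)) := by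
      simpa [Equiv.Perm.sameCycle_apply_right] using ho₂
    have := PosMove.flipUp (M := M) (s := s) (t := t) x y pre post (M.face (M.face α)) ho
    rw [h3₂, M.flip_face, M.flip_face] at this
    simpa using this
  · right; simp
  · left; right
    have := PosMove.spike (M := M) (o := o) (s := s) (t := t) x y pre post (M.rev α)
    rw [M.rev_rev] at this
    simpa using this
  · left; left
    have ho : ¬ M.face.SameCycle o (M.face α) := by
      simpa [Equiv.Perm.sameCycle_apply_right] using ho₂
    have := PosMove.flipDown (M := M) (s := s) (t := t) x y pre post (M.face α) ho
    rw [h3₂, M.flip_face] at this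
    simpa using this
  · left; left
    have ho : ¬ M.face.SameCycle o (M.face (M.rev α)) := by
      simpa [Equiv.Perm.sameCycle_apply_right] using ho₁
    have := PosMove.flipUp (M := M) (s := s) (t := t) x y pre post (M.face (M.rev α)) ho
    rw [h3₁, M.flip_face] at this
    simpa using this
  · left; left
    have ho : ¬ M.face.SameCycle o (M.face (M.face (M.rev α))) := by
      simpa [Equiv.Perm.sameCycle_apply_right] using ho₁
    have := PosMove.flipDown (M := M) (s := s) (t := t) x y pre post
      (M.face (M.face (M.rev α))) ho
    rw [h3₁, M.flip_face, M.flip_face, M.rev_rev] at this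
    simpa using this
  · left; left
    have := PosMove.edgeSlide (M := M) (s := s) (t := t) x y pre post α ho₂ ho₁
    rw [add_comm] at this
    simpa using this

theorem CombMap.Move.of_low (h₂ : M.LowStep o α L₂ L₂' φ₂) (hs : M.rev α ∈ s)
    (y : V) (post : List D) :
    M.Move o s t ⟨M.tail α, L₂ ++ post, y⟩ ⟨M.head α, L₂' ++ post, y⟩ φ₂ := by
  rcases h₂ with ⟨rfl, rfl, rfl⟩ | ⟨rfl, rfl, rfl⟩ | ⟨rfl, rfl, rfl, ho₂, h3₂⟩
  · left
    exact PosMove.boundaryStart (M.tail α) y post (M.rev α) (Or.inl hs)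
  · right
    rw [neg_zero]
    exact PosMove.boundaryStart (M.head α) y post α (Or.inr hs)
  · left
    exact PosMove.slideStart y post α ho₂ hs

theorem CombMap.Move.of_up (h₁ : M.UpStep o α L₁ L₁' φ₁) (ht : α ∈ t)
    (x : V) (pre : List D) :
    M.Move o s t ⟨x, pre ++ L₁, M.tail α⟩ ⟨x, pre ++ L₁', M.head α⟩ φ₁ := by
  rcases h₁ with ⟨rfl, rfl, rfl⟩ | ⟨rfl, rfl, rfl⟩ | ⟨rfl, rfl, rfl, ho₁, h3₁⟩
  · left
    rw [List.append_nil]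
    exact PosMove.boundaryEnd x (M.tail α) pre α (Or.inl ht)
  · right
    rw [neg_zero, List.append_nil, ← M.head_rev]
    exact PosMove.boundaryEnd x (M.head α) pre (M.rev α) (Or.inr (by rwa [M.rev_rev]))
  · left
    have := PosMove.slideEnd (s := s) x pre (M.rev α) ho₁ (by rwa [M.rev_rev])
    rwa [M.head_rev, M.tail_rev] at this

end

/-- A realization of a labelled grid in a combinatorial map with an outer face. The list
`seg k r` contains the dart between the points `(k, r)` and `(k, r + 1)`, if their labels differ,
and `hor k r` is the dart between the points `(k, r)` and `(k + 1, r)`, if their labels differ. -/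
structure Realization {V D : Type*} (M : CombMap V D) (o : D) (N h : ℕ) (ℓ : ℕ → ℕ → V) where
  hor : ℕ → ℕ → D
  seg : ℕ → ℕ → List D
  flips : ℕ → ℕ → D → ℤ
  hor_tail : ∀ k r, k < N → r ≤ h → ℓ k r ≠ ℓ (k + 1) r → M.tail (hor k r) = ℓ k r
  hor_head : ∀ k r, k < N → r ≤ h → ℓ k r ≠ ℓ (k + 1) r → M.head (hor k r) = ℓ (k + 1) r
  seg_walk : ∀ k r, k ≤ N → r < h → M.IsWalk (ℓ k r) (seg k r) (ℓ k (r + 1))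
  seg_length : ∀ k r, (seg k r).length ≤ 1
  seg_nil : ∀ k r, ℓ k r = ℓ k (r + 1) → seg k r = []
  flat : ∀ k r, k < N → r < h → ℓ k r = ℓ (k + 1) r → ℓ k (r + 1) = ℓ (k + 1) (r + 1) →
    seg k r = seg (k + 1) r ∧ flips k r = 0
  up : ∀ k r, k < N → r < h → ℓ k r = ℓ (k + 1) r → ℓ k (r + 1) ≠ ℓ (k + 1) (r + 1) →
    M.UpStep o (hor k (r + 1)) (seg k r) (seg (k + 1) r) (flips k r)
  low : ∀ k r, k < N → r < h → ℓ k r ≠ ℓ (k + 1) r → ℓ k (r + 1) = ℓ (k + 1) (r + 1) →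
    M.LowStep o (hor k r) (seg k r) (seg (k + 1) r) (flips k r)
  root : D
  root_outer : M.face.SameCycle o root
  cut : ℕ
  cut_le : cut ≤ Function.minimalPeriod M.face root
  bottom : ∀ k < N, ℓ k 0 ≠ ℓ (k + 1) 0 →
    M.rev (hor k 0) ∈ M.arc root cut (Function.minimalPeriod M.face root)
  top : ∀ k < N, ℓ k h ≠ ℓ (k + 1) h → hor k h ∈ M.arc root 0 cut
  src_mem : ∀ k ≤ N, ℓ k 0 ∈ M.arcVerts root cut (Function.minimalPeriod M.face root)
  tgt_mem : ∀ k ≤ N, ℓ k h ∈ M.arcVerts root 0 cut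
  first_eq : ∀ r ≤ h, ℓ 0 r = M.tail root
  last_eq : ∀ r ≤ h, ℓ N r = M.tail ((M.face ^ cut) root)
  nontrivial : ∀ d, ¬ M.face.SameCycle o d →
    ∑ k ∈ Finset.range N, ∑ r ∈ Finset.range h, flips k r d = 1

namespace Realization

variable {V D : Type*} {M : CombMap V D} {o : D} {N h : ℕ} {ℓ : ℕ → ℕ → V}

/-- The darts of the `k`-th column below the row `r`. -/
def darts (R : Realization M o N h ℓ) (k : ℕ) : ℕ → List D
  | 0 => []
  | r + 1 => R.darts k r ++ R.seg k r

variable (R : Realization M o N h ℓ)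

theorem darts_walk {k r : ℕ} (hk : k ≤ N) (hr : r ≤ h) : M.IsWalk (ℓ k 0) (R.darts k r) (ℓ k r) := by
  induction r with
  | zero => rfl
  | succ r ih => exact M.isWalk_append (ih (by omega)) (R.seg_walk k r hk hr)

theorem darts_length (k r : ℕ) : (R.darts k r).length ≤ r := by
  induction r with
  | zero => simp [darts]
  | succ r ih =>
    have := R.seg_length k r
    simp only [darts, List.length_append]
    omega

theorem darts_const {k r : ℕ} {x : V} (hx : ∀ i ≤ r, ℓ k i = x) : R.darts k r = [] := by
  induction r with
  | zero => rfl
  | succ r ih =>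
    simp only [darts]
    rw [ih fun i hi => hx i (by omega), R.seg_nil k r (by rw [hx r (by omega), hx _ le_rfl])]
    rfl

theorem darts_below {k m : ℕ} (hk : k < N) (hm : m ≤ h) (he : ∀ r ≤ m, ℓ (k + 1) r = ℓ k r) :
    R.darts k m = R.darts (k + 1) m := by
  induction m with
  | zero => rfl
  | succ m ih =>
    simp only [darts]
    rw [ih (by omega) fun r hr => he r (by omega),
      (R.flat k m hk (by omega) (he m (by omega)).symm (he _ le_rfl).symm).1]

theorem darts_above {k m : ℕ} (hk : k < N) {n : ℕ} (hmn : m ≤ n) (hn : n ≤ h)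
    (he : ∀ r, m ≤ r → r ≤ n → ℓ (k + 1) r = ℓ k r) :
    ∃ post, R.darts k n = R.darts k m ++ post ∧ R.darts (k + 1) n = R.darts (k + 1) m ++ post := by
  induction n, hmn using Nat.le_induction with
  | base => exact ⟨[], by simp, by simp⟩
  | succ n hmn ih =>
    obtain ⟨post, h1, h2⟩ := ih (by omega) fun r hr hr' => he r hr (by omega)
    refine ⟨post ++ R.seg k n, ?_, ?_⟩
    · simp [darts, h1]
    · simp only [darts, h2, List.append_assoc]
      rw [(R.flat k n hk (by omega) (he n hmn (by omega)).symm (he _ (by omega) le_rfl).symm).1]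

/-- The curve along the `k`-th column. -/
def column (k : ℕ) : Curve V D := ⟨ℓ k 0, R.darts k h, ℓ k h⟩

/-- Only the squares directly below and above the row `j` of the change can contribute. -/
theorem sum_flips_eq {k : ℕ} (hk : k < N) {j : ℕ} (he : ∀ r ≤ h, r ≠ j → ℓ (k + 1) r = ℓ k r)
    (S : Finset ℕ) (hS : S ⊆ Finset.range h) (hj : ∀ r < h, r = j ∨ r + 1 = j → r ∈ S) :
    ∑ r ∈ Finset.range h, R.flips k r = ∑ r ∈ S, R.flips k r := by
  symm
  refine Finset.sum_subset hS fun r hr hrS => ?_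
  have hr' := Finset.mem_range.1 hr
  have h1 : r ≠ j := fun h => hrS (hj r hr' (Or.inl h))
  have h2 : r + 1 ≠ j := fun h => hrS (hj r hr' (Or.inr h))
  exact (R.flat k r hk hr' (he r hr'.le h1).symm (he _ hr' h2).symm).2

/-- A change inside the column involves a square on each side. A change at the bottom or top
involves one square and slides an end of the walk along the outer face, which yields the boundary
moves. -/
theorem move_column (hh : 1 ≤ h) {k : ℕ} (hk : k < N) {j : ℕ} (hj : j ≤ h)
    (he : ∀ r ≤ h, r ≠ j → ℓ (k + 1) r = ℓ k r) :
    M.Move o (M.arc R.root R.cut (Function.minimalPeriod M.face R.root)) (M.arc R.root 0 R.cut)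
      (R.column k) (R.column (k + 1)) (∑ r ∈ Finset.range h, R.flips k r) ∨
    (R.column k = R.column (k + 1) ∧ ∑ r ∈ Finset.range h, R.flips k r = 0) := by
  by_cases hne : ℓ k j = ℓ (k + 1) j
  · have he' : ∀ r ≤ h, ℓ (k + 1) r = ℓ k r := by
      intro r hr
      by_cases hrj : r = j
      · rw [hrj, hne]
      · exact he r hr hrj
    right
    constructor
    · simp only [column]
      rw [R.darts_below hk le_rfl he', he' 0 (by omega), he' h le_rfl]
    · refine Finset.sum_eq_zero fun r hr => ?_
      have hr' := Finset.mem_range.1 hr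
      exact (R.flat k r hk hr' (he' r hr'.le).symm (he' _ hr').symm).2
  rcases Nat.eq_zero_or_pos j with rfl | hj0
  · left
    rw [R.sum_flips_eq hk he {0} (by rw [Finset.singleton_subset_iff, Finset.mem_range]; omega)
      (fun r _ hr => by rw [Finset.mem_singleton]; omega), Finset.sum_singleton]
    obtain ⟨post, h1, h2⟩ := R.darts_above (m := 1) hk hh le_rfl
      fun r hr hr' => he r hr' (by omega)
    have hlow := R.low k 0 hk hh hne (he 1 hh (by omega)).symm
    simp only [column]
    rw [h1, h2, he h le_rfl (by omega), ← R.hor_tail k 0 hk (by omega) hne,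
      ← R.hor_head k 0 hk (by omega) hne]
    exact CombMap.Move.of_low hlow (R.bottom k hk hne) _ _
  rcases lt_or_eq_of_le hj with hjh | rfl
  · obtain ⟨i, rfl⟩ : ∃ i, j = i + 1 := ⟨j - 1, by omega⟩
    rw [R.sum_flips_eq hk he {i, i + 1} (fun r hr => by
      simp only [Finset.mem_insert, Finset.mem_singleton] at hr
      rw [Finset.mem_range]; omega) (fun r hr h => by
      simp only [Finset.mem_insert, Finset.mem_singleton]; omega),
      Finset.sum_pair (by omega)]
    obtain ⟨post, h1, h2⟩ := R.darts_above (m := i + 1 + 1) hk hjh le_rfl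
      fun r hr hr' => he r hr' (by omega)
    have hpre := R.darts_below (m := i) hk (by omega) fun r hr => he r (by omega) (by omega)
    have hup := R.up k i hk (by omega) (he i (by omega) (by omega)).symm hne
    have hlow := R.low k (i + 1) hk hjh hne (he (i + 1 + 1) hjh (by omega)).symm
    have := CombMap.Move.of_up_low (s := M.arc R.root R.cut (Function.minimalPeriod M.face R.root))
      (t := M.arc R.root 0 R.cut) hup hlow (ℓ k 0) (ℓ k h) (R.darts k i) post
    simp only [column]
    rw [h1, h2, he h le_rfl (by omega), he 0 (by omega) (by omega)]
    simp only [darts]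
    rw [← hpre]
    simp only [List.append_assoc] at this ⊢
    rcases this with h | ⟨h, h'⟩
    · exact Or.inl h
    · right
      rw [← List.append_assoc (R.seg k i), h, List.append_assoc]
      exact ⟨rfl, h'⟩
  · left
    obtain ⟨i, rfl⟩ : ∃ i, j = i + 1 := ⟨j - 1, by omega⟩
    rw [R.sum_flips_eq hk he {i} (by simp) (fun r hr h => by
      simp only [Finset.mem_singleton]; omega), Finset.sum_singleton]
    have hpre := R.darts_below (m := i) hk (by omega) fun r hr => he r (by omega) (by omega)
    have hup := R.up k i hk (by omega) (he i (by omega) (by omega)).symm hne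
    simp only [column, darts]
    rw [← hpre, he 0 (by omega) (by omega), ← R.hor_tail k _ hk le_rfl hne,
      ← R.hor_head k _ hk le_rfl hne]
    exact CombMap.Move.of_up hup (R.top k hk hne) _ _

/-- A realization yields a homotopy whose height is at most the number of rows. -/
theorem exists_homotopy (R : Realization M o N h ℓ) (hh : 1 ≤ h)
    (hstep : ∀ k < N, ∃ r ≤ h, ∀ r' ≤ h, r' ≠ r → ℓ (k + 1) r' = ℓ k r') :
    ∃ H : Homotopy M o, H.height ≤ h + 1 := by
  let m := Function.minimalPeriod M.face R.root
  let p : Curve V D → Prop := fun c => M.IsWalk c.src c.darts c.tgt ∧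
    c.src ∈ M.arcVerts R.root R.cut m ∧ c.tgt ∈ M.arcVerts R.root 0 R.cut ∧ c.length ≤ h + 1
  have hp : ∀ k ≤ N, p (R.column k) := fun k hk =>
    ⟨R.darts_walk hk le_rfl, R.src_mem k hk, R.tgt_mem k hk,
      Nat.succ_le_succ (R.darts_length k h)⟩
  have hchain : ∀ k ≤ N, M.Chain o (M.arc R.root R.cut m) (M.arc R.root 0 R.cut) p (R.column 0)
      (R.column k) (∑ i ∈ Finset.range k, ∑ r ∈ Finset.range h, R.flips i r) := by
    intro k
    induction k with
    | zero =>
      intro _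
      rw [Finset.sum_range_zero]
      exact CombMap.Chain.refl _ (hp 0 (by omega))
    | succ k ih =>
      intro hk
      rw [Finset.sum_range_succ]
      obtain ⟨j, hj, he⟩ := hstep k hk
      rcases R.move_column hh hk hj he with h | ⟨h, h'⟩
      · exact CombMap.Chain.tail (ih (by omega)) h (hp _ hk)
      -- A step that repeats the curve is not a move. It is dropped, and its flips are zero.
      · rw [h', add_zero, ← h]
        exact ih (by omega)
  obtain ⟨n, curve, flips, h0, hn, hpc, hmv, hs⟩ := (hchain N le_rfl).exists_seq
  refine ⟨{ root := R.root, root_outer := R.root_outer, cut := R.cut, cut_le := R.cut_le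
            last := n, curve := curve, flips := flips
            isWalk := fun i hi => (hpc i hi).1
            curve_zero := ?_, curve_last := ?_
            src_mem := fun i hi => (hpc i hi).2.1
            tgt_mem := fun i hi => (hpc i hi).2.2.1
            move := hmv
            nontrivial := fun d hd => ?_ }, ?_⟩
  · rw [h0]
    simp only [column]
    rw [R.darts_const R.first_eq, R.first_eq 0 (by omega), R.first_eq h le_rfl]
  · rw [hn]
    simp only [column]
    rw [R.darts_const R.last_eq, R.last_eq 0 (by omega), R.last_eq h le_rfl]
  · rw [hs, ← R.nontrivial d hd]
    simp [Finset.sum_apply]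
  · refine Finset.sup_le fun i hi => ?_
    exact (hpc i (by have := Finset.mem_range.1 hi; change i < n + 1 at this; omega)).2.2.2

end Realization

/-! ### The face system of a labelled grid -/

/-- The ends of the grid edges: `(false, k, r)` is the edge from `(k, r)` to `(k + 1, r)` and
`(true, k, r)` is the edge from `(k, r)` to `(k, r + 1)`. -/
def edgeEnd {V : Type*} (ℓ : ℕ → ℕ → V) : Bool × ℕ × ℕ → Bool → V
  | (_, k, r), true => ℓ k r
  | (false, k, r), false => ℓ (k + 1) r
  | (true, k, r), false => ℓ k (r + 1)

/-- The edges of the grid. -/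
def IsGridEdge (N h : ℕ) : Bool × ℕ × ℕ → Prop
  | (false, k, r) => k < N ∧ r ≤ h
  | (true, k, r) => k ≤ N ∧ r < h

/-- The square with lower left corner `(k, r)`, or `none` if there is no such square. -/
def square (N h k r : ℕ) : Option (Fin N × Fin h) :=
  if hk : k < N ∧ r < h then some (⟨k, hk.1⟩, ⟨r, hk.2⟩) else none

/-- The face to the left of an oriented grid edge. -/
def leftFace (N h : ℕ) : Bool × ℕ × ℕ → Bool → Option (Fin N × Fin h)
  | (false, k, r), true => square N h k r
  | (false, k, r), false => if r = 0 then none else square N h k (r - 1)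
  | (true, k, r), true => if k = 0 then none else square N h (k - 1) r
  | (true, k, r), false => square N h k r

theorem square_eq_none {N h k r : ℕ} : square N h k r = none ↔ ¬ (k < N ∧ r < h) := by
  simp only [square]
  split_ifs with hk <;> simp [hk]

theorem square_inj {N h k r k' r' : ℕ} (hk : k < N) (hr : r < h) :
    square N h k' r' = square N h k r ↔ k' = k ∧ r' = r := by
  simp only [square, hk, hr, and_self, dif_pos]
  split_ifs with hk'
  · simp
  · simp only [false_iff]
    rintro ⟨rfl, rfl⟩
    exact hk' ⟨hk, hr⟩

theorem eq_square (N h : ℕ) (p : Fin N × Fin h) : some p = square N h p.1 p.2 := by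
  simp [square]

/-- The bichromatic edges of a labelled grid. -/
abbrev BichromaticEdge {V : Type*} (ℓ : ℕ → ℕ → V) (N h : ℕ) : Type :=
  {e // IsGridEdge N h e ∧ edgeEnd ℓ e true ≠ edgeEnd ℓ e false}

instance {V : Type*} (ℓ : ℕ → ℕ → V) (N h : ℕ) : Finite (BichromaticEdge ℓ N h) := by
  have : Finite {e : Bool × ℕ × ℕ // e.2.1 < N + 1 ∧ e.2.2 < h + 1} := by
    refine Set.Finite.to_subtype (s := {e : Bool × ℕ × ℕ | e.2.1 < N + 1 ∧ e.2.2 < h + 1}) ?_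
    refine (Set.finite_univ.prod ((Set.finite_lt_nat (N + 1)).prod
      (Set.finite_lt_nat (h + 1)))).subset ?_
    rintro ⟨v, k, r⟩ ⟨h1, h2⟩
    exact ⟨trivial, h1, h2⟩
  refine Finite.of_injective (β := {e : Bool × ℕ × ℕ // e.2.1 < N + 1 ∧ e.2.2 < h + 1})
    (fun e => ⟨e.1, ?_⟩) fun e e' he => Subtype.ext (congrArg (fun x => x.1) he)
  obtain ⟨⟨_ | _, k, r⟩, ⟨hk, hr⟩, -⟩ := e
  · exact ⟨Nat.lt_succ_of_lt hk, Nat.lt_succ_of_le hr⟩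
  · exact ⟨Nat.lt_succ_of_le hk, Nat.lt_succ_of_lt hr⟩

noncomputable instance {V : Type*} (ℓ : ℕ → ℕ → V) (N h : ℕ) :
    Fintype (BichromaticEdge ℓ N h) := Fintype.ofFinite _

/-- The face system obtained from a labelled grid by contracting the monochromatic edges. -/
def gridSystem {V : Type*} (ℓ : ℕ → ℕ → V) (N h : ℕ) :
    FaceSystem V (BichromaticEdge ℓ N h) (Option (Fin N × Fin h)) where
  src a := edgeEnd ℓ a.1.1 a.2
  face a := leftFace N h a.1.1 a.2
  src_ne b := b.2.2

section

variable {V : Type*} {G : SimpleGraph V} {N h : ℕ} {ℓ : ℕ → ℕ → V}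

theorem leftFace_eq_square {k r : ℕ} (hk : k < N) (hr : r < h) (x : (Bool × ℕ × ℕ) × Bool) :
    leftFace N h x.1 x.2 = square N h k r ↔ x = ((false, k, r), true) ∨
      x = ((true, k + 1, r), true) ∨ x = ((false, k, r + 1), false) ∨ x = ((true, k, r), false) := by
  have hn : (none = square N h k r) ↔ False := by
    rw [eq_comm, square_eq_none]
    simp [hk, hr]
  obtain ⟨⟨_ | _, k', r'⟩, _ | _⟩ := x
  · simp only [leftFace]
    split_ifs with h0
    · simp [hn, h0]
    · simp only [square_inj hk hr]
      simp
      omega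
  · simp [leftFace, square_inj hk hr]
  · simp [leftFace, square_inj hk hr]
  · simp only [leftFace]
    split_ifs with h0
    · simp [hn, h0]
    · simp only [square_inj hk hr]
      simp
      omega

/-- Monochromatic sides are absent from the face system but contribute zero, so sums around a square
may always be written with all four sides, in counterclockwise order. -/
theorem sum_fiber_square {M : Type*} [AddCommMonoid M] {k r : ℕ} (hk : k < N) (hr : r < h)
    (g : (Bool × ℕ × ℕ) × Bool → M) (hg : ∀ x, edgeEnd ℓ x.1 true = edgeEnd ℓ x.1 false → g x = 0) :
    ∑ a ∈ (gridSystem ℓ N h).fiber (square N h k r), g (a.1.1, a.2) =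
      g ((false, k, r), true) + (g ((true, k + 1, r), true) + (g ((false, k, r + 1), false) +
        g ((true, k, r), false))) := by
  classical
  let i : BichromaticEdge ℓ N h × Bool ↪ (Bool × ℕ × ℕ) × Bool :=
    ⟨fun a => (a.1.1, a.2), fun a b hab => by
      simp only [Prod.mk.injEq] at hab
      exact Prod.ext (Subtype.ext hab.1) hab.2⟩
  let D : Finset ((Bool × ℕ × ℕ) × Bool) := {((false, k, r), true), ((true, k + 1, r), true),
    ((false, k, r + 1), false), ((true, k, r), false)}
  have hD : ∀ x, x ∈ D ↔ leftFace N h x.1 x.2 = square N h k r := by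
    intro x
    rw [leftFace_eq_square hk hr]
    simp [D]
  have h1 : ∑ x ∈ D, g x = g ((false, k, r), true) + (g ((true, k + 1, r), true) +
      (g ((false, k, r + 1), false) + g ((true, k, r), false))) := by
    rw [Finset.sum_insert (by simp), Finset.sum_insert (by simp), Finset.sum_insert (by simp),
      Finset.sum_singleton]
  rw [← h1]
  have h2 : ∑ a ∈ (gridSystem ℓ N h).fiber (square N h k r), g (a.1.1, a.2) =
      ∑ x ∈ ((gridSystem ℓ N h).fiber (square N h k r)).map i, g x := by
    rw [Finset.sum_map]
    rfl
  rw [h2]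
  refine Finset.sum_subset ?_ ?_
  · intro x hx
    obtain ⟨a, ha, rfl⟩ := Finset.mem_map.1 hx
    rw [hD]
    exact FaceSystem.mem_fiber.1 ha
  · intro x hx hx'
    apply hg
    by_contra hne
    apply hx'
    have hface := (hD x).1 hx
    have hedge : IsGridEdge N h x.1 := by
      rw [leftFace_eq_square hk hr] at hface
      rcases hface with rfl | rfl | rfl | rfl
      · exact ⟨hk, hr.le⟩
      · exact ⟨hk, hr⟩
      · exact ⟨hk, hr⟩
      · exact ⟨hk.le, hr⟩
    exact Finset.mem_map.2 ⟨(⟨x.1, hedge, hne⟩, x.2), FaceSystem.mem_fiber.2 hface, rfl⟩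

theorem conserve_square (p : Fin N × Fin h) (f : V → ℤ) :
    ∑ a ∈ (gridSystem ℓ N h).fiber (some p),
      (f ((gridSystem ℓ N h).tgt a) - f ((gridSystem ℓ N h).src a)) = 0 := by
  rw [eq_square]
  have := sum_fiber_square (ℓ := ℓ) p.1.2 p.2.2
    (fun x => f (edgeEnd ℓ x.1 (!x.2)) - f (edgeEnd ℓ x.1 x.2)) (fun x hx => by
      obtain ⟨e, _ | _⟩ := x <;> simp only [Bool.not_true, Bool.not_false] at hx ⊢ <;> rw [hx] <;>
        exact sub_self _)
  refine this.trans ?_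
  simp only [edgeEnd, Bool.not_true, Bool.not_false]
  ring

/-- Closed functions on the grid are integrable because all squares are filled. The potential
descends to labels because each label class is connected. The outer boundary is balanced since all
the squares are. -/
theorem GridLabelling.isPlanar (hl : GridLabelling G N h ℓ) : (gridSystem ℓ N h).IsPlanar := by
  classical
  refine ⟨fun q f => ?_, fun ω hω => ?_⟩
  · rcases q with _ | p
    · have h1 := (gridSystem ℓ N h).sum_fiber_total
        (fun a => f ((gridSystem ℓ N h).tgt a) - f ((gridSystem ℓ N h).src a))
      rw [Fintype.sum_option, Finset.sum_eq_zero (fun p _ => conserve_square p f), add_zero] at h1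
      rw [h1]
      refine Finset.sum_eq_zero fun b _ => ?_
      simp only [FaceSystem.tgt, Bool.not_true, Bool.not_false]
      ring
    · exact conserve_square p f
  · let w : Bool × ℕ × ℕ → ZMod 2 := fun e =>
      if he : IsGridEdge N h e ∧ edgeEnd ℓ e true ≠ edgeEnd ℓ e false then ω ⟨e, he⟩ else 0
    have hw0 : ∀ e, edgeEnd ℓ e true = edgeEnd ℓ e false → w e = 0 := fun e he =>
      dif_neg fun hh => hh.2 he
    have hw1 : ∀ b : BichromaticEdge ℓ N h, w b.1 = ω b := fun b => dif_pos b.2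
    have hcl : ∀ k r, k < N → r < h →
        w (false, k, r) + (w (true, k + 1, r) + (w (false, k, r + 1) + w (true, k, r))) = 0 := by
      intro k r hk hr
      rw [← hω (square N h k r)]
      rw [← sum_fiber_square (ℓ := ℓ) hk hr (fun x => w x.1) fun x hx => hw0 _ hx]
      exact Finset.sum_congr rfl fun a _ => hw1 a.1
    -- Integration along the bottom row and then up the column. By definition its vertical
    -- increments are right; `hH` gets the horizontal ones by adding up squares.
    let Φ : ℕ → ℕ → ZMod 2 := fun k r =>
      ∑ i ∈ Finset.range k, w (false, i, 0) + ∑ j ∈ Finset.range r, w (true, k, j)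
    have hV : ∀ k r, Φ k (r + 1) = Φ k r + w (true, k, r) := fun k r => by
      simp only [Φ, Finset.sum_range_succ, add_assoc]
    have hH : ∀ k r, k < N → r ≤ h → Φ (k + 1) r = Φ k r + w (false, k, r) := by
      intro k r hk
      induction r with
      | zero => intro _; simp [Φ, Finset.sum_range_succ]
      | succ r ih =>
        intro hr
        rw [hV, hV, ih (by omega)]
        have := hcl k r hk hr
        linear_combination this - CharTwo.add_self_eq_zero (w (false, k, r + 1)) -
          CharTwo.add_self_eq_zero (w (true, k, r))
    have hconn := hl.conn Φ
      (fun k r hk hr he => by rw [hH k r hk hr, hw0 (false, k, r) he, add_zero])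
      (fun k r hk hr he => by rw [hV k r, hw0 (true, k, r) he, add_zero])
    -- The value 0 at vertices that are not labels never matters, as edges of the face system have
    -- labels as ends.
    let φ : V → ZMod 2 := fun v =>
      if hv : ∃ p : ℕ × ℕ, p.1 ≤ N ∧ p.2 ≤ h ∧ ℓ p.1 p.2 = v then
        Φ hv.choose.1 hv.choose.2 else 0
    have hφ : ∀ k r, k ≤ N → r ≤ h → φ (ℓ k r) = Φ k r := by
      intro k r hk hr
      have hv : ∃ p : ℕ × ℕ, p.1 ≤ N ∧ p.2 ≤ h ∧ ℓ p.1 p.2 = ℓ k r := ⟨(k, r), hk, hr, rfl⟩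
      simp only [φ, hv, dif_pos]
      exact hconn _ _ _ _ hv.choose_spec.1 hv.choose_spec.2.1 hk hr hv.choose_spec.2.2
    refine ⟨φ, ?_⟩
    rintro ⟨⟨_ | _, k, r⟩, ⟨hk, hr⟩, hne⟩
    · rw [← hw1]
      change w (false, k, r) = φ (ℓ k r) + φ (ℓ (k + 1) r)
      rw [hφ k r hk.le hr, hφ (k + 1) r hk hr, hH k r hk hr]
      linear_combination - CharTwo.add_self_eq_zero (Φ k r)
    · rw [← hw1]
      change w (true, k, r) = φ (ℓ k r) + φ (ℓ k (r + 1))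
      rw [hφ k r hk hr.le, hφ k (r + 1) hk hr, hV k r]
      linear_combination - CharTwo.add_self_eq_zero (Φ k r)

theorem GridLabelling.exists_ends (hl : GridLabelling G N h ℓ) (e : Sym2 V) (he : e ∈ G.edgeSet) :
    ∃ b, (gridSystem ℓ N h).ends b = e := by
  have hne : ∀ x y : V, s(x, y) = e → x ≠ y := by
    rintro x y rfl rfl
    exact G.loopless.irrefl _ he
  rcases hl.edge e he with ⟨k, r, hk, hr, hh⟩ | ⟨k, r, hk, hr, hh⟩
  · exact ⟨⟨(false, k, r), ⟨hk, hr⟩, hne _ _ hh⟩, hh⟩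
  · exact ⟨⟨(true, k, r), ⟨hk, hr⟩, hne _ _ hh⟩, hh⟩

end

/-! ### Counts in triangulations -/

section

variable {V : Type*} {G : SimpleGraph V}

theorem Triangulation.face_face_ne (T : Triangulation G) (d : G.Dart) : T.face (T.face d) ≠ d := by
  intro h
  have := T.face_three d
  rw [h] at this
  exact T.face_ne d this

variable [Finite V] (T : Triangulation G)

theorem Triangulation.card_faces : 3 * Nat.card (Quotient (Equiv.Perm.SameCycle.setoid T.face)) =
    2 * Nat.card G.edgeSet := by
  classical
  have : Fintype V := Fintype.ofFinite V
  have h1 : Nat.card G.Dart = 2 * Nat.card G.edgeSet := by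
    have h := G.dart_card_eq_twice_card_edges
    rwa [SimpleGraph.edgeFinset_card, ← Nat.card_eq_fintype_card,
      ← Nat.card_eq_fintype_card] at h
  rw [← h1]
  have : Fintype (Quotient (Equiv.Perm.SameCycle.setoid T.face)) := Fintype.ofFinite _
  rw [Nat.card_eq_fintype_card, Nat.card_eq_fintype_card, ← Finset.card_univ (α := G.Dart)]
  rw [Finset.card_eq_sum_card_fiberwise (f := fun d : G.Dart =>
    (Quotient.mk (Equiv.Perm.SameCycle.setoid T.face) d)) (t := Finset.univ) (by simp)]
  rw [Finset.sum_const_nat (m := 3), Finset.card_univ, mul_comm]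
  intro q _
  induction q using Quotient.inductionOn with
  | _ d =>
  rw [Finset.card_eq_three]
  refine ⟨d, T.face d, T.face (T.face d), (T.face_ne d).symm, (T.face_face_ne d).symm,
    (T.face_ne _).symm, ?_⟩
  ext d'
  simp only [Finset.mem_filter, Finset.mem_univ, true_and, Finset.mem_insert,
    Finset.mem_singleton]
  rw [Quotient.eq]
  change T.face.SameCycle d' d ↔ _
  constructor
  · intro hs
    obtain ⟨n, hn⟩ := hs.symm.exists_nat_pow_eq
    rw [← hn]
    have : ∀ n : ℕ, (T.face ^ n) d = d ∨ (T.face ^ n) d = T.face d ∨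
        (T.face ^ n) d = T.face (T.face d) := by
      intro n
      induction n with
      | zero => simp
      | succ n ih =>
        rw [pow_succ', Equiv.Perm.mul_apply]
        rcases ih with h | h | h <;> rw [h]
        · simp
        · simp
        · simp [T.face_three]
    exact this n
  · rintro (rfl | rfl | rfl)
    · exact Equiv.Perm.SameCycle.refl _ _
    · rw [Equiv.Perm.sameCycle_apply_left]
    · rw [Equiv.Perm.sameCycle_apply_left, Equiv.Perm.sameCycle_apply_left]

theorem Triangulation.card_edges (T : Triangulation G) : Nat.card G.edgeSet + 6 = 3 * Nat.card V := by
  have h1 := T.card_faces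
  have h2 := T.euler
  omega

theorem Triangulation.nonempty_dart (T : Triangulation G) : Nonempty G.Dart := by
  by_contra hne
  rw [not_nonempty_iff] at hne
  have h1 := T.euler
  have h2 : Nat.card (Quotient (Equiv.Perm.SameCycle.setoid T.face)) = 0 := by
    have : IsEmpty (Quotient (Equiv.Perm.SameCycle.setoid T.face)) :=
      ⟨fun q => q.inductionOn fun d => hne.false d⟩
    exact Nat.card_of_isEmpty
  have h3 : Nat.card V ≤ 1 := by
    rw [Finite.card_le_one_iff_subsingleton]
    have hpre := T.connected.preconnected
    refine ⟨fun x y => ?_⟩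
    obtain ⟨w⟩ := hpre x y
    cases w with
    | nil => rfl
    | cons hadj _ => exact (hne.false ⟨(_, _), hadj⟩).elim
  omega

theorem Triangulation.three_le_card (T : Triangulation G) : 3 ≤ Nat.card V := by
  classical
  obtain ⟨d⟩ := T.nonempty_dart
  have h1 : (T.face d).snd ≠ d.fst := by
    intro h
    have h2 : (T.face (T.face d)).fst = (T.face (T.face d)).snd := by
      rw [T.face_fst, T.triangleSystem_three, h]
    exact (T.face (T.face d)).fst_ne_snd h2
  have h2 : (T.face d).snd ≠ d.snd := by
    rw [← T.face_fst d]
    exact (T.face d).snd_ne_fst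
  have : Fintype V := Fintype.ofFinite V
  rw [Nat.card_eq_fintype_card]
  have h3 : ({d.fst, d.snd, (T.face d).snd} : Finset V).card = 3 := by
    rw [Finset.card_eq_three]
    exact ⟨_, _, _, d.fst_ne_snd, h1.symm, h2.symm, rfl⟩
  rw [← h3]
  exact Finset.card_le_univ _

end

/-! ### The triangle system of a rigid face system -/

namespace FaceSystem

variable {V B Q : Type*} [Fintype B] {S : FaceSystem V B Q} {G : SimpleGraph V}

/-- The dart of an edge. -/
def Rigid.dart [Fintype Q] (hR : S.Rigid G) (a : B × Bool) : G.Dart :=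
  ⟨(S.src a, S.tgt a), hR.adj a⟩

theorem IsPlanar.next_unique (hS : S.IsPlanar) {q : Q} (hq : (S.fiber q).card = 3)
    {a a' b : B × Bool} (ha : a ∈ S.fiber q) (ha' : a' ∈ S.fiber q) (hb : b ∈ S.fiber q)
    (h : S.src a' = S.tgt a) (h' : S.src b = S.tgt a) : b = a' := by
  obtain ⟨a'', -, hf, e1, -⟩ := hS.of_card_three hq ha ha' h
  rcases hf b hb with rfl | rfl | rfl
  · exact absurd h' (S.src_ne_tgt _)
  · rfl
  · exact absurd (h.trans (h'.symm.trans e1)) (S.src_ne_tgt a')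

variable [Fintype Q]

theorem Rigid.eq_of_dart_eq (hR : S.Rigid G) {a a' : B × Bool}
    (ha : (S.fiber (S.face a)).card = 3) (ha' : (S.fiber (S.face a')).card = 3)
    (h : hR.dart a = hR.dart a') : a = a' := by
  have h1 : S.src a = S.src a' := congrArg (fun d : G.Dart => d.fst) h
  have h2 : S.tgt a = S.tgt a' := congrArg (fun d : G.Dart => d.snd) h
  exact (hR.existsUnique (hR.dart a')).unique ⟨h1, h2, ha⟩ ⟨rfl, rfl, ha'⟩

theorem Rigid.exists_dart_eq (hR : S.Rigid G) (d : G.Dart) :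
    ∃ a, hR.dart a = d ∧ (S.fiber (S.face a)).card = 3 := by
  obtain ⟨a, h1, h2, h3⟩ := (hR.existsUnique d).exists
  exact ⟨a, dart_ext h1 h2, h3⟩

/-- The triangular faces define a triangle system. -/
theorem IsPlanar.exists_triangleSystem (hS : S.IsPlanar) (hR : S.Rigid G) :
    ∃ f : G.Dart → G.Dart, TriangleSystem G f ∧
      ∀ a a', (S.fiber (S.face a)).card = 3 → S.face a' = S.face a → S.src a' = S.tgt a →
        f (hR.dart a) = hR.dart a' := by
  have hex : ∀ d, ∃ d', ∃ a a', hR.dart a = d ∧ hR.dart a' = d' ∧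
      (S.fiber (S.face a)).card = 3 ∧ S.face a' = S.face a ∧ S.src a' = S.tgt a := by
    intro d
    obtain ⟨a, h1, h2⟩ := hR.exists_dart_eq d
    obtain ⟨a', h3, h4⟩ := hS.exists_next (mem_fiber.2 (rfl : S.face a = _))
    exact ⟨_, a, a', h1, rfl, h2, mem_fiber.1 h3, h4⟩
  choose f hf using hex
  have hspec : ∀ a a', (S.fiber (S.face a)).card = 3 → S.face a' = S.face a →
      S.src a' = S.tgt a → f (hR.dart a) = hR.dart a' := by
    intro a a' h1 h2 h3
    obtain ⟨b, b', e1, e2, e3, e4, e5⟩ := hf (hR.dart a)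
    obtain rfl := hR.eq_of_dart_eq e3 h1 e1
    rw [← e2, hS.next_unique h1 (mem_fiber.2 rfl) (mem_fiber.2 h2) (mem_fiber.2 e4) h3 e5]
  refine ⟨f, ⟨?_, ?_, ?_⟩, hspec⟩
  · intro d
    obtain ⟨a, a', e1, e2, e3, e4, e5⟩ := hf d
    rw [← e2, ← e1]
    exact e5
  · intro d
    obtain ⟨a, a', e1, e2, e3, e4, e5⟩ := hf d
    obtain ⟨a'', h'', -, h1, h2⟩ :=
      hS.of_card_three e3 (mem_fiber.2 rfl) (mem_fiber.2 e4) e5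
    have e6 := mem_fiber.1 h''
    rw [← e2, hspec a' a'' (by rw [e4]; exact e3) (by rw [e6, e4]) h1,
      hspec a'' a (by rw [e6]; exact e3) e6.symm h2.symm, e1]
  · intro ω hsymm hcl
    have hdart : ∀ b, hR.dart (b, false) = (hR.dart (b, true)).symm := fun b => rfl
    have hω : ∀ a, ω (hR.dart (a.1, true)) = ω (hR.dart a) := by
      rintro ⟨b, _ | _⟩
      · rw [hdart, hsymm]
      · rfl
    obtain ⟨φ, hφ⟩ := hS.potential (fun b => ω (hR.dart (b, true))) (fun q => by
      rw [Finset.sum_congr rfl fun a _ => hω a]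
      rcases hR.card_fiber q with h0 | h2 | h3
      · rw [Finset.card_eq_zero.1 h0]; simp
      · obtain ⟨a, ha⟩ : (S.fiber q).Nonempty := Finset.card_pos.1 (by omega)
        obtain ⟨a', ha', hne, hall, e1, e2⟩ := hS.of_card_two h2 ha
        have : hR.dart a' = (hR.dart a).symm := dart_ext e1 e2
        rw [sum_eq_add_of_forall hne ha ha' hall, this, hsymm]
        exact CharTwo.add_self_eq_zero _
      · classical
        obtain ⟨a, ha⟩ : (S.fiber q).Nonempty := Finset.card_pos.1 (by omega)
        obtain ⟨a', ha', e'⟩ := hS.exists_next ha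
        obtain ⟨a'', ha'', hall, e1, e2⟩ := hS.of_card_three h3 ha ha' e'
        have f1 := mem_fiber.1 ha
        have f2 := mem_fiber.1 ha'
        have f3 := mem_fiber.1 ha''
        have n1 : a ≠ a' := by rintro rfl; exact S.src_ne_tgt _ e'
        have n2 : a' ≠ a'' := by rintro rfl; exact S.src_ne_tgt _ e1
        have n3 : a ≠ a'' := by rintro rfl; exact S.src_ne_tgt _ e2.symm
        have hq : S.fiber q = {a, a', a''} := by
          ext x
          simp only [Finset.mem_insert, Finset.mem_singleton]
          constructor
          · exact hall x
          · rintro (rfl | rfl | rfl) <;> assumption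
        rw [hq, Finset.sum_insert (by simp [n1, n3]), Finset.sum_pair n2,
          ← hspec a' a'' (by rw [f2]; exact h3) (by rw [f2, f3]) e1,
          ← hspec a a' (by rw [f1]; exact h3) (by rw [f1, f2]) e', ← add_assoc]
        exact hcl _)
    refine ⟨φ, fun d => ?_⟩
    obtain ⟨⟨b, s⟩, rfl, -⟩ := hR.exists_dart_eq d
    rw [← hω, hφ]
    cases s
    · exact add_comm _ _
    · rfl

end FaceSystem

/-! ### Comparing the orientation of the grid with the triangulation -/

section

variable {V : Type*} {G : SimpleGraph V} {N h : ℕ} {ℓ : ℕ → ℕ → V}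

theorem card_fiber_square [DecidableEq V] {k r : ℕ} (hk : k < N) (hr : r < h) :
    ((gridSystem ℓ N h).fiber (square N h k r)).card =
      (if ℓ k r = ℓ (k + 1) r then 0 else 1) +
      ((if ℓ (k + 1) r = ℓ (k + 1) (r + 1) then 0 else 1) +
      ((if ℓ k (r + 1) = ℓ (k + 1) (r + 1) then 0 else 1) +
      if ℓ k r = ℓ k (r + 1) then 0 else 1)) := by
  have := sum_fiber_square (ℓ := ℓ) hk hr
    (fun x => if edgeEnd ℓ x.1 true = edgeEnd ℓ x.1 false then 0 else 1) (fun x hx => if_pos hx)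
  rw [Finset.sum_congr rfl (g := fun _ => 1) (fun a _ => if_neg a.1.2.2),
    ← Finset.card_eq_sum_ones] at this
  exact this

/-- The horizontal edges with differing labels. -/
def horEdge {k r : ℕ} (hk : k < N) (hr : r ≤ h) (hne : ℓ k r ≠ ℓ (k + 1) r) :
    BichromaticEdge ℓ N h := ⟨(false, k, r), ⟨hk, hr⟩, hne⟩

/-- The vertical edges with differing labels. -/
def verEdge {k r : ℕ} (hk : k ≤ N) (hr : r < h) (hne : ℓ k r ≠ ℓ k (r + 1)) :
    BichromaticEdge ℓ N h := ⟨(true, k, r), ⟨hk, hr⟩, hne⟩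

theorem face_horEdge_true {k r : ℕ} (hk : k < N) (hr : r ≤ h) (hne : ℓ k r ≠ ℓ (k + 1) r) :
    (gridSystem ℓ N h).face (horEdge hk hr hne, true) = square N h k r := rfl

theorem face_horEdge_false {k r : ℕ} (hk : k < N) (hr : r + 1 ≤ h)
    (hne : ℓ k (r + 1) ≠ ℓ (k + 1) (r + 1)) :
    (gridSystem ℓ N h).face (horEdge hk hr hne, false) = square N h k r := by
  simp [gridSystem, horEdge, leftFace]

theorem face_verEdge_true {k r : ℕ} (hk : k + 1 ≤ N) (hr : r < h)
    (hne : ℓ (k + 1) r ≠ ℓ (k + 1) (r + 1)) :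
    (gridSystem ℓ N h).face (verEdge hk hr hne, true) = square N h k r := by
  simp [gridSystem, verEdge, leftFace]

theorem face_verEdge_false {k r : ℕ} (hk : k ≤ N) (hr : r < h) (hne : ℓ k r ≠ ℓ k (r + 1)) :
    (gridSystem ℓ N h).face (verEdge hk hr hne, false) = square N h k r := rfl

/-- The labels of a sweep, seen as a face system, follow the orientation of `T`. -/
def IsPositive (T : Triangulation G) (ℓ : ℕ → ℕ → V) (N h : ℕ)
    (hR : (gridSystem ℓ N h).Rigid G) : Prop :=
  ∀ a a', ((gridSystem ℓ N h).fiber ((gridSystem ℓ N h).face a)).card = 3 →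
    (gridSystem ℓ N h).face a' = (gridSystem ℓ N h).face a →
    (gridSystem ℓ N h).src a' = (gridSystem ℓ N h).tgt a → T.face (hR.dart a) = hR.dart a'

theorem GridLabelling.rigid [Finite V] (T : Triangulation G) (hl : GridLabelling G N h ℓ) :
    (gridSystem ℓ N h).Rigid G :=
  hl.isPlanar.rigid hl.exists_ends T.card_edges T.three_le_card

/-- There is a square whose boundary has three labels. -/
theorem GridLabelling.exists_square [Finite V] (T : Triangulation G)
    (hl : GridLabelling G N h ℓ) :
    ∃ k r, k < N ∧ r < h ∧ ((gridSystem ℓ N h).fiber (square N h k r)).card = 3 := by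
  have hS := hl.isPlanar
  have hR := hl.rigid T
  have hsome : ∀ a, ((gridSystem ℓ N h).fiber ((gridSystem ℓ N h).face a)).card = 3 →
      (gridSystem ℓ N h).face a ≠ none →
      ∃ k r, k < N ∧ r < h ∧ ((gridSystem ℓ N h).fiber (square N h k r)).card = 3 := by
    intro a h1 h2
    obtain ⟨p, hp⟩ := Option.ne_none_iff_exists'.1 h2
    rw [hp, eq_square] at h1
    exact ⟨p.1, p.2, p.1.2, p.2.2, h1⟩
  obtain ⟨d⟩ := T.nonempty_dart
  obtain ⟨a, h1, h2⟩ := hR.exists_dart_eq d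
  obtain ⟨b, h3, h4⟩ := hR.exists_dart_eq d.symm
  -- A dart and its reversal cannot both lie on the outside, because a triangle does not traverse an
  -- edge in both directions. One of them thus lies on a square.
  by_cases ha : (gridSystem ℓ N h).face a = none
  · refine hsome b h4 fun hb => ?_
    obtain ⟨a', m1, e'⟩ := hS.exists_next (FaceSystem.mem_fiber.2 (rfl : _ = _) :
      a ∈ (gridSystem ℓ N h).fiber ((gridSystem ℓ N h).face a))
    obtain ⟨a'', -, hall, e1, e2⟩ := hS.of_card_three h2 (FaceSystem.mem_fiber.2 rfl) m1 e'
    have s1 : (gridSystem ℓ N h).src b = (gridSystem ℓ N h).tgt a := by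
      rw [← h1] at h3
      exact congrArg (fun d : G.Dart => d.fst) h3
    have s2 : (gridSystem ℓ N h).tgt b = (gridSystem ℓ N h).src a := by
      rw [← h1] at h3
      exact congrArg (fun d : G.Dart => d.snd) h3
    have := hS.next_unique h2 (FaceSystem.mem_fiber.2 rfl) m1
      (FaceSystem.mem_fiber.2 (hb.trans ha.symm)) e' s1
    rw [this] at s2
    exact (gridSystem ℓ N h).src_ne_tgt a'' (e1.trans (s2.trans e2.symm))
  · exact hsome a h2 ha

/-- Either a sweep or its reversal follows the orientation of `T`. -/
theorem Sweep.exists_isPositive [Finite V] (T : Triangulation G) (hl : Sweep G N h ℓ) :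
    ∃ ℓ', ∃ _ : Sweep G N h ℓ', ∃ hR, IsPositive T ℓ' N h hR := by
  classical
  have hR := hl.toGridLabelling.rigid T
  have hl' := hl.reverse
  have hR' := hl'.toGridLabelling.rigid T
  obtain ⟨f, hf, hfs⟩ := hl.isPlanar.exists_triangleSystem hR
  obtain ⟨f', hf', hfs'⟩ := hl'.isPlanar.exists_triangleSystem hR'
  rcases hf.eq_or_eq_reverse T with hpos | hneg
  · exact ⟨ℓ, hl, hR, fun a a' h1 h2 h3 => by rw [← hpos, hfs a a' h1 h2 h3]⟩
  rcases hf'.eq_or_eq_reverse T with hpos' | hneg'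
  · exact ⟨_, hl', hR', fun a a' h1 h2 h3 => by rw [← hpos', hfs' a a' h1 h2 h3]⟩
  exfalso
  -- it suffices to find a triangle that the reversal traverses in the opposite direction
  have hcon : ∀ d : G.Dart, (f d).snd ≠ (f' d.symm).snd := by
    intro d hd
    apply (hneg d).1
    refine dart_ext ?_ ?_
    · rw [hf.fst, T.face_fst]
    · rw [hd, (hneg' d.symm).2, SimpleGraph.Dart.symm_symm]
      exact T.face_fst _
  obtain ⟨k, r, hk, hr, h3⟩ := hl.toGridLabelling.exists_square T
  obtain ⟨j, -, hj⟩ := hl.step k hk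
  have hk' : N - 1 - k < N := by omega
  have ek : N - (N - 1 - k) = k + 1 := by omega
  have ek' : N - (N - 1 - k + 1) = k := by omega
  have hcard := h3
  rw [card_fiber_square hk hr] at hcard
  have hcard' : ((gridSystem (fun k r => ℓ (N - k) r) N h).fiber
      (square N h (N - 1 - k) r)).card = 3 := by
    rw [card_fiber_square hk' hr]
    simp only [ek, ek']
    rw [← hcard]
    simp only [eq_comm]
    ring
  by_cases hbot : ℓ k r = ℓ (k + 1) r
  · rw [if_pos hbot] at hcard
    have n1 : ℓ (k + 1) r ≠ ℓ (k + 1) (r + 1) := by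
      intro h; rw [if_pos h] at hcard; split_ifs at hcard <;> omega
    have n2 : ℓ k (r + 1) ≠ ℓ (k + 1) (r + 1) := by
      intro h; rw [if_pos h] at hcard; split_ifs at hcard <;> omega
    have n3 : ℓ k r ≠ ℓ k (r + 1) := by
      intro h; rw [if_pos h] at hcard; split_ifs at hcard <;> omega
    have e1 := hfs (horEdge hk hr n2, false) (verEdge hk.le hr n3, false)
      (by rw [face_horEdge_false, h3]) (by rw [face_horEdge_false, face_verEdge_false]) rfl
    have n2' : ℓ (N - (N - 1 - k)) (r + 1) ≠ ℓ (N - (N - 1 - k + 1)) (r + 1) := by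
      rw [ek, ek']; exact n2.symm
    have n1' : ℓ (N - (N - 1 - k)) r ≠ ℓ (N - (N - 1 - k)) (r + 1) := by
      rw [ek]; exact n1
    have e2 := hfs' (horEdge hk' hr n2', false) (verEdge hk'.le hr n1', false)
      (by rw [face_horEdge_false, hcard']) (by rw [face_horEdge_false, face_verEdge_false]) rfl
    apply hcon (hR.dart (horEdge hk hr n2, false))
    have e3 : (hR.dart (horEdge hk hr n2, false)).symm = hR'.dart (horEdge hk' hr n2', false) := by
      refine dart_ext ?_ ?_
      · change ℓ k (r + 1) = ℓ (N - (N - 1 - k + 1)) (r + 1)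
        rw [ek']
      · change ℓ (k + 1) (r + 1) = ℓ (N - (N - 1 - k)) (r + 1)
        rw [ek]
    rw [e3, e1, e2]
    change ℓ k r = ℓ (N - (N - 1 - k)) r
    rw [ek, hbot]
  -- Only one point changes between consecutive columns, so a square never has two bichromatic
  -- horizontal sides.
  · have htop : ℓ k (r + 1) = ℓ (k + 1) (r + 1) := by
      have hjr : j = r := by
        by_contra hne
        exact hbot (hj r hr.le (Ne.symm hne)).symm
      exact (hj (r + 1) hr (by omega)).symm
    rw [if_neg hbot, if_pos htop] at hcard
    have n1 : ℓ (k + 1) r ≠ ℓ (k + 1) (r + 1) := by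
      intro h; rw [if_pos h] at hcard; split_ifs at hcard <;> omega
    have n3 : ℓ k r ≠ ℓ k (r + 1) := by
      intro h; rw [if_pos h] at hcard; split_ifs at hcard <;> omega
    have e1 := hfs (horEdge hk hr.le hbot, true) (verEdge hk hr n1, true)
      (by rw [face_horEdge_true, h3]) (by rw [face_horEdge_true, face_verEdge_true]) rfl
    have n2' : ℓ (N - (N - 1 - k)) r ≠ ℓ (N - (N - 1 - k + 1)) r := by
      rw [ek, ek']; exact fun h => hbot h.symm
    have n3' : ℓ (N - (N - 1 - k + 1)) r ≠ ℓ (N - (N - 1 - k + 1)) (r + 1) := by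
      rw [ek']; exact n3
    have e2 := hfs' (horEdge hk' hr.le n2', true) (verEdge hk' hr n3', true)
      (by rw [face_horEdge_true, hcard']) (by rw [face_horEdge_true, face_verEdge_true]) rfl
    apply hcon (hR.dart (horEdge hk hr.le hbot, true))
    have e3 : (hR.dart (horEdge hk hr.le hbot, true)).symm =
        hR'.dart (horEdge hk' hr.le n2', true) := by
      refine dart_ext ?_ ?_
      · change ℓ (k + 1) r = ℓ (N - (N - 1 - k)) r
        rw [ek]
      · change ℓ k r = ℓ (N - (N - 1 - k + 1)) r
        rw [ek']
    rw [e3, e1, e2]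
    change ℓ (k + 1) (r + 1) = ℓ (N - (N - 1 - k + 1)) (r + 1)
    rw [ek', htop]

end

/-! ### Realizing the edges of a labelled grid by darts of a map -/

section

variable {V D : Type*} {M : CombMap V D}

/-- The darts at which a sequence of vertices changes follow the boundary of a face. -/
theorem CombMap.exists_root [DecidableEq V] (P : ℕ → V) (od : ℕ → D) (n : ℕ)
    (htail : ∀ i < n, P i ≠ P (i + 1) → M.tail (od i) = P i)
    (hhead : ∀ i < n, P i ≠ P (i + 1) → M.head (od i) = P (i + 1))
    (hnext : ∀ i < n, P i ≠ P (i + 1) → ∀ j < n, P j ≠ P (j + 1) → P j = P (i + 1) →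
      M.face (od i) = od j)
    (hex : ∃ i, i < n ∧ P i ≠ P (i + 1)) :
    ∃ root, (∃ i < n, P i ≠ P (i + 1) ∧ root = od i) ∧ ∀ i ≤ n,
      M.tail ((M.face ^ Nat.count (fun j => P j ≠ P (j + 1)) i) root) = P i ∧
      (i < n → P i ≠ P (i + 1) →
        od i = (M.face ^ Nat.count (fun j => P j ≠ P (j + 1)) i) root) := by
  let i₀ := Nat.find hex
  have hi₀ : i₀ < n ∧ P i₀ ≠ P (i₀ + 1) := Nat.find_spec hex
  have hmin : ∀ i < i₀, P i = P (i + 1) := by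
    intro i hi
    by_contra hne
    exact Nat.find_min hex hi ⟨hi.trans hi₀.1, hne⟩
  let c : ℕ → ℕ := Nat.count fun j => P j ≠ P (j + 1)
  -- After the first change, `j` is the most recent one, and its dart is the power of `face`
  -- numbered by the changes made before it.
  have inv : ∀ i ≤ n, (i ≤ i₀ ∧ c i = 0 ∧ P i = P 0) ∨
      ∃ m, c i = m + 1 ∧ ∃ j < i, P j ≠ P (j + 1) ∧ od j = (M.face ^ m) (od i₀) ∧
        P i = P (j + 1) := by
    intro i
    induction i with
    | zero => intro _; exact Or.inl ⟨Nat.zero_le _, Nat.count_zero _, rfl⟩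
    | succ i ih =>
      intro hi
      have hc : c (i + 1) = c i + if P i ≠ P (i + 1) then 1 else 0 := Nat.count_succ _ _
      rcases ih (by omega) with ⟨h1, h2, h3⟩ | ⟨m, h1, j, hj, h2, h3, h4⟩
      · rcases lt_or_eq_of_le h1 with hlt | heq
        · left
          rw [if_neg (not_not.2 (hmin i hlt))] at hc
          exact ⟨hlt, by omega, by rw [← hmin i hlt, h3]⟩
        · right
          have := hi₀.2
          rw [← heq] at this
          rw [if_pos this] at hc
          exact ⟨0, by omega, i, by omega, this, by rw [heq]; rfl, rfl⟩
      · right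
        by_cases hne : P i = P (i + 1)
        · rw [if_neg (not_not.2 hne)] at hc
          exact ⟨m, by omega, j, by omega, h2, h3, by rw [← hne, h4]⟩
        · rw [if_pos hne] at hc
          refine ⟨m + 1, by omega, i, by omega, hne, ?_, rfl⟩
          rw [pow_succ', Equiv.Perm.mul_apply, ← h3]
          exact (hnext j (by omega) h2 i (by omega) hne h4).symm
  refine ⟨od i₀, ⟨i₀, hi₀.1, hi₀.2, rfl⟩, fun i hi => ?_⟩
  change M.tail ((M.face ^ c i) (od i₀)) = P i ∧ (i < n → P i ≠ P (i + 1) →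
    od i = (M.face ^ c i) (od i₀))
  rcases inv i hi with ⟨h1, h2, h3⟩ | ⟨m, h1, j, hj, h2, h3, h4⟩
  · rw [h2, pow_zero, Equiv.Perm.one_apply]
    constructor
    · rw [htail _ hi₀.1 hi₀.2, h3]
      rcases inv i₀ hi₀.1.le with ⟨-, -, h⟩ | ⟨m, -, j, hj, h, -⟩
      · exact h
      · exact absurd (hmin j hj) h
    · intro _ hne
      rcases lt_or_eq_of_le h1 with hlt | heq
      · exact absurd (hmin i hlt) hne
      · rw [heq]
  · rw [h1, pow_succ', Equiv.Perm.mul_apply, ← h3]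
    constructor
    · rw [M.tail_face, M.tail_rev, hhead j (by omega) h2, h4]
    · intro hin hne
      exact (hnext j (by omega) h2 i hin hne h4).symm

end

/-- An assignment of darts of a map with an outer face to the bichromatic edges of a labelled
grid: squares with two bichromatic sides are contracted, those with three are inner faces, and
the boundary of the grid is the outer face. -/
structure DartRealization {V D : Type*} (M : CombMap V D) (o : D) (N h : ℕ) (ℓ : ℕ → ℕ → V) where
  dart : BichromaticEdge ℓ N h × Bool → D
  dart_not : ∀ b s, dart (b, !s) = M.rev (dart (b, s))
  tail_dart : ∀ a, M.tail (dart a) = (gridSystem ℓ N h).src a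
  two : ∀ a a', (gridSystem ℓ N h).face a ≠ none →
    ((gridSystem ℓ N h).fiber ((gridSystem ℓ N h).face a)).card = 2 →
    (gridSystem ℓ N h).face a' = (gridSystem ℓ N h).face a → a ≠ a' →
    dart a' = M.rev (dart a)
  three : ∀ a a', (gridSystem ℓ N h).face a ≠ none →
    ((gridSystem ℓ N h).fiber ((gridSystem ℓ N h).face a)).card = 3 →
    (gridSystem ℓ N h).face a' = (gridSystem ℓ N h).face a →
    (gridSystem ℓ N h).src a' = (gridSystem ℓ N h).tgt a → M.face (dart a) = dart a'
  inner : ∀ a, (gridSystem ℓ N h).face a ≠ none →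
    ((gridSystem ℓ N h).fiber ((gridSystem ℓ N h).face a)).card = 3 →
    ¬ M.face.SameCycle o (dart a)
  cover : ∀ d, ¬ M.face.SameCycle o d → ∃ a, (gridSystem ℓ N h).face a ≠ none ∧
    ((gridSystem ℓ N h).fiber ((gridSystem ℓ N h).face a)).card = 3 ∧
    M.face.SameCycle (dart a) d ∧ ∀ a', (gridSystem ℓ N h).face a' ≠ none →
      ((gridSystem ℓ N h).fiber ((gridSystem ℓ N h).face a')).card = 3 →
      M.face.SameCycle (dart a') d → (gridSystem ℓ N h).face a' = (gridSystem ℓ N h).face a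
  outer : ∀ a a', (gridSystem ℓ N h).face a = none → (gridSystem ℓ N h).face a' = none →
    (gridSystem ℓ N h).src a' = (gridSystem ℓ N h).tgt a → M.face (dart a) = dart a'
  outer_sameCycle : ∀ a, (gridSystem ℓ N h).face a = none → M.face.SameCycle o (dart a)
  period : ∀ a, (gridSystem ℓ N h).face a = none →
    Function.minimalPeriod M.face (dart a) = ((gridSystem ℓ N h).fiber none).card

namespace DartRealization

variable {V D : Type*} {M : CombMap V D} {o : D} {N h : ℕ} {ℓ : ℕ → ℕ → V}

theorem head_dart (R : DartRealization M o N h ℓ) (a : BichromaticEdge ℓ N h × Bool) :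
    M.head (R.dart a) = (gridSystem ℓ N h).tgt a := by
  obtain ⟨b, s⟩ := a
  rw [← M.tail_rev, ← R.dart_not, R.tail_dart]
  rfl

open Classical in
/-- The dart of a horizontal edge. -/
noncomputable def hor (R : DartRealization M o N h ℓ) (k r : ℕ) : D :=
  if hb : (k < N ∧ r ≤ h) ∧ ℓ k r ≠ ℓ (k + 1) r then
    R.dart (horEdge hb.1.1 hb.1.2 hb.2, true) else o

open Classical in
/-- The dart of a vertical edge. -/
noncomputable def ver (R : DartRealization M o N h ℓ) (k r : ℕ) : D :=
  if hb : (k ≤ N ∧ r < h) ∧ ℓ k r ≠ ℓ k (r + 1) then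
    R.dart (verEdge hb.1.1 hb.1.2 hb.2, true) else o

open Classical in
/-- The walk along a vertical edge. -/
noncomputable def seg (R : DartRealization M o N h ℓ) (k r : ℕ) : List D :=
  if ℓ k r = ℓ k (r + 1) then [] else [R.ver k r]

open Classical in
/-- The flip of a square. -/
noncomputable def flips (R : DartRealization M o N h ℓ) (k r : ℕ) (d : D) : ℤ :=
  if ∃ a, (gridSystem ℓ N h).face a = square N h k r ∧
    ((gridSystem ℓ N h).fiber (square N h k r)).card = 3 ∧ M.face.SameCycle (R.dart a) d
  then 1 else 0

variable (R : DartRealization M o N h ℓ) {k r : ℕ}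

theorem hor_eq (hk : k < N) (hr : r ≤ h) (hne : ℓ k r ≠ ℓ (k + 1) r) :
    R.hor k r = R.dart (horEdge hk hr hne, true) := dif_pos ⟨⟨hk, hr⟩, hne⟩

theorem rev_hor (hk : k < N) (hr : r ≤ h) (hne : ℓ k r ≠ ℓ (k + 1) r) :
    M.rev (R.hor k r) = R.dart (horEdge hk hr hne, false) := by
  rw [R.hor_eq hk hr hne, ← R.dart_not]
  rfl

theorem ver_eq (hk : k ≤ N) (hr : r < h) (hne : ℓ k r ≠ ℓ k (r + 1)) :
    R.ver k r = R.dart (verEdge hk hr hne, true) := dif_pos ⟨⟨hk, hr⟩, hne⟩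

theorem rev_ver (hk : k ≤ N) (hr : r < h) (hne : ℓ k r ≠ ℓ k (r + 1)) :
    M.rev (R.ver k r) = R.dart (verEdge hk hr hne, false) := by
  rw [R.ver_eq hk hr hne, ← R.dart_not]
  rfl

theorem square_ne_none (hk : k < N) (hr : r < h) : square N h k r ≠ none := by
  rw [Ne, square_eq_none]
  exact not_not.2 ⟨hk, hr⟩

theorem flips_eq_zero (h3 : ((gridSystem ℓ N h).fiber (square N h k r)).card ≠ 3) :
    R.flips k r = 0 := by
  funext d
  exact if_neg fun ⟨_, _, h, _⟩ => h3 h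

theorem flips_eq (hS : (gridSystem ℓ N h).IsPlanar) (hk : k < N) (hr : r < h)
    (h3 : ((gridSystem ℓ N h).fiber (square N h k r)).card = 3)
    {a : BichromaticEdge ℓ N h × Bool} (ha : (gridSystem ℓ N h).face a = square N h k r) :
    R.flips k r = M.flip (R.dart a) := by
  classical
  have hsame : ∀ b, (gridSystem ℓ N h).face b = square N h k r →
      M.face.SameCycle (R.dart a) (R.dart b) := by
    intro b hb
    have hn := square_ne_none hk hr
    obtain ⟨a', m', e'⟩ := hS.exists_next (FaceSystem.mem_fiber.2 ha)
    obtain ⟨a'', m'', hall, e1, e2⟩ := hS.of_card_three h3 (FaceSystem.mem_fiber.2 ha) m' e'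
    have f' := FaceSystem.mem_fiber.1 m'
    have f'' := FaceSystem.mem_fiber.1 m''
    have s1 := R.three a a' (by rwa [ha]) (by rwa [ha]) (by rw [ha, f']) e'
    have s2 := R.three a' a'' (by rwa [f']) (by rwa [f']) (by rw [f'', f']) e1
    rcases hall b (FaceSystem.mem_fiber.2 hb) with rfl | rfl | rfl
    · exact Equiv.Perm.SameCycle.refl _ _
    · rw [← s1, Equiv.Perm.sameCycle_apply_right]
    · rw [← s2, ← s1, Equiv.Perm.sameCycle_apply_right, Equiv.Perm.sameCycle_apply_right]
  funext d
  rw [flips, CombMap.flip]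
  congr 1
  refine propext ⟨fun ⟨b, h1, _, h2⟩ => (hsame b h1).trans h2, fun h => ⟨a, ha, h3, h⟩⟩

theorem two_square (hk : k < N) (hr : r < h)
    (h2 : ((gridSystem ℓ N h).fiber (square N h k r)).card = 2)
    {a a' : BichromaticEdge ℓ N h × Bool} (ha : (gridSystem ℓ N h).face a = square N h k r)
    (ha' : (gridSystem ℓ N h).face a' = square N h k r) (hne : a ≠ a') :
    R.dart a' = M.rev (R.dart a) :=
  R.two a a' (by rw [ha]; exact square_ne_none hk hr) (by rwa [ha]) (by rw [ha, ha']) hne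

theorem three_square (hk : k < N) (hr : r < h)
    (h3 : ((gridSystem ℓ N h).fiber (square N h k r)).card = 3)
    {a a' : BichromaticEdge ℓ N h × Bool} (ha : (gridSystem ℓ N h).face a = square N h k r)
    (ha' : (gridSystem ℓ N h).face a' = square N h k r)
    (he : (gridSystem ℓ N h).src a' = (gridSystem ℓ N h).tgt a) :
    M.face (R.dart a) = R.dart a' :=
  R.three a a' (by rw [ha]; exact square_ne_none hk hr) (by rwa [ha]) (by rw [ha, ha']) he

theorem horEdge_ne_verEdge {k' r' : ℕ} (hk : k < N) (hr : r ≤ h) (hne : ℓ k r ≠ ℓ (k + 1) r)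
    (hk' : k' ≤ N) (hr' : r' < h) (hne' : ℓ k' r' ≠ ℓ k' (r' + 1)) (s s' : Bool) :
    (horEdge hk hr hne, s) ≠ (verEdge hk' hr' hne', s') := fun he => by
  have := congrArg (fun x : BichromaticEdge ℓ N h × Bool => x.1.1.1) he
  simp [horEdge, verEdge] at this

theorem seg_of_eq (he : ℓ k r = ℓ k (r + 1)) : R.seg k r = [] := if_pos he

theorem seg_of_ne (hne : ℓ k r ≠ ℓ k (r + 1)) : R.seg k r = [R.ver k r] := if_neg hne

theorem flat (hk : k < N) (hr : r < h) (h0 : ℓ k r = ℓ (k + 1) r)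
    (h1 : ℓ k (r + 1) = ℓ (k + 1) (r + 1)) :
    R.seg k r = R.seg (k + 1) r ∧ R.flips k r = 0 := by
  classical
  have hcard := card_fiber_square (ℓ := ℓ) hk hr
  rw [if_pos h0, if_pos h1] at hcard
  constructor
  · by_cases hne : ℓ k r = ℓ k (r + 1)
    · rw [R.seg_of_eq hne, R.seg_of_eq (by rw [← h0, ← h1, hne])]
    · have hne' : ℓ (k + 1) r ≠ ℓ (k + 1) (r + 1) := by rwa [← h0, ← h1]
      rw [if_neg hne, if_neg hne'] at hcard
      rw [R.seg_of_ne hne, R.seg_of_ne hne', R.ver_eq hk hr hne',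
        R.two_square hk hr hcard (face_verEdge_false hk.le hr hne) (face_verEdge_true hk hr hne')
          fun h => by simpa using congrArg (fun x => x.2) h, ← R.rev_ver, M.rev_rev]
  · apply R.flips_eq_zero
    rw [hcard]
    split_ifs <;> omega

/-- The three cases of `LowStep` correspond to the other bichromatic sides: the right one only, the
left one only, or both. In the first two the square is a digon and its sides are the same edge; in
the last it is an inner triangle. -/
theorem low (hS : (gridSystem ℓ N h).IsPlanar) (hk : k < N) (hr : r < h)
    (h0 : ℓ k r ≠ ℓ (k + 1) r) (h1 : ℓ k (r + 1) = ℓ (k + 1) (r + 1)) :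
    M.LowStep o (R.hor k r) (R.seg k r) (R.seg (k + 1) r) (R.flips k r) := by
  classical
  have hcard := card_fiber_square (ℓ := ℓ) hk hr
  rw [if_neg h0, if_pos h1] at hcard
  by_cases hl : ℓ k r = ℓ k (r + 1)
  · have hne : ℓ (k + 1) r ≠ ℓ (k + 1) (r + 1) := by rw [← h1, ← hl]; exact h0.symm
    rw [if_pos hl, if_neg hne] at hcard
    refine Or.inl ⟨R.seg_of_eq hl, ?_, R.flips_eq_zero (by omega)⟩
    rw [R.seg_of_ne hne, R.ver_eq hk hr hne, R.hor_eq hk hr.le h0,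
      R.two_square hk hr hcard (face_horEdge_true hk hr.le h0) (face_verEdge_true hk hr hne)
        (horEdge_ne_verEdge _ _ _ _ _ _ _ _)]
  by_cases hr' : ℓ (k + 1) r = ℓ (k + 1) (r + 1)
  · rw [if_neg hl, if_pos hr'] at hcard
    refine Or.inr (Or.inl ⟨?_, R.seg_of_eq hr', R.flips_eq_zero (by omega)⟩)
    rw [R.seg_of_ne hl, ← M.rev_rev (R.ver k r), R.rev_ver hk.le hr hl, R.hor_eq hk hr.le h0,
      R.two_square hk hr hcard (face_horEdge_true hk hr.le h0) (face_verEdge_false hk.le hr hl)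
        (horEdge_ne_verEdge _ _ _ _ _ _ _ _), M.rev_rev]
  · rw [if_neg hl, if_neg hr'] at hcard
    have e1 := R.three_square hk hr hcard (face_horEdge_true hk hr.le h0)
      (face_verEdge_true hk hr hr') rfl
    have e2 := R.three_square hk hr hcard (face_verEdge_true hk hr hr')
      (face_verEdge_false hk.le hr hl) h1
    have e3 := R.three_square hk hr hcard (face_verEdge_false hk.le hr hl)
      (face_horEdge_true hk hr.le h0) rfl
    refine Or.inr (Or.inr ⟨?_, ?_, ?_, ?_, ?_⟩)
    · rw [R.seg_of_ne hl, R.hor_eq hk hr.le h0, e1, e2, ← R.rev_ver, M.rev_rev]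
    · rw [R.seg_of_ne hr', R.hor_eq hk hr.le h0, e1, R.ver_eq hk hr hr']
    · rw [R.hor_eq hk hr.le h0]
      exact R.flips_eq hS hk hr hcard (face_horEdge_true hk hr.le h0)
    · rw [R.hor_eq hk hr.le h0]
      exact R.inner _ (by rw [face_horEdge_true]; exact square_ne_none hk hr)
        (by rw [face_horEdge_true, hcard])
    · rw [R.hor_eq hk hr.le h0, e1, e2, e3]

theorem up (hS : (gridSystem ℓ N h).IsPlanar) (hk : k < N) (hr : r < h)
    (h0 : ℓ k r = ℓ (k + 1) r) (h1 : ℓ k (r + 1) ≠ ℓ (k + 1) (r + 1)) :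
    M.UpStep o (R.hor k (r + 1)) (R.seg k r) (R.seg (k + 1) r) (R.flips k r) := by
  classical
  have hcard := card_fiber_square (ℓ := ℓ) hk hr
  rw [if_pos h0, if_neg h1] at hcard
  by_cases hl : ℓ k r = ℓ k (r + 1)
  · have hne : ℓ (k + 1) r ≠ ℓ (k + 1) (r + 1) := by rw [← h0, hl]; exact h1
    rw [if_pos hl, if_neg hne] at hcard
    refine Or.inl ⟨R.seg_of_eq hl, ?_, R.flips_eq_zero (by omega)⟩
    rw [R.seg_of_ne hne, R.ver_eq hk hr hne, ← M.rev_rev (R.hor k (r + 1)), R.rev_hor hk hr h1,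
      R.two_square hk hr hcard (face_horEdge_false hk hr h1) (face_verEdge_true hk hr hne)
        (horEdge_ne_verEdge _ _ _ _ _ _ _ _)]
  by_cases hr' : ℓ (k + 1) r = ℓ (k + 1) (r + 1)
  · rw [if_neg hl, if_pos hr'] at hcard
    refine Or.inr (Or.inl ⟨?_, R.seg_of_eq hr', R.flips_eq_zero (by omega)⟩)
    rw [R.seg_of_ne hl, ← M.rev_rev (R.ver k r), R.rev_ver hk.le hr hl, R.rev_hor hk hr h1,
      R.two_square hk hr hcard (face_horEdge_false hk hr h1) (face_verEdge_false hk.le hr hl)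
        (horEdge_ne_verEdge _ _ _ _ _ _ _ _), M.rev_rev]
  · rw [if_neg hl, if_neg hr'] at hcard
    have e1 := R.three_square hk hr hcard (face_horEdge_false hk hr h1)
      (face_verEdge_false hk.le hr hl) rfl
    have e2 := R.three_square hk hr hcard (face_verEdge_false hk.le hr hl)
      (face_verEdge_true hk hr hr') h0.symm
    have e3 := R.three_square hk hr hcard (face_verEdge_true hk hr hr')
      (face_horEdge_false hk hr h1) rfl
    refine Or.inr (Or.inr ⟨?_, ?_, ?_, ?_, ?_⟩)
    · rw [R.seg_of_ne hl, R.rev_hor hk hr h1, e1, ← R.rev_ver, M.rev_rev]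
    · rw [R.seg_of_ne hr', R.rev_hor hk hr h1, e1, e2, R.ver_eq hk hr hr']
    · rw [R.rev_hor hk hr h1]
      exact R.flips_eq hS hk hr hcard (face_horEdge_false hk hr h1)
    · rw [R.rev_hor hk hr h1]
      exact R.inner _ (by rw [face_horEdge_false]; exact square_ne_none hk hr)
        (by rw [face_horEdge_false, hcard])
    · rw [R.rev_hor hk hr h1, e1, e2, e3]

/-- Every inner face is realized by exactly one triangular square, and that square is flipped once.
-/
theorem sum_flips (d : D) (hd : ¬ M.face.SameCycle o d) :
    ∑ k ∈ Finset.range N, ∑ r ∈ Finset.range h, R.flips k r d = 1 := by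
  classical
  obtain ⟨a, h1, h2, h3, h4⟩ := R.cover d hd
  obtain ⟨p, hp⟩ := Option.ne_none_iff_exists'.1 h1
  rw [eq_square] at hp
  have hflips : ∀ k < N, ∀ r < h, R.flips k r d = if k = p.1 ∧ r = p.2 then 1 else 0 := by
    intro k hk r hr
    rw [flips]
    congr 1
    refine propext ⟨?_, ?_⟩
    · rintro ⟨b, e1, e2, e3⟩
      have := h4 b (by rw [e1]; exact square_ne_none hk hr) (by rwa [e1]) e3
      rw [e1, hp, square_inj p.1.2 p.2.2] at this
      exact this
    · rintro ⟨rfl, rfl⟩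
      exact ⟨a, hp, by rwa [← hp], h3⟩
  rw [Finset.sum_eq_single_of_mem (p.1 : ℕ) (Finset.mem_range.2 p.1.2),
    Finset.sum_eq_single_of_mem (p.2 : ℕ) (Finset.mem_range.2 p.2.2),
    hflips _ p.1.2 _ p.2.2, if_pos ⟨rfl, rfl⟩]
  · intro r hr hne
    rw [hflips _ p.1.2 _ (Finset.mem_range.1 hr), if_neg fun h => hne h.2]
  · intro k hk hne
    refine Finset.sum_eq_zero fun r hr => ?_
    rw [hflips _ (Finset.mem_range.1 hk) _ (Finset.mem_range.1 hr), if_neg fun h => hne h.1]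

end DartRealization

/-! ### The boundary of the grid as the outer face -/

namespace DartRealization

variable {V D : Type*} {M : CombMap V D} {o : D} {N h : ℕ} {ℓ : ℕ → ℕ → V}

/-- The labels on the top row from left to right, then on the bottom row from right to left. -/
def boundaryLabel (ℓ : ℕ → ℕ → V) (N h i : ℕ) : V := if i ≤ N then ℓ i h else ℓ (2 * N - i) 0

/-- The darts along the top row from left to right, then along the bottom row from right to
left. -/
noncomputable def boundaryDart (R : DartRealization M o N h ℓ) (i : ℕ) : D :=
  if i < N then R.hor i h else M.rev (R.hor (2 * N - 1 - i) 0)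

theorem boundaryLabel_top {k : ℕ} (hk : k ≤ N) : boundaryLabel ℓ N h k = ℓ k h := if_pos hk

theorem boundaryLabel_bottom {G : SimpleGraph V} (hl : Sweep G N h ℓ) {k i : ℕ} (hk : k ≤ N)
    (hi : i + k = 2 * N) : boundaryLabel ℓ N h i = ℓ k 0 := by
  rw [boundaryLabel]
  split_ifs with hN
  · obtain rfl : i = k := by omega
    obtain rfl : i = N := by omega
    rw [hl.last h le_rfl, hl.last 0 (Nat.zero_le _)]
  · congr 1
    omega

/-- The first and last columns are constant, so only the top and bottom rows contribute to the outer
face. -/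
theorem face_eq_none {G : SimpleGraph V} (hl : Sweep G N h ℓ)
    (a : BichromaticEdge ℓ N h × Bool) :
    (gridSystem ℓ N h).face a = none ↔ ∃ k, ∃ hk : k < N,
      (∃ hne : ℓ k h ≠ ℓ (k + 1) h, a = (horEdge hk le_rfl hne, true)) ∨
      ∃ hne : ℓ k 0 ≠ ℓ (k + 1) 0, a = (horEdge hk (Nat.zero_le _) hne, false) := by
  constructor
  · obtain ⟨⟨⟨_ | _, k, r⟩, ⟨hk, hr⟩, hne⟩, _ | _⟩ := a
    · intro ha
      change (if r = 0 then none else square N h k (r - 1)) = none at ha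
      split_ifs at ha with h0
      · subst h0
        exact ⟨k, hk, Or.inr ⟨hne, rfl⟩⟩
      · rw [square_eq_none] at ha
        exact absurd ⟨hk, by omega⟩ ha
    · intro ha
      have ha' := square_eq_none.1 ha
      obtain rfl : r = h := by
        by_contra hne
        exact ha' ⟨hk, by omega⟩
      exact ⟨k, hk, Or.inl ⟨hne, rfl⟩⟩
    · intro ha
      have ha' := square_eq_none.1 ha
      obtain rfl : k = N := by
        by_contra hne
        exact ha' ⟨by omega, hr⟩
      exact absurd ((hl.last r hr.le).trans (hl.last (r + 1) hr).symm) hne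
    · intro ha
      change (if k = 0 then none else square N h (k - 1) r) = none at ha
      split_ifs at ha with h0
      · subst h0
        exact absurd ((hl.first r hr.le).trans (hl.first (r + 1) hr).symm) hne
      · rw [square_eq_none] at ha
        exact absurd ⟨by omega, hr⟩ ha
  · rintro ⟨k, hk, ⟨hne, rfl⟩ | ⟨hne, rfl⟩⟩
    · rw [face_horEdge_true, square_eq_none]
      omega
    · rfl

variable (R : DartRealization M o N h ℓ)

/-- The position of an outer dart on the boundary. -/
def boundaryIndex (N : ℕ) (a : BichromaticEdge ℓ N h × Bool) : ℕ :=
  if a.2 then a.1.1.2.1 else 2 * N - 1 - a.1.1.2.1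

theorem exists_boundaryEdge {G : SimpleGraph V} (hl : Sweep G N h ℓ) {i : ℕ} (hi : i < 2 * N)
    (hne : boundaryLabel ℓ N h i ≠ boundaryLabel ℓ N h (i + 1)) :
    ∃ a, (gridSystem ℓ N h).face a = none ∧ (gridSystem ℓ N h).src a = boundaryLabel ℓ N h i ∧
      (gridSystem ℓ N h).tgt a = boundaryLabel ℓ N h (i + 1) ∧ R.boundaryDart i = R.dart a ∧
      boundaryIndex N a = i := by
  by_cases hiN : i < N
  · rw [boundaryLabel_top hiN.le, boundaryLabel_top hiN] at hne ⊢
    exact ⟨(horEdge hiN le_rfl hne, true), (face_eq_none hl _).2 ⟨i, hiN, Or.inl ⟨hne, rfl⟩⟩, rfl,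
      rfl, by rw [boundaryDart, if_pos hiN, R.hor_eq hiN le_rfl hne], rfl⟩
  · obtain ⟨k, hk⟩ : ∃ k, i + 1 + k = 2 * N := ⟨2 * N - 1 - i, by omega⟩
    have hkN : k < N := by omega
    rw [boundaryLabel_bottom hl (show k + 1 ≤ N by omega) (by omega),
      boundaryLabel_bottom hl hkN.le hk] at hne ⊢
    have e : 2 * N - 1 - i = k := by omega
    refine ⟨(horEdge hkN (Nat.zero_le _) hne.symm, false),
      (face_eq_none hl _).2 ⟨k, hkN, Or.inr ⟨hne.symm, rfl⟩⟩, rfl, rfl, ?_, ?_⟩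
    · rw [boundaryDart, if_neg hiN, e, R.rev_hor hkN (Nat.zero_le _) hne.symm]
    · change 2 * N - 1 - k = i
      omega

/-- With `period`, this shows that one tour of the grid boundary goes around the outer face exactly
once, so that `s` ends where `t` began. -/
theorem card_outer [DecidableEq V] {G : SimpleGraph V} (hl : Sweep G N h ℓ) :
    Nat.count (fun i => boundaryLabel ℓ N h i ≠ boundaryLabel ℓ N h (i + 1)) (2 * N) =
      ((gridSystem ℓ N h).fiber none).card := by
  rw [Nat.count_eq_card_filter_range]
  symm
  refine Finset.card_bij (fun a _ => boundaryIndex N a) ?_ ?_ ?_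
  · intro a ha
    rw [Finset.mem_filter, Finset.mem_range]
    obtain ⟨k, hk, ⟨hne, rfl⟩ | ⟨hne, rfl⟩⟩ := (face_eq_none hl a).1 (FaceSystem.mem_fiber.1 ha)
    · change k < 2 * N ∧ boundaryLabel ℓ N h k ≠ boundaryLabel ℓ N h (k + 1)
      rw [boundaryLabel_top hk.le, boundaryLabel_top hk]
      exact ⟨by omega, hne⟩
    · change 2 * N - 1 - k < 2 * N ∧
        boundaryLabel ℓ N h (2 * N - 1 - k) ≠ boundaryLabel ℓ N h (2 * N - 1 - k + 1)
      rw [boundaryLabel_bottom hl (show k + 1 ≤ N from hk) (by omega),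
        boundaryLabel_bottom hl hk.le (by omega)]
      exact ⟨by omega, hne.symm⟩
  · intro a ha b hb hab
    obtain ⟨k, hk, ⟨hne, rfl⟩ | ⟨hne, rfl⟩⟩ := (face_eq_none hl a).1 (FaceSystem.mem_fiber.1 ha) <;>
    obtain ⟨k', hk', ⟨hne', rfl⟩ | ⟨hne', rfl⟩⟩ :=
      (face_eq_none hl b).1 (FaceSystem.mem_fiber.1 hb)
    · change k = k' at hab
      subst hab
      rfl
    · change k = 2 * N - 1 - k' at hab
      omega
    · change 2 * N - 1 - k = k' at hab
      omega
    · change 2 * N - 1 - k = 2 * N - 1 - k' at hab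
      obtain rfl : k = k' := by omega
      rfl
  · intro i hi
    rw [Finset.mem_filter, Finset.mem_range] at hi
    by_cases hiN : i < N
    · have hne := hi.2
      rw [boundaryLabel_top hiN.le, boundaryLabel_top hiN] at hne
      exact ⟨(horEdge hiN le_rfl hne, true), FaceSystem.mem_fiber.2
        ((face_eq_none hl _).2 ⟨i, hiN, Or.inl ⟨hne, rfl⟩⟩), rfl⟩
    · have hne := hi.2
      obtain ⟨k, hk⟩ : ∃ k, i + 1 + k = 2 * N := ⟨2 * N - 1 - i, by omega⟩
      have hkN : k < N := by omega
      rw [boundaryLabel_bottom hl (show k + 1 ≤ N by omega) (by omega),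
        boundaryLabel_bottom hl hkN.le hk] at hne
      refine ⟨(horEdge hkN (Nat.zero_le _) hne.symm, false), FaceSystem.mem_fiber.2
        ((face_eq_none hl _).2 ⟨k, hkN, Or.inr ⟨hne.symm, rfl⟩⟩), ?_⟩
      change 2 * N - 1 - k = i
      omega

theorem exists_boundaryLabel_ne {G : SimpleGraph V} (hl : Sweep G N h ℓ) :
    ∃ i, i < 2 * N ∧ boundaryLabel ℓ N h i ≠ boundaryLabel ℓ N h (i + 1) := by
  by_contra! hcon
  have hconst : ∀ i ≤ 2 * N, boundaryLabel ℓ N h i = ℓ 0 0 := by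
    intro i
    induction i with
    | zero =>
      intro _
      rw [boundaryLabel_top (Nat.zero_le _), hl.first h le_rfl]
    | succ i ih =>
      intro hi
      rw [← hcon i (by omega), ih (by omega)]
  obtain ⟨k, hk, h1 | h1⟩ := hl.boundary
  · exact h1 ((boundaryLabel_bottom hl hk (show 2 * N - k + k = 2 * N by omega)).symm.trans
      (hconst _ (by omega)))
  · exact h1 ((boundaryLabel_top hk).symm.trans (hconst _ (by omega)))

/-- The realization of a sweep. -/
theorem nonempty_realization (R : DartRealization M o N h ℓ) {G : SimpleGraph V} (hl : Sweep G N h ℓ) :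
    Nonempty (Realization M o N h ℓ) := by
  classical
  have hS := hl.toGridLabelling.isPlanar
  let c : ℕ → ℕ := Nat.count fun i => boundaryLabel ℓ N h i ≠ boundaryLabel ℓ N h (i + 1)
  obtain ⟨root, ⟨i₀, hi₀, hne₀, hroot⟩, H⟩ := M.exists_root (boundaryLabel ℓ N h) R.boundaryDart
    (2 * N)
    (fun i hi hne => by
      obtain ⟨a, -, h2, -, h4, -⟩ := R.exists_boundaryEdge hl hi hne
      rw [h4, R.tail_dart, h2])
    (fun i hi hne => by
      obtain ⟨a, -, -, h3, h4, -⟩ := R.exists_boundaryEdge hl hi hne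
      rw [h4, R.head_dart, h3])
    (fun i hi hne j hj hne' he => by
      obtain ⟨a, h1, -, h3, h4, -⟩ := R.exists_boundaryEdge hl hi hne
      obtain ⟨b, h1', h2', -, h4', -⟩ := R.exists_boundaryEdge hl hj hne'
      rw [h4, h4', R.outer a b h1 h1' (by rw [h2', h3, he])])
    (exists_boundaryLabel_ne hl)
  obtain ⟨a₀, h1, -, -, h4, -⟩ := R.exists_boundaryEdge hl hi₀ hne₀
  rw [h4] at hroot
  have hper : Function.minimalPeriod M.face root = c (2 * N) := by
    rw [hroot, R.period a₀ h1, ← card_outer hl]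
  have hmono : Monotone c := Nat.count_monotone _
  have hlt : ∀ i j, i < j → boundaryLabel ℓ N h i ≠ boundaryLabel ℓ N h (i + 1) → c i < c j :=
    fun i j hij hne => Nat.count_strict_mono hne hij
  refine ⟨{ hor := R.hor, seg := R.seg, flips := R.flips
            hor_tail := fun k r hk hr hne => by rw [R.hor_eq hk hr hne, R.tail_dart]; rfl
            hor_head := fun k r hk hr hne => by rw [R.hor_eq hk hr hne, R.head_dart]; rfl
            seg_walk := fun k r hk hr => ?_
            seg_length := fun k r => ?_
            seg_nil := fun k r he => R.seg_of_eq he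
            flat := fun k r hk hr => R.flat hk hr
            up := fun k r hk hr => R.up hS hk hr
            low := fun k r hk hr => R.low hS hk hr
            root := root
            root_outer := by rw [hroot]; exact R.outer_sameCycle a₀ h1
            -- The number of label changes on the top row: the top row traces `t`, and the bottom
            -- row, read backwards, traces `s`.
            cut := c N
            cut_le := by rw [hper]; exact hmono (by omega)
            bottom := fun k hk hne => ?_
            top := fun k hk hne => ?_
            src_mem := fun k hk => ?_
            tgt_mem := fun k hk => ?_
            first_eq := fun r hr => ?_
            last_eq := fun r hr => ?_
            nontrivial := R.sum_flips }⟩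
  · by_cases hne : ℓ k r = ℓ k (r + 1)
    · rw [R.seg_of_eq hne]
      exact hne
    · rw [R.seg_of_ne hne, R.ver_eq hk hr hne]
      exact ⟨R.tail_dart _, R.head_dart _⟩
  · rw [seg]
    split_ifs <;> simp
  · have hne' : boundaryLabel ℓ N h (2 * N - 1 - k) ≠ boundaryLabel ℓ N h (2 * N - 1 - k + 1) := by
      rw [boundaryLabel_bottom hl (show k + 1 ≤ N from hk) (by omega),
        boundaryLabel_bottom hl hk.le (by omega)]
      exact hne.symm
    refine ⟨c (2 * N - 1 - k), hmono (by omega), ?_, ?_⟩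
    · rw [hper]
      exact hlt _ _ (by omega) hne'
    · rw [← (H (2 * N - 1 - k) (by omega)).2 (by omega) hne', boundaryDart, if_neg (by omega)]
      congr 2
      omega
  · have hne' : boundaryLabel ℓ N h k ≠ boundaryLabel ℓ N h (k + 1) := by
      rwa [boundaryLabel_top hk.le, boundaryLabel_top hk]
    refine ⟨c k, Nat.zero_le _, hlt _ _ hk hne', ?_⟩
    rw [← (H k (by omega)).2 (by omega) hne', boundaryDart, if_pos hk]
  · refine ⟨c (2 * N - k), hmono (by omega), ?_, ?_⟩
    · rw [hper]
      exact hmono (by omega)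
    · rw [(H (2 * N - k) (by omega)).1, boundaryLabel_bottom hl hk (by omega)]
  · refine ⟨c k, Nat.zero_le _, hmono hk, ?_⟩
    rw [(H k (by omega)).1, boundaryLabel_top hk]
  · have h0 := (H 0 (Nat.zero_le _)).1
    rw [Nat.count_zero, pow_zero, Equiv.Perm.one_apply, boundaryLabel_top (Nat.zero_le _)] at h0
    rw [h0, hl.first r hr, hl.first h le_rfl]
  · rw [(H N (by omega)).1, boundaryLabel_top le_rfl, hl.last r hr, hl.last h le_rfl]

end DartRealization

/-! ### Outer boundary of degree three: a face of the triangulation -/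

section

variable {V : Type*} {G : SimpleGraph V} {N h : ℕ} {ℓ : ℕ → ℕ → V}

theorem sameCycle_of_comm {A D : Type*} [Finite D] {f : Equiv.Perm A} {g : Equiv.Perm D} {ι : A → D}
    (hι : Function.Injective ι) (hc : ∀ d, g (ι d) = ι (f d)) {d d' : A}
    (hs : g.SameCycle (ι d) (ι d')) : f.SameCycle d d' := by
  obtain ⟨i, hi⟩ := hs.exists_nat_pow_eq
  have hpow : ∀ i : ℕ, (g ^ i) (ι d) = ι ((f ^ i) d) := by
    intro i
    induction i with
    | zero => rfl
    | succ i ih => rw [pow_succ', pow_succ', Equiv.Perm.mul_apply, Equiv.Perm.mul_apply, ih, hc]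
  rw [hpow] at hi
  exact ⟨i, by rw [zpow_natCast]; exact hι hi⟩

theorem sameCycle_of_three {D : Type*} {f : Equiv.Perm D} {x y : D}
    (hy : y = x ∨ y = f x ∨ y = f (f x)) : f.SameCycle x y := by
  rcases hy with rfl | rfl | rfl
  · exact Equiv.Perm.SameCycle.refl _ _
  · rw [Equiv.Perm.sameCycle_apply_right]
  · rw [Equiv.Perm.sameCycle_apply_right, Equiv.Perm.sameCycle_apply_right]

variable {T : Triangulation G} {hR : (gridSystem ℓ N h).Rigid G}

/-- A face of `T` is followed dart by dart inside one triangular grid face, and each dart belongs to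
only one triangular grid face. -/
theorem IsPositive.face_eq [Finite V] (hP : IsPositive T ℓ N h hR)
    (hS : (gridSystem ℓ N h).IsPlanar) {a a' : BichromaticEdge ℓ N h × Bool}
    (ha : ((gridSystem ℓ N h).fiber ((gridSystem ℓ N h).face a)).card = 3)
    (ha' : ((gridSystem ℓ N h).fiber ((gridSystem ℓ N h).face a')).card = 3)
    (hs : T.face.SameCycle (hR.dart a) (hR.dart a')) :
    (gridSystem ℓ N h).face a' = (gridSystem ℓ N h).face a := by
  have : Finite G.Dart := Finite.of_injective _ SimpleGraph.Dart.toProd_injective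
  obtain ⟨i, hi⟩ := hs.exists_nat_pow_eq
  have hpow : ∀ i : ℕ, ∃ b, (gridSystem ℓ N h).face b = (gridSystem ℓ N h).face a ∧
      (T.face ^ i) (hR.dart a) = hR.dart b := by
    intro i
    induction i with
    | zero => exact ⟨a, rfl, rfl⟩
    | succ i ih =>
      obtain ⟨b, h1, h2⟩ := ih
      obtain ⟨b', h3, h4⟩ := hS.exists_next (FaceSystem.mem_fiber.2 (rfl : _ = _) :
        b ∈ (gridSystem ℓ N h).fiber ((gridSystem ℓ N h).face b))
      have h5 := FaceSystem.mem_fiber.1 h3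
      exact ⟨b', h5.trans h1, by
        rw [pow_succ', Equiv.Perm.mul_apply, h2, hP b b' (by rwa [h1]) h5 h4]⟩
  obtain ⟨b, h1, h2⟩ := hpow i
  rw [hR.eq_of_dart_eq ha' (by rwa [h1]) (hi.symm.trans h2), h1]

theorem IsPositive.sameCycle (hP : IsPositive T ℓ N h hR)
    (hS : (gridSystem ℓ N h).IsPlanar) {a a' : BichromaticEdge ℓ N h × Bool}
    (ha : ((gridSystem ℓ N h).fiber ((gridSystem ℓ N h).face a)).card = 3)
    (hs : (gridSystem ℓ N h).face a' = (gridSystem ℓ N h).face a) :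
    T.face.SameCycle (hR.dart a) (hR.dart a') := by
  obtain ⟨b, m1, e1⟩ := hS.exists_next (FaceSystem.mem_fiber.2 (rfl : _ = _) :
    a ∈ (gridSystem ℓ N h).fiber ((gridSystem ℓ N h).face a))
  obtain ⟨c, m2, hall, e2, -⟩ := hS.of_card_three ha (FaceSystem.mem_fiber.2 rfl) m1 e1
  have f1 := FaceSystem.mem_fiber.1 m1
  have f2 := FaceSystem.mem_fiber.1 m2
  have s1 := hP a b ha f1 e1
  have s2 := hP b c (by rwa [f1]) (f2.trans f1.symm) e2
  apply sameCycle_of_three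
  rcases hall a' (FaceSystem.mem_fiber.2 hs) with rfl | rfl | rfl
  · exact Or.inl rfl
  · exact Or.inr (Or.inl s1.symm)
  · exact Or.inr (Or.inr (by rw [s1, s2]))

theorem FaceSystem.Rigid.dart_not (hR : (gridSystem ℓ N h).Rigid G) (b : BichromaticEdge ℓ N h)
    (s : Bool) : hR.dart (b, !s) = (hR.dart (b, s)).symm := by
  cases s <;> rfl

theorem FaceSystem.Rigid.dart_eq_symm (hR : (gridSystem ℓ N h).Rigid G)
    (hS : (gridSystem ℓ N h).IsPlanar) {a a' : BichromaticEdge ℓ N h × Bool}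
    (h2 : ((gridSystem ℓ N h).fiber ((gridSystem ℓ N h).face a)).card = 2)
    (hf : (gridSystem ℓ N h).face a' = (gridSystem ℓ N h).face a) (hne : a ≠ a') :
    hR.dart a' = (hR.dart a).symm := by
  obtain ⟨b, -, -, hall, e1, e2⟩ := hS.of_card_two h2 (FaceSystem.mem_fiber.2 (rfl : _ = _))
  rcases hall a' (FaceSystem.mem_fiber.2 hf) with rfl | rfl
  · exact absurd rfl hne
  · exact dart_ext e1 e2

/-- The realization of a grid whose boundary has three bichromatic edges. -/
theorem IsPositive.nonempty_dartRealization_three [Finite V] (hP : IsPositive T ℓ N h hR)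
    (hS : (gridSystem ℓ N h).IsPlanar) (h3 : ((gridSystem ℓ N h).fiber none).card = 3) :
    ∃ o : G.Dart, Nonempty (DartRealization T.toMap o N h ℓ) := by
  obtain ⟨a₀, ha₀⟩ : ((gridSystem ℓ N h).fiber none).Nonempty := Finset.card_pos.1 (by omega)
  have f₀ := FaceSystem.mem_fiber.1 ha₀
  refine ⟨hR.dart a₀, ⟨{ dart := hR.dart
                         dart_not := hR.dart_not
                         tail_dart := fun a => rfl
                         two := fun a a' _ h2 hf hne => hR.dart_eq_symm hS h2 hf hne
                         three := fun a a' _ => hP a a'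
                         inner := fun a hn ha hs => hn ?_
                         cover := fun d hd => ?_
                         outer := fun a a' hn hn' => hP a a' (by rw [hn, h3]) (hn'.trans hn.symm)
                         outer_sameCycle := fun a hn => ?_
                         period := fun a hn => ?_ }⟩⟩
  · rw [hP.face_eq hS (by rw [f₀, h3]) ha hs, f₀]
  · obtain ⟨a, rfl, ha⟩ := hR.exists_dart_eq d
    refine ⟨a, fun hn => hd ?_, ha, Equiv.Perm.SameCycle.refl _ _, fun a' _ ha' hs =>
      (hP.face_eq hS ha' ha hs).symm⟩
    exact hP.sameCycle hS (by rw [f₀, h3]) (hn.trans f₀.symm)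
  · exact hP.sameCycle hS (by rw [f₀, h3]) (hn.trans f₀.symm)
  · rw [h3]
    have : Fact (Nat.Prime 3) := ⟨Nat.prime_three⟩
    exact Function.minimalPeriod_eq_prime (T.face_three _) (T.face_ne _)

end

/-! ### Darts after doubling an edge -/

section

variable {V : Type*} {G : SimpleGraph V} (T : Triangulation G) (e : G.Dart)

open Classical in
/-- The darts of a triangulation as darts of its faces after doubling an edge. -/
noncomputable def doubleDart (d : G.Dart) : G.Dart ⊕ Bool :=
  if d = e.symm then .inr true else .inl d

theorem doubleDart_injective : Function.Injective (doubleDart e) := by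
  intro d d' hd
  unfold doubleDart at hd
  split_ifs at hd with h1 h2 h2
  · rw [h1, h2]
  · exact Sum.inl_injective hd

/-- Away from the new digon, doubling changes the faces only by a renaming: the triangle to the left
of `e.symm` now uses the new dart `inr true`. -/
theorem doubleFace_doubleDart (d : G.Dart) :
    doubleFace T e (doubleDart e d) = doubleDart e (T.face d) := by
  by_cases h1 : d = e.symm
  · rw [doubleDart, if_pos h1, doubleFace_newRev, doubleDart, if_neg, h1]
    rw [h1]
    exact T.face_ne _
  · rw [doubleDart, if_neg h1]
    by_cases h2 : T.face d = e.symm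
    · rw [(doubleFace_old T e d h1).1 h2, doubleDart, if_pos h2]
    · rw [(doubleFace_old T e d h1).2 h2, doubleDart, if_neg h2]

theorem sameCycle_double [Finite V] {x : G.Dart ⊕ Bool} :
    (doubleFace T e).SameCycle (.inr false) x ↔ x = .inr false ∨ x = .inl e.symm := by
  have : Finite G.Dart := Finite.of_injective _ SimpleGraph.Dart.toProd_injective
  constructor
  · intro hs
    obtain ⟨i, hi⟩ := hs.exists_nat_pow_eq
    rw [← hi]
    clear hi
    induction i with
    | zero => exact Or.inl rfl
    | succ i ih =>
      rw [pow_succ', Equiv.Perm.mul_apply]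
      rcases ih with h | h
      · rw [h, doubleFace_new]
        exact Or.inr rfl
      · rw [h, doubleFace_symm]
        exact Or.inl rfl
  · rintro (rfl | rfl)
    · exact Equiv.Perm.SameCycle.refl _ _
    · rw [← doubleFace_new T e, Equiv.Perm.sameCycle_apply_right]

theorem not_sameCycle_doubleDart [Finite V] (d : G.Dart) :
    ¬ (doubleFace T e).SameCycle (.inr false) (doubleDart e d) := by
  rw [sameCycle_double, doubleDart]
  split_ifs with hd
  · simp
  · simpa using hd

theorem exists_doubleDart_eq [Finite V] {x : G.Dart ⊕ Bool}
    (hx : ¬ (doubleFace T e).SameCycle (.inr false) x) : ∃ d, doubleDart e d = x := by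
  rw [sameCycle_double] at hx
  rcases x with d | _ | _
  · exact ⟨d, if_neg fun hd => hx (Or.inr (by rw [hd]))⟩
  · exact absurd (Or.inl rfl) hx
  · exact ⟨e.symm, if_pos rfl⟩

open Classical in
/-- The dart of the doubled edge that belongs to one of the two copies of a dart. -/
noncomputable def doubleCopy (e d : G.Dart) (p : Prop) : G.Dart ⊕ Bool :=
  if p ∧ d = e then .inr false else if p ∧ d = e.symm then .inr true else .inl d

theorem doubleCopy_symm (d : G.Dart) (p : Prop) :
    doubleCopy e d.symm p = doubleRev (doubleCopy e d p) := by
  have h0 : d.symm = e ↔ d = e.symm :=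
    ⟨fun h => by rw [← h, SimpleGraph.Dart.symm_symm], fun h => by rw [h, SimpleGraph.Dart.symm_symm]⟩
  have h1 : d.symm = e.symm ↔ d = e :=
    ⟨fun h => by rw [← d.symm_symm, h, SimpleGraph.Dart.symm_symm], fun h => by rw [h]⟩
  by_cases hp : p
  · by_cases h2 : d = e
    · have h3 : d ≠ e.symm := by rw [h2]; exact e.symm_ne.symm
      rw [doubleCopy, doubleCopy, if_neg fun h => h3 (h0.1 h.2), if_pos ⟨hp, h1.2 h2⟩,
        if_pos ⟨hp, h2⟩]
      rfl
    · by_cases h3 : d = e.symm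
      · rw [doubleCopy, doubleCopy, if_pos ⟨hp, h0.2 h3⟩, if_neg fun h => h2 h.2, if_pos ⟨hp, h3⟩]
        rfl
      · rw [doubleCopy, doubleCopy, if_neg fun h => h3 (h0.1 h.2), if_neg fun h => h2 (h1.1 h.2),
          if_neg fun h => h2 h.2, if_neg fun h => h3 h.2]
        rfl
  · rw [doubleCopy, doubleCopy, if_neg fun h => hp h.1, if_neg fun h => hp h.1,
      if_neg fun h => hp h.1, if_neg fun h => hp h.1]
    rfl

theorem doubleTail_doubleCopy (d : G.Dart) (p : Prop) : doubleTail e (doubleCopy e d p) = d.fst := by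
  unfold doubleCopy
  split_ifs with h1 h2
  · rw [h1.2]; rfl
  · rw [h2.2]; rfl
  · rfl

end

/-! ### Outer boundary of degree two, and the conclusion for sweeps -/

section

variable {V : Type*} {G : SimpleGraph V} {N h : ℕ} {ℓ : ℕ → ℕ → V}
  {T : Triangulation G} {hR : (gridSystem ℓ N h).Rigid G}

/-- The realization of a grid whose boundary has two bichromatic edges. -/
theorem IsPositive.nonempty_dartRealization_two [Finite V] (hP : IsPositive T ℓ N h hR)
    (hS : (gridSystem ℓ N h).IsPlanar) (hc : ((gridSystem ℓ N h).fiber none).card = 2) :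
    ∃ e : G.Dart, Nonempty (DartRealization (T.double e) (Sum.inr false) N h ℓ) := by
  have : Finite G.Dart := Finite.of_injective _ SimpleGraph.Dart.toProd_injective
  obtain ⟨a₀, ha₀⟩ : ((gridSystem ℓ N h).fiber none).Nonempty := Finset.card_pos.1 (by omega)
  have f₀ := FaceSystem.mem_fiber.1 ha₀
  obtain ⟨κ, hκ₁, hκ₂, hκ₃⟩ := hR.copies a₀ (by rw [f₀, hc])
  rw [f₀] at hκ₁ hκ₂
  obtain ⟨a₁, ha₁, hne, hall, e1, e2⟩ := hS.of_card_two hc ha₀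
  have f₁ := FaceSystem.mem_fiber.1 ha₁
  have hsymm : hR.dart a₁ = (hR.dart a₀).symm := dart_ext e1 e2
  let e := hR.dart a₀
  -- The outer digon cuts the chain of copies of the doubled edge. Copies on the side of `a₀` become
  -- the new edge, those on the other side the old one, and `κ` from `copies` tells the sides apart.
  -- Inner digons never straddle the cut.
  let δ : BichromaticEdge ℓ N h × Bool → G.Dart ⊕ Bool := fun a =>
    doubleCopy e (hR.dart a) (κ a.1 = κ a₀.1)
  have hδ₀ : δ a₀ = .inr false := if_pos ⟨rfl, rfl⟩
  have hδ₁ : δ a₁ = .inl e.symm := by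
    have := hκ₂ a₁ e1 e2 f₁
    change doubleCopy e (hR.dart a₁) (κ a₁.1 = κ a₀.1) = _
    rw [doubleCopy, if_neg fun h => this h.1, if_neg fun h => this h.1, hsymm]
  -- The last clause of `copies` ensures that triangles use `e` in the old copy and `e.symm` in the
  -- new one, which is how the inner faces of the doubled map are bounded.
  have hδ : ∀ a, ((gridSystem ℓ N h).fiber ((gridSystem ℓ N h).face a)).card = 3 →
      δ a = doubleDart e (hR.dart a) := by
    intro a ha
    have h1 : hR.dart a = e → κ a.1 ≠ κ a₀.1 := fun hd =>
      (hκ₃ a ha).1 (congrArg (fun d : G.Dart => d.fst) hd) (congrArg (fun d : G.Dart => d.snd) hd)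
    have h2 : hR.dart a = e.symm → κ a.1 = κ a₀.1 := fun hd =>
      (hκ₃ a ha).2 (congrArg (fun d : G.Dart => d.fst) hd) (congrArg (fun d : G.Dart => d.snd) hd)
    change doubleCopy e (hR.dart a) (κ a.1 = κ a₀.1) = _
    rw [doubleCopy, doubleDart, if_neg fun hh => h1 hh.2 hh.1]
    by_cases hd : hR.dart a = e.symm
    · rw [if_pos ⟨h2 hd, hd⟩, if_pos hd]
    · rw [if_neg fun hh => hd hh.2, if_neg hd]
  have houter : ∀ a, (gridSystem ℓ N h).face a = none → a = a₀ ∨ a = a₁ := fun a ha =>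
    hall a (FaceSystem.mem_fiber.2 ha)
  refine ⟨e, ⟨{ dart := δ
                dart_not := fun b s => ?_
                tail_dart := fun a => doubleTail_doubleCopy e _ _
                two := fun a a' hn h2 hf hne' => ?_
                three := fun a a' hn h3 hf he => ?_
                inner := fun a hn ha => ?_
                cover := fun d hd => ?_
                outer := fun a a' hn hn' he => ?_
                outer_sameCycle := fun a hn => ?_
                period := fun a hn => ?_ }⟩⟩
  · change doubleCopy e (hR.dart (b, !s)) _ = doubleRev (doubleCopy e (hR.dart (b, s)) _)
    rw [← doubleCopy_symm, hR.dart_not]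
  · change doubleCopy e (hR.dart a') _ = doubleRev (doubleCopy e (hR.dart a) _)
    rw [← doubleCopy_symm, ← hR.dart_eq_symm hS h2 hf hne', hκ₁ _ hn h2 a
      (FaceSystem.mem_fiber.2 rfl) a' (FaceSystem.mem_fiber.2 hf)]
  · rw [hδ a h3, hδ a' (by rwa [hf]), ← hP a a' h3 hf he]
    exact doubleFace_doubleDart T e _
  · rw [hδ a ha]
    exact not_sameCycle_doubleDart T e _
  · obtain ⟨d, rfl⟩ := exists_doubleDart_eq T e hd
    obtain ⟨a, rfl, ha⟩ := hR.exists_dart_eq d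
    refine ⟨a, fun hn => ?_, ha, ?_, fun a' _ ha' hs => ?_⟩
    · rw [hn] at ha
      omega
    · rw [hδ a ha]
    · rw [hδ a' ha'] at hs
      exact (hP.face_eq hS ha' ha (sameCycle_of_comm (doubleDart_injective e)
        (doubleFace_doubleDart T e) hs)).symm
  · rcases houter a hn with rfl | rfl <;> rcases houter a' hn' with rfl | rfl
    · exact absurd he ((gridSystem ℓ N h).src_ne_tgt _)
    · rw [hδ₀, hδ₁]
      exact doubleFace_new T e
    · rw [hδ₀, hδ₁]
      exact doubleFace_symm T e
    · exact absurd he ((gridSystem ℓ N h).src_ne_tgt _)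
  · refine (sameCycle_double T e).2 ?_
    rcases houter a hn with rfl | rfl
    · exact Or.inl hδ₀
    · exact Or.inr hδ₁
  · rw [hc]
    have : Fact (Nat.Prime 2) := ⟨Nat.prime_two⟩
    rcases houter a hn with rfl | rfl
    · rw [hδ₀]
      refine Function.minimalPeriod_eq_prime ?_ fun hf => ?_
      · change doubleFace T e (doubleFace T e (.inr false)) = .inr false
        rw [doubleFace_new, doubleFace_symm]
      · exact absurd ((doubleFace_new T e).symm.trans hf) (by simp)
    · rw [hδ₁]
      refine Function.minimalPeriod_eq_prime ?_ fun hf => ?_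
      · change doubleFace T e (doubleFace T e (.inl e.symm)) = .inl e.symm
        rw [doubleFace_symm, doubleFace_new]
      · exact absurd ((doubleFace_symm T e).symm.trans hf) (by simp)

/-- A sweep yields a homotopy. -/
theorem Sweep.homotopyHeight_le [Finite V] (T : Triangulation G) (hl : Sweep G N h ℓ) :
    homotopyHeight T ≤ (h + 1 : ℕ) := by
  obtain ⟨ℓ', hl', hR, hP⟩ := hl.exists_isPositive T
  have hS := hl'.toGridLabelling.isPlanar
  have hh : 1 ≤ h := by
    obtain ⟨k, r, -, hr, -⟩ := hl'.toGridLabelling.exists_square T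
    omega
  -- Degree zero would mean a monochromatic grid boundary, which the channel construction has
  -- excluded.
  have hout : ((gridSystem ℓ' N h).fiber none).card ≠ 0 := by
    classical
    rw [← DartRealization.card_outer hl', Nat.count_eq_card_filter_range, Finset.card_ne_zero]
    obtain ⟨i, h1, h2⟩ := DartRealization.exists_boundaryLabel_ne hl'
    exact ⟨i, Finset.mem_filter.2 ⟨Finset.mem_range.2 h1, h2⟩⟩
  rcases hR.card_fiber none with h0 | h2 | h3
  · exact absurd h0 hout
  · obtain ⟨e, ⟨R⟩⟩ := hP.nonempty_dartRealization_two hS h2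
    obtain ⟨R'⟩ := R.nonempty_realization hl'
    obtain ⟨H, hH⟩ := R'.exists_homotopy hh hl'.step
    exact inf_le_right.trans ((iInf₂_le e H).trans (Nat.cast_le.2 hH))
  · obtain ⟨o, ⟨R⟩⟩ := hP.nonempty_dartRealization_three hS h3
    obtain ⟨R'⟩ := R.nonempty_realization hl'
    obtain ⟨H, hH⟩ := R'.exists_homotopy hh hl'.step
    exact inf_le_left.trans ((iInf₂_le o H).trans (Nat.cast_le.2 hH))

end

end GridHomotopy

theorem mainTheorem4 {V : Type*} [Finite V] (G : SimpleGraph V)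
    (T : GridHomotopy.Triangulation G) :
    GridHomotopy.homotopyHeight T ≤ GridHomotopy.gridMajorHeight G := by
  refine le_iInf fun W => le_iInf fun H => le_iInf fun R => ?_
  obtain ⟨d⟩ := T.nonempty_dart
  -- A labelled point shows that both dimensions of the grid are positive.
  obtain ⟨⟨p, q⟩, -⟩ := R.surjective d.fst
  obtain ⟨N, rfl⟩ : ∃ N, W = N + 1 := ⟨W - 1, by have := p.2; omega⟩
  obtain ⟨h, rfl⟩ : ∃ h, H = h + 1 := ⟨H - 1, by have := q.2; omega⟩
  obtain ⟨N', ℓ, hl⟩ := R.exists_sweep ⟨d.edge, d.edge_mem⟩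
  exact hl.homotopyHeight_le T
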